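/- \textbf{Notation.} Matrix indices $i,j$ run over $\{-1,1\}$. The Yangian $\mathrm Y(2)$ is the unital associative $\mathbb C$-algebra with generators $t_{ij}^{(r)}$, $r\ge 0$, and relations $t^{(0)}_{ij}=\delta_{ij}$ and $$[t^{(r+1)}_{ij},t^{(s)}_{kl}]-[t^{(r)}_{ij},t^{(s+1)}_{kl}]=t^{(r)}_{kj}t^{(s)}_{il}-t^{(s)}_{kj}t^{(r)}_{il};$$ put $t_{ij}(u)=\sum_r t^{(r)}_{ij}u^{-r}$, $T(u)=(t_{ij}(u))$, with coproduct $\Delta(t_{ij}(u))=\sum_a t_{ia}(u)\otimes t_{aj}(u)$. Let $\theta_{ij}=ij$ in the case of $\mathrm Y^-(2)$ and $\theta_{ij}=1$ in the case of $\mathrm Y^+(2)$, let $(E_{ij})^t=\theta_{ij}E_{-j,-i}$, and let $S(u)=T(u)T^t(-u)$, that is, $s_{ij}(u)=\sum_a\theta_{aj}\,t_{ia}(u)t_{-j,-a}(-u)=\sum_M s_{ij}^{(M)}u^{-M}$. The twisted Yangian $\mathrm Y^{\mp}(2)\subset\mathrm Y(2)$ is the subalgebra generated by all $s_{ij}^{(M)}$;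 it is a left coideal: $\Delta(\mathrm Y^\mp(2))\subset \mathrm Y(2)\otimes\mathrm Y^\mp(2)$. The Bethe subalgebra $\mathcal B^{\mp}\subset\mathrm Y^{\mp}(2)$ is the subalgebra generated by the coefficients of $$\sigma_1(u)=\operatorname{tr}\bigl(A_2\,S_1(u)\,R^t(3-2u)\,C_2\bigr),\qquad \sigma_2(u)=\operatorname{tr}\bigl(A_2\,S_1(u)\,R^t(1-2u)\,S_2(u-1)\bigr),$$ where the traces are over $\mathbb C^2\otimes\mathbb C^2$, lower indices indicate the tensor factor, $A_2=\frac12\bigl(1-\sum E_{ij}\otimes E_{ji}\bigr)$, $R^t(x)=1-x^{-1}\sum E_{ij}^t\otimes E_{ji}$ and $C=E_{11}-E_{-1,-1}$. For $\alpha-\beta\in\mathbb Z_{\ge0}$ let $L(\alpha,\beta)$ be the irreducible $\mathfrak{gl}_2$-module of highest weight $(\alpha,\beta)$, made a $\mathrm Y(2)$-module by $t_{ij}(u)\mapsto\delta_{ij}+E_{ij}u^{-1}$. For $\delta\in\mathbb C$ let $W(\delta)$ be the one-dimensional $\mathrm Y^+(2)$-module with $s_{11}(u)=\frac{u+\delta}{u+1/2}$,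 $s_{-1,-1}(u)=\frac{u-\delta+1}{u+1/2}$, $s_{1,-1}(u)=s_{-1,1}(u)=0$. Fix $k\ge1$ and $\alpha_i,\beta_i\in\mathbb C$ with $\alpha_i-\beta_i\in\mathbb Z_{\ge0}$ $(1\le i\le k)$, and for $z_1,\dots,z_k\in\mathbb C$ put $$L(z_1,\dots,z_k)=\bigotimes_{i=1}^kL(z_i+\alpha_i,z_i+\beta_i),\qquad L'(z_1,\dots,z_k,\delta)=L(z_1,\dots,z_k)\otimes W(\delta),$$ the first being restricted to $\mathrm Y^-(2)$ in part (1). If $\alpha_1-\beta_1\ge1$, let $L''(z_1,\dots,z_k,\delta)$ be defined like $L'(z_1,\dots,z_k,\delta)$ but with first factor $L(z_1+\alpha_1-1,z_1+\beta_1)$; if $\alpha_1=\beta_1$, put $L''=0$. A subalgebra $\mathcal B$ acts on a finite-dimensional module with \emph{simple spectrum} if the module has a basis of common eigenvectors of $\mathcal B$ in which different basis vectors have different systems of eigenvalues. \textbf{Corollary (simple spectrum for large $t$).} Let $u_1,\dots,u_k\in\mathbb C$ satisfy $u_i^2\ne u_j^2$ for $i\ne j$. Then there is $R>0$ (depending on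 $k$, the $u_i$, $\alpha_i$, $\beta_i$) such that for all $t\in\mathbb C$ with $|t|>R$ and $z_i=tu_i$: \begin{enumerate} \item $\mathcal B^-$ acts with simple spectrum on $L(z_1,\dots,z_k)$; \item $\mathcal B^+$ acts with simple spectrum on $L'(z_1,\dots,z_k,1)\oplus L'(z_1,\dots,z_k,0)$; \item if $u_1\neq0$ or $\alpha_1+\beta_1\ne1$, then $\mathcal B^+$ acts with simple spectrum on $L'(z_1,\dots,z_k,\tfrac12)\oplus L'(z_1-1,z_2,\dots,z_k,\tfrac12)$; \item $\mathcal B^+$ acts with simple spectrum on $L'(z_1,\dots,z_k,\tfrac12)\oplus L''(z_1,\dots,z_k,\tfrac12)$. \end{enumerate} -/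

import Mathlib

open scoped TensorProduct

noncomputable section

namespace TwistedBethe

/-! ### Matrices of power series in `u⁻¹`

A series `a₀ + a₁ u⁻¹ + a₂ u⁻² + ⋯` with coefficients in an algebra `A` is the element
`PowerSeries.mk a` of `PowerSeries A`; the formal variable `PowerSeries.X` stands for `u⁻¹`. -/

/-- The index set `{-1, 1}`. -/
abbrev Idx : Type := ℤˣ

/-- The sign `θ_{ij}`: it is `sgn(i) sgn(j)` in the symplectic case (`ε = -1`) and `1` in the
orthogonal case (`ε = 1`). -/
def theta (ε : ℤˣ) (i j : Idx) : ℤ := if ε = -1 then ((i * j : ℤˣ) : ℤ) else 1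

section Series

variable {A : Type*} [Ring A]

/-- The substitution `u ↦ -u`. -/
def negU (f : PowerSeries A) : PowerSeries A :=
  PowerSeries.mk fun n => (-1) ^ n * PowerSeries.coeff n f

/-- The substitution `u ↦ u - 1`, re-expanded in `u⁻¹` by means of
`(u - 1)^{-r} = ∑_{m ≥ r} (m-1 choose m-r) u^{-m}`. -/
def shiftU (f : PowerSeries A) : PowerSeries A :=
  PowerSeries.mk fun m =>
    ∑ r ∈ Finset.range (m + 1), (Nat.choose (m - 1) (m - r)) • PowerSeries.coeff r f

/-- The transposition `(E_{ij})^t = θ_{ij} E_{-j,-i}` on matrices: the `(i,j)` entry of `M^t` is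
`θ_{ij} M_{-j,-i}`. -/
def transp (ε : ℤˣ) (M : Matrix Idx Idx A) : Matrix Idx Idx A :=
  Matrix.of fun i j => theta ε i j • M (-j) (-i)

/-- `S(u) = T(u) T^t(-u)`. -/
def sMatrix (ε : ℤˣ) (T : Matrix Idx Idx (PowerSeries A)) : Matrix Idx Idx (PowerSeries A) :=
  T * transp ε (T.map negU)

end Series

/-! ### The series `σ₁(u, F₁₁)` and `σ₂(u, F₁₁)` attached to an `S`-matrix of size `2`

Operators on `W ⊗ W`, `W = ℂ²`, are matrices indexed by `Idx × Idx`. -/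

/-- The permutation operator `P = ∑ E_{ij} ⊗ E_{ji}`. -/
def permOp : Matrix (Idx × Idx) (Idx × Idx) ℂ :=
  ∑ i : Idx, ∑ j : Idx,
    Matrix.kroneckerMap (· * ·) (Matrix.single i j (1 : ℂ)) (Matrix.single j i (1 : ℂ))

/-- The operator `∑ (E_{ij})^t ⊗ E_{ji}`. -/
def permOpT (ε : ℤˣ) : Matrix (Idx × Idx) (Idx × Idx) ℂ :=
  ∑ i : Idx, ∑ j : Idx,
    Matrix.kroneckerMap (· * ·) (transp ε (Matrix.single i j (1 : ℂ))) (Matrix.single j i (1 : ℂ))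

/-- The normalised antisymmetrizer `A₂ = (1 - P) / 2`. -/
def antisym : Matrix (Idx × Idx) (Idx × Idx) ℂ := (1 / 2 : ℂ) • (1 - permOp)

/-- The expansion of `(c - 2u)⁻¹ = u⁻¹ (c u⁻¹ - 2)⁻¹` in `u⁻¹`. -/
def invAffine (c : ℂ) : PowerSeries ℂ :=
  PowerSeries.X * (PowerSeries.C c * PowerSeries.X - PowerSeries.C 2)⁻¹

/-- `R^t(c - 2u) = 1 - (c - 2u)⁻¹ ∑ (E_{ij})^t ⊗ E_{ji}`. -/
def rMatrixT (ε : ℤˣ) (c : ℂ) : Matrix (Idx × Idx) (Idx × Idx) (PowerSeries ℂ) :=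
  1 - invAffine c • (permOpT ε).map (PowerSeries.C (R := ℂ))

/-- The diagonal matrix `F₁₁ = E₁₁ - E_{-1,-1}`. -/
def fMatrix : Matrix Idx Idx ℂ := Matrix.diagonal fun i => (((i : ℤˣ) : ℤ) : ℂ)

section Sigma

variable {A : Type*} [Ring A] [Algebra ℂ A]

/-- A matrix with complex entries, regarded as a matrix over `A[[u⁻¹]]`. -/
def liftConst {m : Type*} (M : Matrix m m ℂ) : Matrix m m (PowerSeries A) :=
  M.map fun c => PowerSeries.C (algebraMap ℂ A c)

/-- A matrix with entries in `ℂ[[u⁻¹]]`, regarded as a matrix over `A[[u⁻¹]]`. -/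
def liftSeries {m : Type*} (M : Matrix m m (PowerSeries ℂ)) : Matrix m m (PowerSeries A) :=
  M.map (PowerSeries.map (algebraMap ℂ A))

/-- A matrix acting on the first tensor factor of `W ⊗ W`. -/
def onFirst (M : Matrix Idx Idx (PowerSeries A)) :
    Matrix (Idx × Idx) (Idx × Idx) (PowerSeries A) :=
  Matrix.kroneckerMap (· * ·) M (1 : Matrix Idx Idx (PowerSeries A))

/-- A matrix acting on the second tensor factor of `W ⊗ W`. -/
def onSecond (M : Matrix Idx Idx (PowerSeries A)) :
    Matrix (Idx × Idx) (Idx × Idx) (PowerSeries A) :=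
  Matrix.kroneckerMap (· * ·) (1 : Matrix Idx Idx (PowerSeries A)) M

/-- `σ₁(u, F₁₁) = tr (A₂ S₁(u) R^t(3 - 2u) C₂)` with `C = F₁₁`. -/
def sigmaOne (ε : ℤˣ) (S : Matrix Idx Idx (PowerSeries A)) : PowerSeries A :=
  Matrix.trace
    (liftConst antisym * onFirst S * liftSeries (rMatrixT ε 3) * onSecond (liftConst fMatrix))

/-- `σ₂(u, F₁₁) = tr (A₂ S₁(u) R^t(1 - 2u) S₂(u - 1))`. -/
def sigmaTwo (ε : ℤˣ) (S : Matrix Idx Idx (PowerSeries A)) : PowerSeries A :=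
  Matrix.trace
    (liftConst antisym * onFirst S * liftSeries (rMatrixT ε 1) * onSecond (S.map shiftU))

end Sigma

/-! ### The Yangian `Y(2)` -/

section RTT

variable {A : Type*} [Ring A]

/-- The defining relations of `Y(2)` for a family `t r i j = t_{ij}^{(r)}`. -/
structure IsRTT (t : ℕ → Idx → Idx → A) : Prop where
  zero : ∀ i j, t 0 i j = if i = j then 1 else 0
  comm : ∀ r s i j k l,
    (t (r + 1) i j * t s k l - t s k l * t (r + 1) i j)
        - (t r i j * t (s + 1) k l - t (s + 1) k l * t r i j)
      = t r k j * t s i l - t s k j * t r i l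

/-- The generating matrix `T(u)` of a family. -/
def genMatrix (t : ℕ → Idx → Idx → A) : Matrix Idx Idx (PowerSeries A) :=
  Matrix.of fun i j => PowerSeries.mk fun r => t r i j

end RTT

/-- The generator `t_{ij}^{(r)}` of the free algebra. -/
def freeGen (r : ℕ) (i j : Idx) : FreeAlgebra ℂ (ℕ × Idx × Idx) := FreeAlgebra.ι ℂ (r, i, j)

/-- The defining relations of `Y(2)`. -/
inductive YangianRel :
    FreeAlgebra ℂ (ℕ × Idx × Idx) → FreeAlgebra ℂ (ℕ × Idx × Idx) → Prop
  | zero (i j : Idx) : YangianRel (freeGen 0 i j) (if i = j then 1 else 0)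
  | comm (r s : ℕ) (i j k l : Idx) : YangianRel
      ((freeGen (r + 1) i j * freeGen s k l - freeGen s k l * freeGen (r + 1) i j)
        - (freeGen r i j * freeGen (s + 1) k l - freeGen (s + 1) k l * freeGen r i j))
      (freeGen r k j * freeGen s i l - freeGen s k j * freeGen r i l)

/-- The Yangian `Y(2)` over `ℂ`. -/
def Yangian : Type := RingQuot YangianRel

instance : Ring Yangian := inferInstanceAs (Ring (RingQuot YangianRel))

instance : Algebra ℂ Yangian := inferInstanceAs (Algebra ℂ (RingQuot YangianRel))

namespace Yangian

/-- The generators `t_{ij}^{(r)}` of `Y(2)`. -/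
def t (r : ℕ) (i j : Idx) : Yangian := RingQuot.mkAlgHom ℂ YangianRel (freeGen r i j)

theorem isRTT_t : IsRTT t where
  zero i j := by
    have h := RingQuot.mkAlgHom_rel ℂ (YangianRel.zero i j)
    rw [apply_ite (RingQuot.mkAlgHom ℂ YangianRel), map_one, map_zero] at h
    exact h
  comm r s i j k l := by
    have h := RingQuot.mkAlgHom_rel ℂ (YangianRel.comm r s i j k l)
    simp only [map_sub, map_mul] at h
    exact h

/-- The universal property of `Y(2)`. -/
def lift {A : Type*} [Ring A] [Algebra ℂ A] (τ : ℕ → Idx → Idx → A) (h : IsRTT τ) :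
    Yangian →ₐ[ℂ] A :=
  RingQuot.liftAlgHom ℂ ⟨FreeAlgebra.lift ℂ (fun p : ℕ × Idx × Idx => τ p.1 p.2.1 p.2.2), by
    intro x y hxy
    induction hxy with
    | zero i j =>
      rw [apply_ite (FreeAlgebra.lift ℂ _), map_one, map_zero]
      simpa [freeGen] using h.zero i j
    | comm r s i j k l => simpa [freeGen] using h.comm r s i j k l⟩

theorem lift_t {A : Type*} [Ring A] [Algebra ℂ A] (τ : ℕ → Idx → Idx → A) (h : IsRTT τ)
    (r : ℕ) (i j : Idx) : lift τ h (t r i j) = τ r i j := by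
  unfold lift t
  erw [RingQuot.liftAlgHom_mkAlgHom_apply]
  simp [freeGen]

end Yangian

/-! ### The coproduct -/

section Coproduct

variable {A : Type*} [Ring A]

/-- The family of coefficients of the product `T'(u) T''(u)`. -/
def mulFamily (t' t'' : ℕ → Idx → Idx → A) (r : ℕ) (i j : Idx) : A :=
  ∑ p ∈ Finset.HasAntidiagonal.antidiagonal r, ∑ a : Idx, t' p.1 i a * t'' p.2 a j

theorem rtt_product_aux {B : Type*} [Ring B] (z w : B) (hz : ∀ b, Commute z b)
    (hw : ∀ b, Commute w b) (u' v' u'' v'' : Idx → Idx → B)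
    (h' : ∀ i j k l, z * (u' i j * v' k l - v' k l * u' i j)
      = w * (u' k j * v' i l - v' k j * u' i l))
    (h'' : ∀ i j k l, z * (u'' i j * v'' k l - v'' k l * u'' i j)
      = w * (u'' k j * v'' i l - v'' k j * u'' i l))
    (c1 : ∀ i j k l, Commute (u'' i j) (v' k l)) (c2 : ∀ i j k l, Commute (v'' i j) (u' k l))
    (i j k l : Idx) :
    z * ((∑ a, u' i a * u'' a j) * (∑ b, v' k b * v'' b l)
        - (∑ b, v' k b * v'' b l) * (∑ a, u' i a * u'' a j))
      = w * ((∑ a, u' k a * u'' a j) * (∑ b, v' i b * v'' b l)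
        - (∑ b, v' k b * v'' b j) * (∑ a, u' i a * u'' a l)) := by
  have key : ∀ a b, z * (u' i a * u'' a j * (v' k b * v'' b l)
      - v' k b * v'' b l * (u' i a * u'' a j))
      = w * (u' k a * u'' a j * (v' i b * v'' b l) - v' k b * v'' b j * (u' i a * u'' a l))
        + w * (v' k b * u' i a * (u'' b j * v'' a l) - v' k a * u' i b * (u'' a j * v'' b l)) := by
    intro a b
    have e1 : z * (u' i a * u'' a j * (v' k b * v'' b l) - v' k b * v'' b l * (u' i a * u'' a j))
        = z * (u' i a * v' k b - v' k b * u' i a) * (u'' a j * v'' b l)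
          + v' k b * u' i a * (z * (u'' a j * v'' b l - v'' b l * u'' a j)) := by
      have q1 : u' i a * u'' a j * (v' k b * v'' b l)
          = u' i a * v' k b * (u'' a j * v'' b l) := by
        rw [mul_assoc, ← mul_assoc (u'' a j), (c1 a j k b).eq]; simp only [mul_assoc]
      have q2 : v' k b * v'' b l * (u' i a * u'' a j)
          = v' k b * u' i a * (v'' b l * u'' a j) := by
        rw [mul_assoc, ← mul_assoc (v'' b l), (c2 b l i a).eq]; simp only [mul_assoc]
      rw [q1, q2, ← mul_assoc (v' k b * u' i a) z, ← (hz (v' k b * u' i a)).eq]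
      noncomm_ring
    rw [e1, h', h'', ← mul_assoc (v' k b * u' i a) w, ← (hw (v' k b * u' i a)).eq]
    have q3 : u' k a * u'' a j * (v' i b * v'' b l)
        = u' k a * v' i b * (u'' a j * v'' b l) := by
      rw [mul_assoc, ← mul_assoc (u'' a j), (c1 a j i b).eq]; simp only [mul_assoc]
    have q4 : v' k b * v'' b j * (u' i a * u'' a l)
        = v' k b * u' i a * (v'' b j * u'' a l) := by
      rw [mul_assoc, ← mul_assoc (v'' b j), (c2 b j i a).eq]; simp only [mul_assoc]
    rw [q3, q4]
    noncomm_ring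
  have swap : ∑ a, ∑ b, v' k b * u' i a * (u'' b j * v'' a l)
      = ∑ a, ∑ b, v' k a * u' i b * (u'' a j * v'' b l) := Finset.sum_comm
  have lhs : z * ((∑ a, u' i a * u'' a j) * (∑ b, v' k b * v'' b l)
        - (∑ b, v' k b * v'' b l) * (∑ a, u' i a * u'' a j))
      = ∑ a, ∑ b, z * (u' i a * u'' a j * (v' k b * v'' b l)
          - v' k b * v'' b l * (u' i a * u'' a j)) := by
    rw [Finset.sum_mul_sum, Finset.sum_mul_sum, Finset.sum_comm (f := fun b a =>
      v' k b * v'' b l * (u' i a * u'' a j))]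
    simp only [Finset.mul_sum, Finset.sum_sub_distrib, mul_sub]
  have rhs : w * ((∑ a, u' k a * u'' a j) * (∑ b, v' i b * v'' b l)
        - (∑ b, v' k b * v'' b j) * (∑ a, u' i a * u'' a l))
      = ∑ a, ∑ b, w * (u' k a * u'' a j * (v' i b * v'' b l)
          - v' k b * v'' b j * (u' i a * u'' a l)) := by
    rw [Finset.sum_mul_sum, Finset.sum_mul_sum, Finset.sum_comm (f := fun b a =>
      v' k b * v'' b j * (u' i a * u'' a l))]
    simp only [Finset.mul_sum, Finset.sum_sub_distrib, mul_sub]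
  rw [lhs, rhs]
  simp only [key, Finset.sum_add_distrib]
  rw [add_eq_left]
  simp only [← Finset.mul_sum, Finset.sum_sub_distrib, swap, sub_self, mul_zero]

/-- A series in the first of two variables. -/
def serX (f : PowerSeries A) : PowerSeries (PowerSeries A) := PowerSeries.C f

/-- A series in the second of two variables. -/
def serY (f : PowerSeries A) : PowerSeries (PowerSeries A) :=
  PowerSeries.map (PowerSeries.C (R := A)) f

theorem coeff_serX_mul_serY (f g : PowerSeries A) (r s : ℕ) :
    PowerSeries.coeff r (PowerSeries.coeff s (serX f * serY g))
      = PowerSeries.coeff r f * PowerSeries.coeff s g := by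
  simp [serX, serY]

theorem coeff_serY_mul_serX (f g : PowerSeries A) (r s : ℕ) :
    PowerSeries.coeff r (PowerSeries.coeff s (serY g * serX f))
      = PowerSeries.coeff s g * PowerSeries.coeff r f := by
  simp [serX, serY]

theorem commute_serX_X (b : PowerSeries (PowerSeries A)) :
    Commute (serX (PowerSeries.X : PowerSeries A)) b := by
  refine PowerSeries.ext fun n => ?_
  simp [serX, PowerSeries.coeff_C_mul, PowerSeries.coeff_mul_C, (PowerSeries.commute_X _).eq]

theorem commute_serY_X (b : PowerSeries (PowerSeries A)) :
    Commute (serY (PowerSeries.X : PowerSeries A)) b := by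
  have : serY (PowerSeries.X : PowerSeries A) = PowerSeries.X := by simp [serY]
  rw [this]
  exact (PowerSeries.commute_X b).symm

theorem coeff_lhs (a b : PowerSeries (PowerSeries A)) (r s : ℕ) :
    PowerSeries.coeff (r + 1) (PowerSeries.coeff (s + 1)
      ((serY (PowerSeries.X : PowerSeries A) - serX PowerSeries.X) * (a - b)))
      = (PowerSeries.coeff (r + 1) (PowerSeries.coeff s a)
          - PowerSeries.coeff (r + 1) (PowerSeries.coeff s b))
        - (PowerSeries.coeff r (PowerSeries.coeff (s + 1) a)
          - PowerSeries.coeff r (PowerSeries.coeff (s + 1) b)) := by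
  have : serY (PowerSeries.X : PowerSeries A) = PowerSeries.X := by simp [serY]
  rw [this, sub_mul]
  simp [serX, PowerSeries.coeff_succ_X_mul, PowerSeries.coeff_C_mul]

theorem coeff_rhs (a b : PowerSeries (PowerSeries A)) (r s : ℕ) :
    PowerSeries.coeff (r + 1) (PowerSeries.coeff (s + 1)
      (serX (PowerSeries.X : PowerSeries A) * serY PowerSeries.X * (a - b)))
      = PowerSeries.coeff r (PowerSeries.coeff s a)
        - PowerSeries.coeff r (PowerSeries.coeff s b) := by
  have : serY (PowerSeries.X : PowerSeries A) = PowerSeries.X := by simp [serY]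
  rw [this, mul_assoc]
  simp [serX, PowerSeries.coeff_succ_X_mul, PowerSeries.coeff_C_mul]

theorem coeff_lhs_zero (a b : PowerSeries (PowerSeries A)) (r : ℕ) :
    PowerSeries.coeff (r + 1) (PowerSeries.coeff 0
      ((serY (PowerSeries.X : PowerSeries A) - serX PowerSeries.X) * (a - b)))
      = -(PowerSeries.coeff r (PowerSeries.coeff 0 a)
          - PowerSeries.coeff r (PowerSeries.coeff 0 b)) := by
  have : serY (PowerSeries.X : PowerSeries A) = PowerSeries.X := by simp [serY]
  rw [this, sub_mul, map_sub, PowerSeries.coeff_zero_X_mul, zero_sub, map_neg, serX,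
    PowerSeries.coeff_C_mul, PowerSeries.coeff_succ_X_mul, map_sub, map_sub]

theorem coeff_lhs_zero_zero (a b : PowerSeries (PowerSeries A)) :
    PowerSeries.coeff 0 (PowerSeries.coeff 0
      ((serY (PowerSeries.X : PowerSeries A) - serX PowerSeries.X) * (a - b))) = 0 := by
  have : serY (PowerSeries.X : PowerSeries A) = PowerSeries.X := by simp [serY]
  rw [this, sub_mul, map_sub, PowerSeries.coeff_zero_X_mul, zero_sub, map_neg, serX,
    PowerSeries.coeff_C_mul, PowerSeries.coeff_zero_X_mul, neg_zero]

theorem coeff_zero_lhs (a b : PowerSeries (PowerSeries A)) (s : ℕ) :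
    PowerSeries.coeff 0 (PowerSeries.coeff (s + 1)
      ((serY (PowerSeries.X : PowerSeries A) - serX PowerSeries.X) * (a - b)))
      = PowerSeries.coeff 0 (PowerSeries.coeff s a)
          - PowerSeries.coeff 0 (PowerSeries.coeff s b) := by
  have : serY (PowerSeries.X : PowerSeries A) = PowerSeries.X := by simp [serY]
  rw [this, sub_mul, map_sub, PowerSeries.coeff_succ_X_mul, map_sub, serX,
    PowerSeries.coeff_C_mul, PowerSeries.coeff_zero_X_mul, sub_zero, map_sub, map_sub]

theorem coeff_genMatrix (t : ℕ → Idx → Idx → A) (r : ℕ) (i j : Idx) :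
    PowerSeries.coeff r (genMatrix t i j) = t r i j := by
  simp [genMatrix]

theorem IsRTT.series {t : ℕ → Idx → Idx → A} (h : IsRTT t) (i j k l : Idx) :
    (serY (PowerSeries.X : PowerSeries A) - serX PowerSeries.X)
        * (serX (genMatrix t i j) * serY (genMatrix t k l)
          - serY (genMatrix t k l) * serX (genMatrix t i j))
      = serX (PowerSeries.X : PowerSeries A) * serY PowerSeries.X
        * (serX (genMatrix t k j) * serY (genMatrix t i l)
          - serY (genMatrix t k j) * serX (genMatrix t i l)) := by
  refine PowerSeries.ext fun s => PowerSeries.ext fun r => ?_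
  have hY : serY (PowerSeries.X : PowerSeries A) = PowerSeries.X := by simp [serY]
  have hcom0 : ∀ i j (a : A), t 0 i j * a = a * t 0 i j := by
    intro i j a
    rw [h.zero]; split_ifs <;> simp
  have hcom0' : ∀ i j (a : A), a * t 0 i j = t 0 i j * a := fun i j a => (hcom0 i j a).symm
  cases s with
  | zero =>
    have hr : PowerSeries.coeff r (PowerSeries.coeff 0
        (serX (PowerSeries.X : PowerSeries A) * serY PowerSeries.X
        * (serX (genMatrix t k j) * serY (genMatrix t i l)
          - serY (genMatrix t k j) * serX (genMatrix t i l)))) = 0 := by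
      rw [(commute_serX_X _).eq, mul_assoc, hY, PowerSeries.coeff_zero_X_mul, map_zero]
    rw [hr]
    cases r with
    | zero => rw [coeff_lhs_zero_zero]
    | succ r =>
      rw [coeff_lhs_zero, coeff_serX_mul_serY, coeff_serY_mul_serX, coeff_genMatrix,
        coeff_genMatrix, hcom0', sub_self, neg_zero]
  | succ s =>
    cases r with
    | zero =>
      have hr : PowerSeries.coeff 0 (PowerSeries.coeff (s + 1)
          (serX (PowerSeries.X : PowerSeries A) * serY PowerSeries.X
          * (serX (genMatrix t k j) * serY (genMatrix t i l)
            - serY (genMatrix t k j) * serX (genMatrix t i l)))) = 0 := by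
        rw [mul_assoc, serX, PowerSeries.coeff_C_mul, PowerSeries.coeff_zero_X_mul]
      rw [hr, coeff_zero_lhs, coeff_serX_mul_serY, coeff_serY_mul_serX, coeff_genMatrix,
        coeff_genMatrix, hcom0, sub_self]
    | succ r =>
      rw [coeff_lhs, coeff_rhs]
      simp only [coeff_serX_mul_serY, coeff_serY_mul_serX, coeff_genMatrix]
      exact h.comm r s i j k l

theorem IsRTT.of_series {t : ℕ → Idx → Idx → A} (h0 : ∀ i j, t 0 i j = if i = j then 1 else 0)
    (h : ∀ i j k l, (serY (PowerSeries.X : PowerSeries A) - serX PowerSeries.X)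
        * (serX (genMatrix t i j) * serY (genMatrix t k l)
          - serY (genMatrix t k l) * serX (genMatrix t i j))
      = serX (PowerSeries.X : PowerSeries A) * serY PowerSeries.X
        * (serX (genMatrix t k j) * serY (genMatrix t i l)
          - serY (genMatrix t k j) * serX (genMatrix t i l))) : IsRTT t := by
  refine ⟨h0, fun r s i j k l => ?_⟩
  have e := congrArg (fun F => PowerSeries.coeff (r + 1) (PowerSeries.coeff (s + 1) F)) (h i j k l)
  simp only [coeff_lhs, coeff_rhs] at e
  simpa only [coeff_serX_mul_serY, coeff_serY_mul_serX, coeff_genMatrix] using e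

theorem genMatrix_mulFamily (t' t'' : ℕ → Idx → Idx → A) :
    genMatrix (mulFamily t' t'') = genMatrix t' * genMatrix t'' := by
  ext i j n
  simp only [genMatrix, mulFamily, Matrix.mul_apply, PowerSeries.coeff_mul, Matrix.of_apply,
    PowerSeries.coeff_mk, map_sum]
  exact Finset.sum_comm

theorem IsRTT.mulFamily {t' t'' : ℕ → Idx → Idx → A} (h' : IsRTT t') (h'' : IsRTT t'')
    (hc : ∀ r s i j k l, Commute (t' r i j) (t'' s k l)) : IsRTT (mulFamily t' t'') := by
  have hX : ∀ r s i j k l,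
      Commute (PowerSeries.coeff r (genMatrix t'' i j)) (PowerSeries.coeff s (genMatrix t' k l)) := by
    intro r s i j k l
    rw [coeff_genMatrix, coeff_genMatrix]
    exact (hc s r k l i j).symm
  refine IsRTT.of_series (fun i j => ?_) (fun i j k l => ?_)
  · have e : TwistedBethe.mulFamily t' t'' 0 i j = ∑ a : Idx, t' 0 i a * t'' 0 a j := by
      simp [TwistedBethe.mulFamily]
    rw [e]
    simp only [h'.zero, h''.zero, ite_mul, one_mul, zero_mul]
    rw [Finset.sum_ite_eq, if_pos (Finset.mem_univ i)]
  · have hp : ∀ i j, serX (genMatrix (TwistedBethe.mulFamily t' t'') i j)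
        = ∑ a, serX (genMatrix t' i a) * serX (genMatrix t'' a j) := by
      intro i j
      rw [genMatrix_mulFamily, Matrix.mul_apply]
      simp only [serX, map_sum, map_mul]
    have hq : ∀ i j, serY (genMatrix (TwistedBethe.mulFamily t' t'') i j)
        = ∑ a, serY (genMatrix t' i a) * serY (genMatrix t'' a j) := by
      intro i j
      rw [genMatrix_mulFamily, Matrix.mul_apply]
      simp only [serY, map_sum, map_mul]
    simp only [hp, hq]
    refine rtt_product_aux _ _ (fun b => ?_) (fun b => ?_) _ _ _ _
      (fun i j k l => h'.series i j k l) (fun i j k l => h''.series i j k l) ?_ ?_ i j k l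
    · exact (commute_serY_X b).sub_left (commute_serX_X b)
    · exact (commute_serX_X b).mul_left (commute_serY_X b)
    · intro i j k l
      refine PowerSeries.ext fun s => PowerSeries.ext fun r => ?_
      rw [coeff_serX_mul_serY, coeff_serY_mul_serX]
      exact hX _ _ _ _ _ _
    · intro i j k l
      refine PowerSeries.ext fun s => PowerSeries.ext fun r => ?_
      rw [coeff_serX_mul_serY, coeff_serY_mul_serX]
      exact hX _ _ _ _ _ _

end Coproduct

section EvaluationFamily

variable {A : Type*} [Ring A] [Algebra ℂ A]

/-- The relations `[E_{ij}, E_{kl}] = δ_{kj} E_{il} - δ_{il} E_{kj}` of `gl₂`. -/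
def IsGL2 (E : Idx → Idx → A) : Prop :=
  ∀ i j k l, E i j * E k l - E k l * E i j
    = (if k = j then E i l else 0) - (if i = l then E k j else 0)

/-- The coefficients of `t_{ij}(u) = δ_{ij} + E_{ij} (u - c)⁻¹`. For `c = 0` this is the evaluation
`t_{ij}(u) ↦ δ_{ij} + E_{ij} u⁻¹`. -/
def evalFamily (c : ℂ) (E : Idx → Idx → A) : ℕ → Idx → Idx → A
  | 0, i, j => if i = j then 1 else 0
  | r + 1, i, j => c ^ r • E i j

theorem isRTT_evalFamily (c : ℂ) {E : Idx → Idx → A} (hE : IsGL2 E) : IsRTT (evalFamily c E) where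
  zero _ _ := rfl
  comm r s i j k l := by
    cases r with
    | zero =>
      cases s with
      | zero =>
        simp only [evalFamily]
        split_ifs <;> simp
      | succ s =>
        have h := congrArg (fun a => c ^ s • a) (hE i j k l)
        simp only [smul_sub] at h
        simp only [evalFamily, pow_zero, one_smul, mul_smul_comm, smul_mul_assoc, h]
        split_ifs <;> simp
    | succ r =>
      cases s with
      | zero =>
        have h := congrArg (fun a => c ^ r • a) (hE i j k l)
        simp only [smul_sub] at h
        simp only [evalFamily, pow_zero, one_smul, mul_smul_comm, smul_mul_assoc, h]
        split_ifs <;> simp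
      | succ s =>
        simp only [evalFamily, mul_smul_comm, smul_mul_assoc, smul_smul]
        ring_nf
        abel_nf

end EvaluationFamily

/-- The coproduct `Δ(t_{ij}(u)) = ∑_a t_{ia}(u) ⊗ t_{aj}(u)` of `Y(2)`. -/
def comulFamily : ℕ → Idx → Idx → Yangian ⊗[ℂ] Yangian :=
  mulFamily (fun r i j => Yangian.t r i j ⊗ₜ[ℂ] (1 : Yangian))
    (fun r i j => (1 : Yangian) ⊗ₜ[ℂ] Yangian.t r i j)

theorem IsRTT.map {A B : Type*} [Ring A] [Ring B] {t : ℕ → Idx → Idx → A} (h : IsRTT t)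
    (f : A →+* B) : IsRTT fun r i j => f (t r i j) where
  zero i j := by
    show f (t 0 i j) = _
    rw [h.zero, apply_ite f, map_one, map_zero]
  comm r s i j k l := by
    have e := congrArg f (h.comm r s i j k l)
    simpa only [map_sub, map_mul] using e

theorem isRTT_comulFamily : IsRTT comulFamily := by
  refine IsRTT.mulFamily ?_ ?_ ?_
  · exact Yangian.isRTT_t.map
      (Algebra.TensorProduct.includeLeft : Yangian →ₐ[ℂ] Yangian ⊗[ℂ] Yangian).toRingHom
  · exact Yangian.isRTT_t.map
      (Algebra.TensorProduct.includeRight : Yangian →ₐ[ℂ] Yangian ⊗[ℂ] Yangian).toRingHom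
  · intro r s i j k l
    simp [Commute, SemiconjBy]

/-- The coproduct of `Y(2)`. -/
def Yangian.comul : Yangian →ₐ[ℂ] Yangian ⊗[ℂ] Yangian :=
  Yangian.lift comulFamily isRTT_comulFamily

/-! ### Modules over the Yangian -/

/-- A (left) module over `Y(2)`. -/
structure YangianModule where
  carrier : Type
  [addCommGroup : AddCommGroup carrier]
  [module : Module ℂ carrier]
  act : Yangian →ₐ[ℂ] Module.End ℂ carrier

attribute [instance] YangianModule.addCommGroup YangianModule.module

namespace YangianModule

/-- The tensor product of two `Y(2)`-modules. -/
abbrev tensor (M N : YangianModule) : YangianModule where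
  carrier := M.carrier ⊗[ℂ] N.carrier
  act := (Module.endTensorEndAlgHom (R := ℂ) (S := ℂ) (A := ℂ)
      (M := M.carrier) (N := N.carrier)).comp
    ((Algebra.TensorProduct.map M.act N.act).comp Yangian.comul)

/-- The pull-back of a `gl₂`-module under `t_{ij}(u) ↦ δ_{ij} + E_{ij} (u - c)⁻¹`. -/
abbrev eval {V : Type} [AddCommGroup V] [Module ℂ V] (c : ℂ) (E : Idx → Idx → Module.End ℂ V)
    (hE : IsGL2 E) : YangianModule where
  carrier := V
  act := Yangian.lift (evalFamily c E) (isRTT_evalFamily c hE)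

/-- The trivial one-dimensional module, `t_{ij}(u) ↦ δ_{ij}`. -/
abbrev trivial : YangianModule :=
  eval (V := ℂ) 0 (fun i j => (0 : Module.End ℂ ℂ)) (by intro i j k l; simp)

/-- The tensor product `M₁ ⊗ (M₂ ⊗ (⋯ ⊗ (M_k ⊗ ℂ)))`. -/
def tensorFamily : (k : ℕ) → (Fin k → YangianModule) → YangianModule
  | 0, _ => trivial
  | k + 1, M => tensor (M 0) (tensorFamily k fun i => M i.succ)

end YangianModule

/-- The matrix of `E_{ij}` on the irreducible `gl₂`-module with highest weight
`(α, α - d)`, in the basis `v₀, …, v_d` with `v₀` the highest weight vector: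
`E₁₁ v_n = (α - n) v_n`, `E_{-1,-1} v_n = (α - d + n) v_n`, `E_{-1,1} v_n = v_{n+1}` (and
`E_{-1,1} v_d = 0`), `E_{1,-1} v_n = n (d - n + 1) v_{n-1}`. -/
def irrepMatrix (α : ℂ) (d : ℕ) (i j : Idx) : Matrix (Fin (d + 1)) (Fin (d + 1)) ℂ :=
  Matrix.of fun m n =>
    if i = 1 then
      if j = 1 then (if m = n then α - (n : ℕ) else 0)
      else (if (m : ℕ) + 1 = n then ((n : ℕ) : ℂ) * (d - (n : ℕ) + 1) else 0)
    else
      if j = 1 then (if (m : ℕ) = n + 1 then 1 else 0)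
      else (if m = n then α - d + (n : ℕ) else 0)

/-- The operator `E_{ij}` on the irreducible `gl₂`-module with highest weight `(α, α - d)`. -/
def irrepE (α : ℂ) (d : ℕ) (i j : Idx) : Module.End ℂ (Fin (d + 1) → ℂ) :=
  Matrix.toLin' (irrepMatrix α d i j)

theorem neg_one_ne_one_idx : (-1 : Idx) ≠ 1 := by decide

theorem irrepMatrix_pos_pos (α : ℂ) (d : ℕ) :
    irrepMatrix α d 1 1 = Matrix.diagonal fun n : Fin (d + 1) => α - ((n : ℕ) : ℂ) := by
  ext m n
  by_cases h : m = n <;> simp [irrepMatrix, h]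

theorem irrepMatrix_neg_neg (α : ℂ) (d : ℕ) :
    irrepMatrix α d (-1) (-1) = Matrix.diagonal fun n : Fin (d + 1) => α - d + ((n : ℕ) : ℂ) := by
  ext m n
  by_cases h : m = n <;> simp [irrepMatrix, h]

theorem irrepMatrix_raise_mul_lower (α : ℂ) (d : ℕ) :
    irrepMatrix α d 1 (-1) * irrepMatrix α d (-1) 1
      = Matrix.diagonal fun n : Fin (d + 1) => (((n : ℕ) : ℂ) + 1) * (d - ((n : ℕ) : ℂ)) := by
  ext m p
  simp only [irrepMatrix, Matrix.mul_apply, Matrix.of_apply, if_true, neg_one_ne_one_idx, if_false]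
  by_cases hm : (m : ℕ) + 1 < d + 1
  · rw [Finset.sum_eq_single (⟨m + 1, hm⟩ : Fin (d + 1))]
    · by_cases h : m = p
      · subst h; simp; left; ring
      · have : (m : ℕ) ≠ p := fun e => h (Fin.ext e)
        simp [h, this]
    · intro n _ hn
      rw [if_neg, zero_mul]
      exact fun e => hn (Fin.ext e.symm)
    · simp
  · have hmd : (m : ℕ) = d := by have := m.2; omega
    rw [Finset.sum_eq_zero]
    · by_cases h : m = p
      · subst h; simp [hmd]
      · simp [h]
    · intro n _
      rw [if_neg, zero_mul]
      have := n.2; omega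

theorem irrepMatrix_lower_mul_raise (α : ℂ) (d : ℕ) :
    irrepMatrix α d (-1) 1 * irrepMatrix α d 1 (-1)
      = Matrix.diagonal fun n : Fin (d + 1) => ((n : ℕ) : ℂ) * (d - ((n : ℕ) : ℂ) + 1) := by
  ext m p
  simp only [irrepMatrix, Matrix.mul_apply, Matrix.of_apply, if_true, neg_one_ne_one_idx, if_false]
  by_cases hm : (m : ℕ) = 0
  · rw [Finset.sum_eq_zero]
    · by_cases h : m = p
      · subst h; simp [hm]
      · simp [h]
    · intro n _
      rw [if_neg, zero_mul]
      omega
  · have hlt : (m : ℕ) - 1 < d + 1 := by have := m.2; omega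
    have hs : (m : ℕ) - 1 + 1 = m := by omega
    rw [Finset.sum_eq_single (⟨m - 1, hlt⟩ : Fin (d + 1))]
    · by_cases h : m = p
      · subst h; simp [hs]
      · have : (m : ℕ) ≠ p := fun e => h (Fin.ext e)
        simp [h, this, hs]
    · intro n _ hn
      rw [if_neg, zero_mul]
      exact fun e => hn (Fin.ext (by simp; omega))
    · simp

theorem isGL2_irrepE (α : ℂ) (d : ℕ) : IsGL2 (irrepE α d) := by
  have key : ∀ i j k l, irrepMatrix α d i j * irrepMatrix α d k l
      - irrepMatrix α d k l * irrepMatrix α d i j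
      = (if k = j then irrepMatrix α d i l else 0) - (if i = l then irrepMatrix α d k j else 0) := by
    have e1 : ∀ m n : Fin (d + 1), irrepMatrix α d 1 (-1) m n
        = if (m : ℕ) + 1 = n then ((n : ℕ) : ℂ) * (d - (n : ℕ) + 1) else 0 := by
      intro m n; simp [irrepMatrix]
    have e2 : ∀ m n : Fin (d + 1), irrepMatrix α d (-1) 1 m n
        = if (m : ℕ) = n + 1 then 1 else 0 := by
      intro m n; simp [irrepMatrix]
    have n1 : (1 : Idx) ≠ -1 := by decide
    intro i j k l
    rcases Int.units_eq_one_or i with rfl | rfl <;> rcases Int.units_eq_one_or j with rfl | rfl <;>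
      rcases Int.units_eq_one_or k with rfl | rfl <;>
      rcases Int.units_eq_one_or l with rfl | rfl <;>
      simp only [irrepMatrix_raise_mul_lower, irrepMatrix_lower_mul_raise, if_true, if_false,
        neg_one_ne_one_idx, n1, sub_self, sub_zero, zero_sub, irrepMatrix_pos_pos,
        irrepMatrix_neg_neg] <;>
      ext m n <;>
      simp only [Matrix.sub_apply, Matrix.neg_apply, Matrix.zero_apply, Matrix.mul_diagonal,
        Matrix.diagonal_mul, Matrix.diagonal_apply, e1, e2] <;>
      (try split_ifs) <;>
      first
        | ring1
        | (rename_i h; subst h; ring1)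
        | (rename_i h; have hc := congrArg (fun x : ℕ => (x : ℂ)) h; push_cast at hc
           first | (rw [← hc]; ring1) | (rw [hc]; ring1))
  intro i j k l
  have := congrArg Matrix.toLin' (key i j k l)
  simp only [map_sub, Matrix.toLin'_mul, apply_ite Matrix.toLin', map_zero] at this
  exact this

/-- The `Y(2)`-module `L(α, β)`, `β = α - d`. -/
abbrev evalModule (α : ℂ) (d : ℕ) : YangianModule :=
  YangianModule.eval 0 (irrepE α d) (isGL2_irrepE α d)

/-- The `Y(2)`-module `L(α₁, β₁) ⊗ ⋯ ⊗ L(α_k, β_k)`, `β_i = α_i - d_i`. -/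
abbrev stringModule {k : ℕ} (α : Fin k → ℂ) (d : Fin k → ℕ) : YangianModule :=
  YangianModule.tensorFamily k fun i => evalModule (α i) (d i)

/-! ### The twisted Yangians `Y^∓(2)` and their Bethe subalgebras -/

/-- The element `s_{ij}^{(M)}` of `Y(2)`. -/
def sElement (ε : ℤˣ) (M : ℕ) (i j : Idx) : Yangian :=
  PowerSeries.coeff M (sMatrix ε (genMatrix Yangian.t) i j)

/-- The twisted Yangian, generated by all `s_{ij}^{(M)}`: it is `Y^-(2)` for `ε = -1` and `Y^+(2)`
for `ε = 1`. -/
def TwistedYangian (ε : ℤˣ) : Subalgebra ℂ Yangian :=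
  Algebra.adjoin ℂ {x | ∃ M i j, x = sElement ε M i j}

/-- The generators `s_{ij}^{(M)}` as elements of the twisted Yangian. -/
def sGen (ε : ℤˣ) (M : ℕ) (i j : Idx) : TwistedYangian ε :=
  ⟨sElement ε M i j, Algebra.subset_adjoin ⟨M, i, j, rfl⟩⟩

/-- The Bethe subalgebra `𝓑^∓` of `Y^∓(2)`, generated by the coefficients of `σ₁(u, F₁₁)` and
`σ₂(u, F₁₁)`. -/
def betheSubalgebra (ε : ℤˣ) : Subalgebra ℂ (TwistedYangian ε) :=
  Algebra.adjoin ℂ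
    ({x | ∃ n, x = PowerSeries.coeff n (sigmaOne ε (genMatrix (sGen ε)))} ∪
      {x | ∃ n, x = PowerSeries.coeff n (sigmaTwo ε (genMatrix (sGen ε)))})

/-! ### The left coideal structure -/

section Coideal

variable {A B : Type*} [Ring A] [Ring B]

theorem commute_of_coeff {f g : PowerSeries A}
    (h : ∀ m n, Commute (PowerSeries.coeff m f) (PowerSeries.coeff n g)) : Commute f g := by
  refine PowerSeries.ext fun n => ?_
  rw [PowerSeries.coeff_mul, PowerSeries.coeff_mul, ← Finset.Nat.sum_antidiagonal_swap]
  exact Finset.sum_congr rfl fun p _ => (h p.2 p.1).eq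

theorem coeff_negU (f : PowerSeries A) (n : ℕ) :
    PowerSeries.coeff n (negU f) = (-1) ^ n * PowerSeries.coeff n f := by
  simp [negU]

theorem negU_mul (f g : PowerSeries A) : negU (f * g) = negU f * negU g := by
  refine PowerSeries.ext fun n => ?_
  rw [coeff_negU, PowerSeries.coeff_mul, PowerSeries.coeff_mul, Finset.mul_sum]
  refine Finset.sum_congr rfl fun p hp => ?_
  rw [coeff_negU, coeff_negU, ← Finset.HasAntidiagonal.mem_antidiagonal.mp hp, pow_add,
    mul_assoc ((-1 : A) ^ p.1) (PowerSeries.coeff p.1 f),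
    ← mul_assoc (PowerSeries.coeff p.1 f),
    (((Commute.neg_one_right (PowerSeries.coeff p.1 f)).pow_right p.2)).eq]
  simp only [mul_assoc]

theorem negU_sum {ι : Type*} (s : Finset ι) (f : ι → PowerSeries A) :
    negU (∑ a ∈ s, f a) = ∑ a ∈ s, negU (f a) := by
  refine PowerSeries.ext fun n => ?_
  simp [coeff_negU, Finset.mul_sum]

theorem negU_map (φ : A →+* B) (f : PowerSeries A) :
    PowerSeries.map φ (negU f) = negU (PowerSeries.map φ f) := by
  refine PowerSeries.ext fun n => ?_
  simp [coeff_negU]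

theorem theta_mul (ε : ℤˣ) (i b j : Idx) : theta ε i b * theta ε b j = theta ε i j := by
  unfold theta
  split_ifs
  · rw [← Units.val_mul]
    congr 1
    rw [mul_assoc, ← mul_assoc b, Int.units_mul_self, one_mul]
  · rfl

theorem sMatrix_map (ε : ℤˣ) (φ : A →+* B) (T : Matrix Idx Idx (PowerSeries A)) :
    (sMatrix ε T).map (PowerSeries.map φ) = sMatrix ε (T.map (PowerSeries.map φ)) := by
  ext1 i j
  simp only [sMatrix, transp, Matrix.map_apply, Matrix.mul_apply, Matrix.of_apply, map_sum,
    map_mul, map_zsmul, negU_map]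

theorem sMatrix_mul (ε : ℤˣ) (T' T'' : Matrix Idx Idx (PowerSeries A))
    (hn : ∀ i j k l, Commute (negU (T' i j)) (negU (T'' k l))) :
    sMatrix ε (T' * T'') = T' * sMatrix ε T'' * transp ε (T'.map negU) := by
  have h : transp ε ((T' * T'').map negU) = transp ε (T''.map negU) * transp ε (T'.map negU) := by
    ext1 i j
    simp only [transp, Matrix.of_apply, Matrix.map_apply, Matrix.mul_apply, negU_sum, negU_mul]
    rw [Finset.smul_sum, ← Equiv.sum_comp (Equiv.neg Idx)]
    refine Finset.sum_congr rfl fun b _ => ?_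
    rw [Equiv.neg_apply, (hn _ _ _ _).eq, smul_mul_smul_comm, theta_mul]
  rw [sMatrix, h, sMatrix]
  simp only [Matrix.mul_assoc]

theorem coeff_mul_mem {R : Type*} [CommRing R] [Algebra R A] (P : Subalgebra R A)
    {f g : PowerSeries A} (hf : ∀ n, PowerSeries.coeff n f ∈ P)
    (hg : ∀ n, PowerSeries.coeff n g ∈ P) (n : ℕ) : PowerSeries.coeff n (f * g) ∈ P := by
  rw [PowerSeries.coeff_mul]
  exact Subalgebra.sum_mem _ fun p _ => P.mul_mem (hf _) (hg _)

end Coideal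

/-- The inclusion `Y(2) ⊗ Y^∓(2) → Y(2) ⊗ Y(2)`. -/
def coidealIncl (ε : ℤˣ) : Yangian ⊗[ℂ] TwistedYangian ε →ₐ[ℂ] Yangian ⊗[ℂ] Yangian :=
  Algebra.TensorProduct.map (AlgHom.id ℂ Yangian) (TwistedYangian ε).val

theorem coidealIncl_injective (ε : ℤˣ) : Function.Injective (coidealIncl ε) :=
  Module.Flat.lTensor_preserves_injective_linearMap (M := Yangian)
    (TwistedYangian ε).val.toLinearMap Subtype.val_injective

theorem comul_sElement_mem (ε : ℤˣ) (M : ℕ) (i j : Idx) :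
    Yangian.comul (sElement ε M i j) ∈ (coidealIncl ε).range := by
  set ι₁ : Yangian →+* Yangian ⊗[ℂ] Yangian :=
    (Algebra.TensorProduct.includeLeft : Yangian →ₐ[ℂ] Yangian ⊗[ℂ] Yangian).toRingHom with hι₁
  set ι₂ : Yangian →+* Yangian ⊗[ℂ] Yangian :=
    (Algebra.TensorProduct.includeRight : Yangian →ₐ[ℂ] Yangian ⊗[ℂ] Yangian).toRingHom with hι₂
  set T := genMatrix Yangian.t
  set T' := T.map (PowerSeries.map ι₁)
  set T'' := T.map (PowerSeries.map ι₂)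
  have hcomm : ∀ a b, Commute (ι₁ a) (ι₂ b) := by
    intro a b
    simp [hι₁, hι₂, Commute, SemiconjBy]
  have hT : T.map (PowerSeries.map Yangian.comul.toRingHom) = T' * T'' := by
    have e1 : T.map (PowerSeries.map Yangian.comul.toRingHom) = genMatrix comulFamily := by
      ext i j n
      simp [T, genMatrix, Yangian.comul, Yangian.lift_t]
    have e2 : T' = genMatrix fun r i j => Yangian.t r i j ⊗ₜ[ℂ] (1 : Yangian) := by
      ext i j n
      simp [T', T, genMatrix, hι₁]
    have e3 : T'' = genMatrix fun r i j => (1 : Yangian) ⊗ₜ[ℂ] Yangian.t r i j := by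
      ext i j n
      simp [T'', T, genMatrix, hι₂]
    rw [e1, e2, e3, comulFamily, genMatrix_mulFamily]
  have hS : (sMatrix ε T).map (PowerSeries.map Yangian.comul.toRingHom)
      = T' * (sMatrix ε T).map (PowerSeries.map ι₂) * transp ε (T'.map negU) := by
    rw [sMatrix_map, hT, sMatrix_mul, sMatrix_map]
    intro i j k l
    refine commute_of_coeff fun m n => ?_
    simp only [T', T'', Matrix.map_apply, ← negU_map, PowerSeries.coeff_map]
    exact hcomm _ _
  have e : Yangian.comul (sElement ε M i j)
      = PowerSeries.coeff M
          ((T' * (sMatrix ε T).map (PowerSeries.map ι₂) * transp ε (T'.map negU)) i j) := by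
    rw [← hS, Matrix.map_apply, PowerSeries.coeff_map]
    rfl
  have m1 : ∀ a, ι₁ a ∈ (coidealIncl ε).range := fun a => ⟨a ⊗ₜ 1, by simp [coidealIncl, hι₁]⟩
  have m2 : ∀ n k l, ι₂ (sElement ε n k l) ∈ (coidealIncl ε).range :=
    fun n k l => ⟨1 ⊗ₜ sGen ε n k l, by simp [coidealIncl, hι₂, sGen]⟩
  rw [e, Matrix.mul_apply, map_sum]
  refine Subalgebra.sum_mem _ fun b _ => coeff_mul_mem _ (fun n => ?_) (fun n => ?_) M
  · rw [Matrix.mul_apply, map_sum]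
    refine Subalgebra.sum_mem _ fun a _ => coeff_mul_mem _ (fun n => ?_) (fun n => ?_) n
    · simp only [T', Matrix.map_apply, PowerSeries.coeff_map]
      exact m1 _
    · simp only [Matrix.map_apply, PowerSeries.coeff_map]
      exact m2 n a b
  · simp only [T', transp, Matrix.of_apply, Matrix.map_apply, ← negU_map, map_zsmul,
      PowerSeries.coeff_map]
    exact Subalgebra.zsmul_mem _ (m1 _) _

theorem comul_mem (ε : ℤˣ) (x : TwistedYangian ε) :
    Yangian.comul x ∈ (coidealIncl ε).range := by
  have h : TwistedYangian ε ≤ (coidealIncl ε).range.comap Yangian.comul := by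
    refine Algebra.adjoin_le ?_
    rintro _ ⟨M, i, j, rfl⟩
    exact comul_sElement_mem ε M i j
  exact h x.2

/-- The coaction `Y^∓(2) → Y(2) ⊗ Y^∓(2)`: the restriction of the coproduct of `Y(2)`. -/
def coaction (ε : ℤˣ) : TwistedYangian ε →ₐ[ℂ] Yangian ⊗[ℂ] TwistedYangian ε :=
  ((AlgEquiv.ofInjective (coidealIncl ε) (coidealIncl_injective ε)).symm :
      (coidealIncl ε).range →ₐ[ℂ] Yangian ⊗[ℂ] TwistedYangian ε).comp
    ((Yangian.comul.comp (TwistedYangian ε).val).codRestrict (coidealIncl ε).range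
      (comul_mem ε))

theorem coidealIncl_coaction (ε : ℤˣ) (x : TwistedYangian ε) :
    coidealIncl ε (coaction ε x) = Yangian.comul x :=
  congrArg Subtype.val ((AlgEquiv.ofInjective (coidealIncl ε)
    (coidealIncl_injective ε)).apply_symm_apply ⟨Yangian.comul x, comul_mem ε x⟩)

/-! ### Modules over the twisted Yangians -/

/-- A (left) module over `Y^∓(2)`. -/
structure TwistedModule (ε : ℤˣ) where
  carrier : Type
  [addCommGroup : AddCommGroup carrier]
  [module : Module ℂ carrier]
  act : TwistedYangian ε →ₐ[ℂ] Module.End ℂ carrier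

attribute [instance] TwistedModule.addCommGroup TwistedModule.module

/-- The restriction of a `Y(2)`-module to `Y^∓(2)`. -/
abbrev YangianModule.restrict (ε : ℤˣ) (M : YangianModule) : TwistedModule ε where
  carrier := M.carrier
  act := M.act.comp (TwistedYangian ε).val

/-- The tensor product of a `Y(2)`-module and a `Y^∓(2)`-module. -/
abbrev YangianModule.tensorTwisted {ε : ℤˣ} (M : YangianModule) (N : TwistedModule ε) :
    TwistedModule ε where
  carrier := M.carrier ⊗[ℂ] N.carrier
  act := (Module.endTensorEndAlgHom (R := ℂ) (S := ℂ) (A := ℂ)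
      (M := M.carrier) (N := N.carrier)).comp
    ((Algebra.TensorProduct.map M.act N.act).comp (coaction ε))

/-- The direct sum of two `Y^∓(2)`-modules. -/
abbrev TwistedModule.directSum {ε : ℤˣ} (M N : TwistedModule ε) : TwistedModule ε where
  carrier := M.carrier × N.carrier
  act := (LinearMap.prodMapAlgHom ℂ M.carrier N.carrier).comp (M.act.prod N.act)

/-! ### The one-dimensional modules `W(δ)` over `Y^+(2)`

`Y^+(2)` is a subalgebra of `Y(2)`, so the character has to be produced on the subalgebra. It is
obtained from the action of `Y^+(2)` on the line spanned by the highest weight vector of a suitable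
Verma module; `charW_pos`, `charW_neg`, `charW_off` show that it has the required values on the
generators, which determine it. -/

/-- The matrix units of `gl₂` acting on sequences (coordinates with respect to
`v₀, v₁, v₂, …`), highest weight `(a, b)`. -/
def vermaE (a b : ℂ) (i j : Idx) : Module.End ℂ (ℕ → ℂ) where
  toFun ψ n :=
    if i = 1 then
      if j = 1 then (a - n) * ψ n else (n + 1) * (a - b - n) * ψ (n + 1)
    else
      if j = 1 then (if n = 0 then 0 else ψ (n - 1)) else (b + n) * ψ n
  map_add' ψ φ := by
    ext n
    simp only [Pi.add_apply]
    split_ifs <;> ring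
  map_smul' c ψ := by
    ext n
    simp only [Pi.smul_apply, smul_eq_mul, RingHom.id_apply]
    split_ifs <;> ring

theorem isGL2_vermaE (a b : ℂ) : IsGL2 (vermaE a b) := by
  have n1 : (1 : Idx) ≠ -1 := by decide
  intro i j k l
  rcases Int.units_eq_one_or i with rfl | rfl <;> rcases Int.units_eq_one_or j with rfl | rfl <;>
    rcases Int.units_eq_one_or k with rfl | rfl <;>
    rcases Int.units_eq_one_or l with rfl | rfl <;>
    refine LinearMap.ext fun ψ => funext fun n => ?_ <;>
    rcases n with _ | n <;>
    simp [vermaE, n1] <;> ring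

/-- The action of `Y(2)` on the Verma module whose highest weight vector spans `W(δ)`. -/
def vermaAct (δ : ℂ) : Yangian →ₐ[ℂ] Module.End ℂ (ℕ → ℂ) :=
  Yangian.lift (evalFamily (-1 / 2) (vermaE (δ - 3 / 2) (-1)))
    (isRTT_evalFamily _ (isGL2_vermaE _ _))

section Acts

variable {V : Type*} [AddCommGroup V] [Module ℂ V]

/-- The series of operators `F` sends `v` to the series of scalars `f` times `w`. -/
def Acts (F : PowerSeries (Module.End ℂ V)) (v : V) (f : PowerSeries ℂ) (w : V) : Prop :=
  ∀ n, PowerSeries.coeff n F v = PowerSeries.coeff n f • w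

theorem Acts.mul {F G : PowerSeries (Module.End ℂ V)} {f g : PowerSeries ℂ} {v w x : V}
    (hF : Acts F w f x) (hG : Acts G v g w) : Acts (F * G) v (f * g) x := by
  intro n
  rw [PowerSeries.coeff_mul, PowerSeries.coeff_mul, LinearMap.sum_apply, Finset.sum_smul]
  refine Finset.sum_congr rfl fun p _ => ?_
  rw [Module.End.mul_apply, hG, map_smul, hF, smul_smul, mul_comm]

theorem Acts.add {F G : PowerSeries (Module.End ℂ V)} {f g : PowerSeries ℂ} {v w : V}
    (hF : Acts F v f w) (hG : Acts G v g w) : Acts (F + G) v (f + g) w := by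
  intro n
  rw [map_add, map_add, LinearMap.add_apply, hF, hG, add_smul]

theorem Acts.negU {F : PowerSeries (Module.End ℂ V)} {f : PowerSeries ℂ} {v w : V}
    (hF : Acts F v f w) : Acts (negU F) v (negU f) w := by
  intro n
  rw [coeff_negU, coeff_negU, Module.End.mul_apply, hF, map_smul]
  rcases neg_one_pow_eq_or ℂ n with h | h <;> rcases Nat.even_or_odd n with h' | h' <;>
    simp [h'.neg_one_pow]

end Acts

/-- The expansion of `(u - c)⁻¹`. -/
def poleSeries (c : ℂ) : PowerSeries ℂ :=
  PowerSeries.mk fun n => if n = 0 then 0 else c ^ (n - 1)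

theorem acts_eval_same {V : Type*} [AddCommGroup V] [Module ℂ V] (c e : ℂ)
    (E : Idx → Idx → Module.End ℂ V) (i : Idx) (v : V) (h : E i i v = e • v) :
    Acts (genMatrix (evalFamily c E) i i) v (1 + PowerSeries.C e * poleSeries c) v := by
  intro n
  rw [coeff_genMatrix]
  cases n with
  | zero => simp [evalFamily, poleSeries]
  | succ n => simp [evalFamily, poleSeries, h, PowerSeries.coeff_one, smul_smul, mul_comm]

theorem acts_eval_ne {V : Type*} [AddCommGroup V] [Module ℂ V] (c e : ℂ)
    (E : Idx → Idx → Module.End ℂ V) {i j : Idx} (hij : i ≠ j) (v w : V) (h : E i j v = e • w) :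
    Acts (genMatrix (evalFamily c E) i j) v (PowerSeries.C e * poleSeries c) w := by
  intro n
  rw [coeff_genMatrix]
  cases n with
  | zero => simp [evalFamily, poleSeries, hij]
  | succ n => simp [evalFamily, poleSeries, h, smul_smul, mul_comm]

theorem poleSeries_mul (c : ℂ) :
    (1 - PowerSeries.C c * PowerSeries.X) * poleSeries c = PowerSeries.X := by
  refine PowerSeries.ext fun n => ?_
  rw [sub_mul, one_mul, mul_assoc, map_sub, PowerSeries.coeff_C_mul]
  rcases n with _ | _ | n
  · simp [poleSeries]
  · simp [poleSeries, PowerSeries.coeff_succ_X_mul]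
  · rw [PowerSeries.coeff_succ_X_mul]
    simp [poleSeries, PowerSeries.coeff_X, pow_succ, mul_comm]

theorem negU_X_C (c : ℂ) :
    negU (1 - PowerSeries.C c * PowerSeries.X : PowerSeries ℂ)
      = 1 + PowerSeries.C c * PowerSeries.X := by
  refine PowerSeries.ext fun n => ?_
  rw [coeff_negU]
  rcases n with _ | _ | n <;> simp [PowerSeries.coeff_one]

theorem negU_poleSeries_mul (c : ℂ) :
    (1 + PowerSeries.C c * PowerSeries.X) * negU (poleSeries c) = -PowerSeries.X := by
  rw [← negU_X_C, ← negU_mul, poleSeries_mul]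
  refine PowerSeries.ext fun n => ?_
  rw [coeff_negU]
  rcases n with _ | _ | n <;> simp [PowerSeries.coeff_X]

theorem poleSeries_half :
    poleSeries (-1 / 2) * negU (poleSeries (-1 / 2))
      = poleSeries (-1 / 2) + negU (poleSeries (-1 / 2)) := by
  have h1 := poleSeries_mul (-1 / 2)
  have h2 := negU_poleSeries_mul (-1 / 2)
  set h : PowerSeries ℂ := PowerSeries.C (-1 / 2 : ℂ) * PowerSeries.X with hh
  have hX : (PowerSeries.X : PowerSeries ℂ) = -(2 * h) := by
    have e2 : (2 : PowerSeries ℂ) = PowerSeries.C 2 := (map_ofNat _ 2).symm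
    have e3 : (PowerSeries.C (2 : ℂ)) * PowerSeries.C (-1 / 2) = -1 := by
      rw [← map_mul, ← map_one (PowerSeries.C (R := ℂ)), ← map_neg]
      norm_num
    rw [hh, e2, ← mul_assoc, e3]
    ring
  have ne1 : (1 - h) ≠ 0 := by
    intro e
    have := congrArg (PowerSeries.coeff 0) e
    simp [hh] at this
  have ne2 : (1 + h) ≠ 0 := by
    intro e
    have := congrArg (PowerSeries.coeff 0) e
    simp [hh] at this
  rw [hX] at h1 h2
  refine mul_left_cancel₀ (mul_ne_zero ne1 ne2) ?_
  linear_combination (1 + h) * negU (poleSeries (-1 / 2)) * h1 - (2 * h) * h2 - (1 + h) * h1 - (1 - h) * h2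

/-- The highest weight vector. -/
def xi : ℕ → ℂ := Pi.single 0 1

/-- The character of `Y^+(2)` on `W(δ)`, as series: `s₁₁(u) ↦ 1 + (δ - 1/2)/(u + 1/2)`,
`s_{-1,-1}(u) ↦ 1 - (δ - 1/2)/(u + 1/2)`. -/
def charSeries (δ : ℂ) (i j : Idx) : PowerSeries ℂ :=
  if i = j then 1 + PowerSeries.C (((i : ℤ) : ℂ) * (δ - 1 / 2)) * poleSeries (-1 / 2) else 0

theorem Acts.zero_left {V : Type*} [AddCommGroup V] [Module ℂ V] (v w : V) :
    Acts (0 : PowerSeries (Module.End ℂ V)) v 0 w := by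
  intro n
  simp

theorem Acts.zero_right {V : Type*} [AddCommGroup V] [Module ℂ V]
    {F : PowerSeries (Module.End ℂ V)} {f : PowerSeries ℂ} {v w : V} (h : Acts F v 0 w) (x : V)
    (hf : f = 0) : Acts F v f x := by
  intro n
  rw [h n, hf]
  simp

theorem sMatrix_one_apply {A : Type*} [Ring A] (T : Matrix Idx Idx (PowerSeries A)) (i j : Idx) :
    sMatrix 1 T i j = T i 1 * negU (T (-j) (-1)) + T i (-1) * negU (T (-j) 1) := by
  have hu : (Finset.univ : Finset Idx) = {1, -1} := by decide
  have n1 : (1 : Idx) ≠ -1 := by decide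
  simp [sMatrix, transp, theta, Matrix.mul_apply, hu, n1]

theorem acts_sMatrix_xi (δ : ℂ) (i j : Idx) :
    Acts (sMatrix 1 (genMatrix (evalFamily (-1 / 2) (vermaE (δ - 3 / 2) (-1)))) i j) xi
      (charSeries δ i j) xi := by
  have n1 : (1 : Idx) ≠ -1 := by decide
  set E := vermaE (δ - 3 / 2) (-1) with hE
  set G := genMatrix (evalFamily (-1 / 2) E) with hG
  set P := poleSeries (-1 / 2) with hP
  have key := poleSeries_half
  rw [← hP] at key
  set v₁ : ℕ → ℂ := Pi.single 1 1 with hv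
  have x1 : E 1 1 xi = (δ - 3 / 2) • xi := by
    ext n; rcases n with _ | n <;> simp [hE, vermaE, xi]
  have x2 : E (-1) (-1) xi = (-1 : ℂ) • xi := by
    ext n; rcases n with _ | n <;> simp [hE, vermaE, xi]
  have x3 : E (-1) 1 xi = (1 : ℂ) • v₁ := by
    ext n; rcases n with _ | _ | n <;> simp [hE, hv, vermaE, xi]
  have x4 : ∀ w, E 1 (-1) xi = (0 : ℂ) • w := by
    intro w
    ext n; simp [hE, vermaE, xi]
  have x5 : E 1 (-1) v₁ = (δ - 1 / 2) • xi := by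
    ext n; rcases n with _ | n <;> simp [hE, hv, vermaE, xi]
    ring
  have x6 : E (-1) (-1) v₁ = (0 : ℂ) • v₁ := by
    ext n; rcases n with _ | _ | n <;> simp [hE, hv, vermaE]
  have g1 := acts_eval_same (-1 / 2) _ E 1 xi x1
  have g2 := acts_eval_same (-1 / 2) _ E (-1) xi x2
  have g3 := acts_eval_ne (-1 / 2) _ E neg_one_ne_one_idx xi v₁ x3
  have g4 := fun w => acts_eval_ne (-1 / 2) _ E n1 xi w (x4 w)
  have g5 := acts_eval_ne (-1 / 2) _ E n1 v₁ xi x5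
  have g6 := acts_eval_same (-1 / 2) _ E (-1) v₁ x6
  simp only [← hG, ← hP] at g1 g2 g3 g4 g5 g6
  have nU : ∀ e : ℂ, negU (1 + PowerSeries.C e * P) = 1 + PowerSeries.C e * negU P := by
    intro e
    refine PowerSeries.ext fun n => ?_
    rw [coeff_negU]
    rcases n with _ | n
    · simp [hP, poleSeries, negU]
    · simp [coeff_negU, PowerSeries.coeff_one]
      ring
  have nC : ∀ e : ℂ, negU (PowerSeries.C e * P) = PowerSeries.C e * negU P := by
    intro e
    refine PowerSeries.ext fun n => ?_
    simp [coeff_negU]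
    ring
  have hC1 : (PowerSeries.C (-1 : ℂ)) = -1 := by simp
  have hC2 : (PowerSeries.C (δ - 3 / 2 : ℂ)) = PowerSeries.C (δ - 1 / 2) - 1 := by
    rw [← map_one (PowerSeries.C (R := ℂ)), ← map_sub]
    congr 1; ring
  rw [sMatrix_one_apply]
  rcases Int.units_eq_one_or i with rfl | rfl <;> rcases Int.units_eq_one_or j with rfl | rfl
  · have h := (g1.mul g2.negU).add (g5.mul g3.negU)
    convert h using 1
    rw [nU, nC, hC1, hC2]
    simp only [charSeries, if_true, Units.val_one, Int.cast_one, one_mul, map_one]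
    rw [← hP]
    linear_combination -key
  · rw [neg_neg]
    have h := (g1.mul (g4 xi).negU).add ((g4 xi).mul g1.negU)
    convert h using 1
    rw [nU, nC]
    simp [charSeries, n1]
  · have h := (g3.mul g2.negU).add (g6.mul g3.negU)
    refine Acts.zero_right (w := v₁) ?_ xi (by simp [charSeries])
    convert h using 1
    rw [nU, nC, hC1]
    simp only [map_one, map_zero]
    linear_combination key
  · rw [neg_neg]
    have h0 : Acts (G (-1) 1 * negU (G 1 (-1))) xi 0 xi := by
      refine Acts.zero_right (w := v₁) ?_ xi rfl
      convert g3.mul (g4 xi).negU using 1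
      rw [nC]
      simp
    have h := h0.add (g2.mul g1.negU)
    convert h using 1
    rw [nU, hC1, hC2]
    have hC3 : (PowerSeries.C (-(δ - 1 / 2) : ℂ)) = -PowerSeries.C (δ - 1 / 2) := map_neg _ _
    simp only [charSeries, if_true, Units.val_neg, Units.val_one, Int.cast_neg, Int.cast_one,
      neg_one_mul, hC3]
    rw [← hP]
    linear_combination (PowerSeries.C (δ - 1 / 2) - 1) * key

theorem act_sElement_xi (δ : ℂ) (M : ℕ) (i j : Idx) :
    vermaAct δ (sElement 1 M i j) xi
      = PowerSeries.coeff M (charSeries δ i j) • xi := by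
  have h : vermaAct δ (sElement 1 M i j)
      = PowerSeries.coeff M
        (sMatrix 1 (genMatrix (evalFamily (-1 / 2) (vermaE (δ - 3 / 2) (-1)))) i j) := by
    have e : (genMatrix Yangian.t).map (PowerSeries.map (vermaAct δ).toRingHom)
        = genMatrix (evalFamily (-1 / 2) (vermaE (δ - 3 / 2) (-1))) := by
      ext1 i j
      refine PowerSeries.ext fun n => ?_
      rw [Matrix.map_apply, PowerSeries.coeff_map, coeff_genMatrix, coeff_genMatrix]
      exact Yangian.lift_t _ _ _ _ _
    rw [← e, ← sMatrix_map, Matrix.map_apply, PowerSeries.coeff_map]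
    rfl
  rw [h]
  exact acts_sMatrix_xi δ i j M

theorem exists_act_xi (δ : ℂ) (x : TwistedYangian 1) :
    ∃ r : ℂ, vermaAct δ x xi = r • xi := by
  obtain ⟨x, hx⟩ := x
  induction hx using Algebra.adjoin_induction with
  | mem x hx =>
    obtain ⟨M, i, j, rfl⟩ := hx
    exact ⟨_, act_sElement_xi δ M i j⟩
  | algebraMap r => exact ⟨r, by simp [Module.algebraMap_end_apply]⟩
  | add x y _ _ hx hy =>
    obtain ⟨r, hr⟩ := hx
    obtain ⟨s, hs⟩ := hy
    refine ⟨r + s, ?_⟩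
    simp only at hr hs ⊢
    rw [map_add, LinearMap.add_apply, hr, hs, add_smul]
  | mul x y _ _ hx hy =>
    obtain ⟨r, hr⟩ := hx
    obtain ⟨s, hs⟩ := hy
    refine ⟨s * r, ?_⟩
    simp only at hr hs ⊢
    rw [map_mul, Module.End.mul_apply, hs, map_smul, hr, smul_smul]

/-- The eigenvalue of `x` on the highest weight vector. -/
def charWFun (δ : ℂ) (x : TwistedYangian 1) : ℂ := (exists_act_xi δ x).choose

theorem charWFun_eq (δ : ℂ) (x : TwistedYangian 1) {r : ℂ}
    (h : vermaAct δ x xi = r • xi) : charWFun δ x = r := by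
  have h' := (exists_act_xi δ x).choose_spec
  have := congrFun (h.symm.trans h') 0
  change (exists_act_xi δ x).choose = r
  simpa [xi] using this.symm

theorem act_xi (δ : ℂ) (x : TwistedYangian 1) :
    vermaAct δ x xi = charWFun δ x • xi := (exists_act_xi δ x).choose_spec

/-- The character of `Y^+(2)` on `W(δ)`. -/
def charW (δ : ℂ) : TwistedYangian 1 →ₐ[ℂ] ℂ where
  toFun := charWFun δ
  map_one' := charWFun_eq _ _ (by simp)
  map_mul' x y := charWFun_eq _ _ (by
    rw [Subalgebra.coe_mul, map_mul, Module.End.mul_apply, act_xi, map_smul, act_xi, smul_smul,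
      mul_comm])
  map_zero' := charWFun_eq _ _ (by simp)
  map_add' x y := charWFun_eq _ _ (by
    rw [Subalgebra.coe_add, map_add, LinearMap.add_apply, act_xi, act_xi, add_smul])
  commutes' r := charWFun_eq _ _ (by simp [Module.algebraMap_end_apply])

theorem charW_sGen (δ : ℂ) (M : ℕ) (i j : Idx) :
    charW δ (sGen 1 M i j) = PowerSeries.coeff M (charSeries δ i j) :=
  charWFun_eq _ _ (act_sElement_xi δ M i j)

theorem charW_aux (e : ℂ) :
    (1 + PowerSeries.C (1 / 2 : ℂ) * PowerSeries.X) * (1 + PowerSeries.C e * poleSeries (-1 / 2))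
      = 1 + PowerSeries.C (e + 1 / 2) * PowerSeries.X := by
  have h := poleSeries_mul (-1 / 2)
  have hC : (PowerSeries.C (-1 / 2 : ℂ)) = -PowerSeries.C (1 / 2) := by
    rw [← map_neg]; congr 1; norm_num
  rw [hC] at h
  rw [map_add]
  linear_combination PowerSeries.C e * h

/-- `(u + 1/2) s₁₁(u) = u + δ` on `W(δ)`, divided by `u`. -/
theorem charW_pos (δ : ℂ) :
    (1 + PowerSeries.C (1 / 2 : ℂ) * PowerSeries.X) *
        PowerSeries.mk (fun M => charW δ (sGen 1 M 1 1))
      = 1 + PowerSeries.C δ * PowerSeries.X := by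
  have e : PowerSeries.mk (fun M => charW δ (sGen 1 M 1 1))
      = 1 + PowerSeries.C (δ - 1 / 2) * poleSeries (-1 / 2) := by
    refine PowerSeries.ext fun M => ?_
    rw [PowerSeries.coeff_mk, charW_sGen]
    simp [charSeries]
  rw [e, charW_aux, sub_add_cancel]

/-- `(u + 1/2) s_{-1,-1}(u) = u - δ + 1` on `W(δ)`, divided by `u`. -/
theorem charW_neg (δ : ℂ) :
    (1 + PowerSeries.C (1 / 2 : ℂ) * PowerSeries.X) *
        PowerSeries.mk (fun M => charW δ (sGen 1 M (-1) (-1)))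
      = 1 + PowerSeries.C (1 - δ) * PowerSeries.X := by
  have e : PowerSeries.mk (fun M => charW δ (sGen 1 M (-1) (-1)))
      = 1 + PowerSeries.C (1 / 2 - δ) * poleSeries (-1 / 2) := by
    refine PowerSeries.ext fun M => ?_
    rw [PowerSeries.coeff_mk, charW_sGen]
    simp [charSeries]
  rw [e, charW_aux]
  congr 3
  ring

theorem charW_off (δ : ℂ) (M : ℕ) {i j : Idx} (h : i ≠ j) : charW δ (sGen 1 M i j) = 0 := by
  simp [charW_sGen, charSeries, h]

/-- The one-dimensional `Y^+(2)`-module `W(δ)`. -/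
abbrev moduleW (δ : ℂ) : TwistedModule 1 where
  carrier := ℂ
  act := (Algebra.ofId ℂ (Module.End ℂ ℂ)).comp (charW δ)

/-- A subalgebra `B` of `Y^∓(2)` acts on a finite-dimensional module with simple spectrum: there is
a basis of common eigenvectors, with pairwise different systems of eigenvalues. -/
def HasSimpleSpectrum {ε : ℤˣ} (B : Subalgebra ℂ (TwistedYangian ε)) (M : TwistedModule ε) :
    Prop :=
  ∃ (N : ℕ) (b : Module.Basis (Fin N) ℂ M.carrier) (χ : Fin N → TwistedYangian ε → ℂ),
    (∀ n, ∀ x ∈ B, M.act x (b n) = χ n x • b n) ∧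
      ∀ m n, m ≠ n → ∃ x ∈ B, χ m x ≠ χ n x

/-- The `Y^+(2)`-module `L(α₁, β₁) ⊗ ⋯ ⊗ L(α_k, β_k) ⊗ W(δ)`, `β_i = α_i - d_i`. -/
abbrev stringModuleW {k : ℕ} (α : Fin k → ℂ) (d : Fin k → ℕ) (δ : ℂ) : TwistedModule 1 :=
  (stringModule α d).tensorTwisted (moduleW δ)

end TwistedBethe

end

open TwistedBethe

/-!
Up to an invertible scalar series, `σ₁(u)` is `s₁₁(u) - s_{-1,-1}(u)` (`sigmaOne_eq`), and the
reflection equation implies that the coefficients of this series commute with one another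
(`reflection_equation`, `commute_of_reflection`). On every module in question `σ₂(u)` acts by a
scalar series (`isSigma_stringS`): it does so on a one-dimensional module, and tensoring with an
evaluation module multiplies it by two quantum determinants (`IsSigma.site`). Consequently, an
element of the Bethe subalgebra that is a combination of coefficients of
`s₁₁(u) - s_{-1,-1}(u)` commutes, on such a module, with the whole Bethe subalgebra. If its
characteristic polynomial is separable there, then its eigenbasis exhibits simple spectrum
(`hasSimpleSpectrum_of_charpoly`).

To obtain such an element, put `s = t⁻¹`. In the standard basis of `⨂ L(z_p + α_p, z_p + β_p)`,
with `z_p = t u_p`, the series `(1 + u⁻¹/2) (s₁₁(u) - s_{-1,-1}(u))` is a polynomial in `u⁻¹`,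
hence can be evaluated at `u⁻¹ = s w` by a partial sum of its coefficients. With `d_p = α_p - β_p`,
its value on the tensor product with `W(δ)` is `s` times
`2 w ∏ (1 - w² u_p²) · diag (∑ (d_p - 2 m_p) / (1 - w² u_p²) + δ - 1/2)` plus `O(s²)`
(`exists_leadingTerm_betheSeries`), where `m_p` runs through `0, …, d_p`. The restriction of the
tensor product to the twisted Yangian behaves as `δ = 1/2`. Since the `u_p²` are distinct,
uniqueness of partial fraction expansions shows that the diagonal entries are distinct for a
suitable `w` (`exists_separating_point`); if some `u_p` is zero, the weight
`d_p - 2 m_p` is recovered from the value at `w = 0`. As separability of the characteristic polynomial is an open condition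
(`eventually_charpoly_separable`), the spectrum is simple for all small `s ≠ 0`.

The same argument applies to a direct sum of two modules if the values of
`∑ (d_p - 2 m_p) + δ` on the two summands never agree, which is a matter of parity when `δ` is `1`
and `0`, or when `∑ d_p` is lowered by one. For the summands `L'(z₁, …, z_k, 1/2)` and
`L'(z₁ - 1, z₂, …, z_k, 1/2)` the leading terms coincide; there each summand has simple spectrum,
and the scalar series by which `σ₂(u)` acts on them differ unless `2 (z₁ + α₁) - d₁ = 1`
(`siteFactor_sub_one_ne`), an exception that the hypothesis excludes for large `t`.
-/

open scoped TensorProduct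
noncomputable section
namespace TwistedBethe

/-! ### The reflection equation -/

theorem sum_idx {M : Type*} [AddCommMonoid M] (f : Idx → M) : ∑ a : Idx, f a = f 1 + f (-1) := by
  have hu : (Finset.univ : Finset Idx) = {1, -1} := by decide
  rw [hu, Finset.sum_pair (by decide)]

section FourByFour

variable {R B : Type*} [CommRing R] [Ring B] [Algebra R B]

/-- The operator `P` with entries in `B`. -/
def swapMat (B : Type*) [Ring B] : Matrix (Idx × Idx) (Idx × Idx) B :=
  Matrix.of fun a b => if a.1 = b.2 ∧ a.2 = b.1 then 1 else 0

/-- The partial transpose `Q = ∑ (E_{ij})^t ⊗ E_{ji}` of `P`, with entries in `B`. -/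
def swapMatT (B : Type*) [Ring B] (ε : ℤˣ) : Matrix (Idx × Idx) (Idx × Idx) B :=
  Matrix.of fun a b => if a.2 = -a.1 ∧ b.2 = -b.1 then ((theta ε a.1 b.1 : ℤ) : B) else 0

/-- `M ⊗ 1`. -/
def fstMat (M : Matrix Idx Idx B) : Matrix (Idx × Idx) (Idx × Idx) B :=
  Matrix.of fun a b => if a.2 = b.2 then M a.1 b.1 else 0

/-- `1 ⊗ M`. -/
def sndMat (M : Matrix Idx Idx B) : Matrix (Idx × Idx) (Idx × Idx) B :=
  Matrix.of fun a b => if a.1 = b.1 then M a.2 b.2 else 0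

/-- A pair of matrices satisfying the RTT relation with spectral parameter `z / w`, written so that
no inverse is needed, together with the symmetry of its right-hand side. -/
structure IsRTTPair (z w : R) (M N : Matrix Idx Idx B) : Prop where
  comm : ∀ i j k l, z • (M i j * N k l - N k l * M i j) = w • (M k j * N i l - N k j * M i l)
  swap : ∀ i j k l, M k j * N i l - N k j * M i l = N i l * M k j - M i l * N k j

theorem IsRTTPair.symm {z w : R} {M N : Matrix Idx Idx B} (h : IsRTTPair z w M N) :
    IsRTTPair (-z) w N M where
  comm i j k l := by
    have h1 := h.comm k l i j
    rw [h.swap] at h1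
    rw [neg_smul, ← smul_neg, neg_sub]
    exact h1
  swap i j k l := (h.swap k l i j).symm

theorem swapMat_mul (M : Matrix (Idx × Idx) (Idx × Idx) B) (a b : Idx × Idx) :
    (swapMat B * M) a b = M a.swap b := by
  rw [Matrix.mul_apply, Finset.sum_eq_single a.swap]
  · simp [swapMat]
  · intro c _ hc
    rw [swapMat, Matrix.of_apply, if_neg, zero_mul]
    rintro ⟨h1, h2⟩
    exact hc (Prod.ext h2.symm h1.symm)
  · simp

theorem mul_swapMat (M : Matrix (Idx × Idx) (Idx × Idx) B) (a b : Idx × Idx) :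
    (M * swapMat B) a b = M a b.swap := by
  rw [Matrix.mul_apply, Finset.sum_eq_single b.swap]
  · simp [swapMat]
  · intro c _ hc
    rw [swapMat, Matrix.of_apply, if_neg, mul_zero]
    rintro ⟨h1, h2⟩
    exact hc (Prod.ext h1 h2)
  · simp

theorem swapMat_mul_swapMat : swapMat B * swapMat B = 1 := by
  ext a b
  rw [swapMat_mul]
  simp only [swapMat, Matrix.of_apply, Matrix.one_apply, Prod.fst_swap, Prod.snd_swap,
    Prod.ext_iff, and_comm]

theorem fstMat_mul (M : Matrix Idx Idx B) (N : Matrix (Idx × Idx) (Idx × Idx) B) (i k : Idx)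
    (b : Idx × Idx) : (fstMat M * N) (i, k) b = ∑ a, M i a * N (a, k) b := by
  simp [Matrix.mul_apply, Fintype.sum_prod_type, fstMat, -UnitsInt.univ]

theorem mul_fstMat (M : Matrix Idx Idx B) (N : Matrix (Idx × Idx) (Idx × Idx) B) (j l : Idx)
    (b : Idx × Idx) : (N * fstMat M) b (j, l) = ∑ a, N b (a, l) * M a j := by
  simp [Matrix.mul_apply, Fintype.sum_prod_type, fstMat, -UnitsInt.univ]

theorem sndMat_mul (M : Matrix Idx Idx B) (N : Matrix (Idx × Idx) (Idx × Idx) B) (i k : Idx)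
    (b : Idx × Idx) : (sndMat M * N) (i, k) b = ∑ a, M k a * N (i, a) b := by
  rw [Matrix.mul_apply, Fintype.sum_prod_type, Finset.sum_comm]
  simp [sndMat, -UnitsInt.univ]

theorem mul_sndMat (M : Matrix Idx Idx B) (N : Matrix (Idx × Idx) (Idx × Idx) B) (j l : Idx)
    (b : Idx × Idx) : (N * sndMat M) b (j, l) = ∑ a, N b (j, a) * M a l := by
  rw [Matrix.mul_apply, Fintype.sum_prod_type, Finset.sum_comm]
  simp [sndMat, -UnitsInt.univ]

theorem fstMat_mul_sndMat (M N : Matrix Idx Idx B) (i k j l : Idx) :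
    (fstMat M * sndMat N) (i, k) (j, l) = M i j * N k l := by
  rw [fstMat_mul]
  simp [sndMat, -UnitsInt.univ]

theorem sndMat_mul_fstMat (M N : Matrix Idx Idx B) (i k j l : Idx) :
    (sndMat N * fstMat M) (i, k) (j, l) = N k l * M i j := by
  rw [sndMat_mul]
  simp [fstMat, -UnitsInt.univ]

theorem fstMat_mul_fstMat (M N : Matrix Idx Idx B) : fstMat M * fstMat N = fstMat (M * N) := by
  ext ⟨i, k⟩ ⟨j, l⟩
  rw [fstMat_mul]
  by_cases h : k = l <;> simp [fstMat, Matrix.mul_apply, h]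

theorem sndMat_mul_sndMat (M N : Matrix Idx Idx B) : sndMat M * sndMat N = sndMat (M * N) := by
  ext ⟨i, k⟩ ⟨j, l⟩
  rw [sndMat_mul]
  by_cases h : i = j <;> simp [sndMat, Matrix.mul_apply, h]

theorem fstMat_mul_sndMat_comm {M N : Matrix Idx Idx B}
    (h : ∀ i j k l, Commute (M i j) (N k l)) : fstMat M * sndMat N = sndMat N * fstMat M := by
  ext ⟨i, k⟩ ⟨j, l⟩
  rw [fstMat_mul_sndMat, sndMat_mul_fstMat, (h _ _ _ _).eq]

theorem swapMat_mul_fstMat (M : Matrix Idx Idx B) :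
    swapMat B * fstMat M = sndMat M * swapMat B := by
  ext ⟨i, k⟩ ⟨j, l⟩
  rw [swapMat_mul, mul_swapMat]
  simp [fstMat, sndMat]

theorem swapMat_mul_sndMat (M : Matrix Idx Idx B) :
    swapMat B * sndMat M = fstMat M * swapMat B := by
  ext ⟨i, k⟩ ⟨j, l⟩
  rw [swapMat_mul, mul_swapMat]
  simp [fstMat, sndMat]

theorem theta_comm (ε : ℤˣ) (i j : Idx) : theta ε i j = theta ε j i := by
  simp [theta, mul_comm]

theorem swapMat_mul_swapMatT (ε : ℤˣ) :
    swapMat B * swapMatT B ε = swapMatT B ε * swapMat B := by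
  ext ⟨i, k⟩ ⟨j, l⟩
  rw [swapMat_mul, mul_swapMat]
  revert i j k l
  simp only [swapMatT, Matrix.of_apply, Prod.fst_swap, Prod.snd_swap]
  intro i k j l
  rcases Int.units_eq_one_or ε with rfl | rfl <;>
  rcases Int.units_eq_one_or i with rfl | rfl <;> rcases Int.units_eq_one_or j with rfl | rfl <;>
    rcases Int.units_eq_one_or k with rfl | rfl <;>
    rcases Int.units_eq_one_or l with rfl | rfl <;> simp [theta]

theorem commute_swapMat_swapMatT (ε : ℤˣ) : Commute (swapMat B) (swapMatT B ε) :=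
  swapMat_mul_swapMatT ε

theorem IsRTTPair.mul_mul {z w : R} {M N : Matrix Idx Idx B} (h : IsRTTPair z w M N) :
    (z • (1 : Matrix _ _ B) - w • swapMat B) * (fstMat M * sndMat N)
      = sndMat N * fstMat M * (z • (1 : Matrix _ _ B) - w • swapMat B) := by
  ext ⟨i, k⟩ ⟨j, l⟩
  simp only [sub_mul, mul_sub, Matrix.smul_mul, Matrix.mul_smul, one_mul, mul_one,
    Matrix.sub_apply, Matrix.smul_apply, swapMat_mul, mul_swapMat, Prod.swap_prod_mk,
    fstMat_mul_sndMat, sndMat_mul_fstMat]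
  have := h.comm i j k l
  rw [smul_sub, smul_sub] at this
  rw [sub_eq_sub_iff_sub_eq_sub]
  exact this

theorem transp_apply (ε : ℤˣ) (M : Matrix Idx Idx B) (i j : Idx) :
    transp ε M i j = (theta ε i j : ℤ) • M (-j) (-i) := rfl

theorem IsRTTPair.transp_mul_mul {z w : R} {M N : Matrix Idx Idx B} (h : IsRTTPair z w M N)
    (ε : ℤˣ) :
    fstMat (transp ε M) * (z • (1 : Matrix _ _ B) - w • swapMatT B ε) * sndMat N
      = sndMat N * (z • (1 : Matrix _ _ B) - w • swapMatT B ε) * fstMat (transp ε M) := by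
  have e1 : ∀ i k j l, (fstMat (transp ε M) * swapMatT B ε * sndMat N) (i, k) (j, l)
      = theta ε i j • (M k (-i) * N (-j) l) := by
    intro i k j l
    simp only [mul_sndMat, fstMat_mul, sum_idx, swapMatT, Matrix.of_apply, transp_apply]
    rcases Int.units_eq_one_or ε with rfl | rfl <;>
    rcases Int.units_eq_one_or i with rfl | rfl <;> rcases Int.units_eq_one_or j with rfl | rfl <;>
      rcases Int.units_eq_one_or k with rfl | rfl <;> simp [theta]
  have e2 : ∀ i k j l, (sndMat N * swapMatT B ε * fstMat (transp ε M)) (i, k) (j, l)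
      = theta ε i j • (N k (-i) * M (-j) l) := by
    intro i k j l
    simp only [mul_fstMat, sndMat_mul, sum_idx, swapMatT, Matrix.of_apply, transp_apply]
    rcases Int.units_eq_one_or ε with rfl | rfl <;>
    rcases Int.units_eq_one_or i with rfl | rfl <;> rcases Int.units_eq_one_or j with rfl | rfl <;>
      rcases Int.units_eq_one_or l with rfl | rfl <;> simp [theta]
  ext ⟨i, k⟩ ⟨j, l⟩
  simp only [sub_mul, mul_sub, Matrix.smul_mul, Matrix.mul_smul, mul_one,
    Matrix.sub_apply, Matrix.smul_apply, e1, e2, fstMat_mul_sndMat, sndMat_mul_fstMat,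
    transp_apply]
  have := h.comm (-j) (-i) k l
  rw [smul_sub, smul_sub, sub_eq_sub_iff_sub_eq_sub, sub_eq_sub_iff_add_eq_add] at this
  simp only [smul_mul_assoc, mul_smul_comm, smul_comm z, smul_comm w, ← smul_sub]
  congr 1
  rw [sub_eq_sub_iff_add_eq_add, this]

theorem IsRTTPair.transp_mul_transp {z w : R} {M N : Matrix Idx Idx B} (h : IsRTTPair z w M N)
    (ε : ℤˣ) :
    fstMat (transp ε M) * sndMat (transp ε N) * (z • (1 : Matrix _ _ B) - w • swapMat B)
      = (z • (1 : Matrix _ _ B) - w • swapMat B) * (sndMat (transp ε N) * fstMat (transp ε M)) := by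
  have hθ : ∀ i j k l : Idx, theta ε i l * theta ε k j = theta ε i j * theta ε k l := by
    intro i j k l
    rw [← theta_mul ε i j l, mul_assoc, theta_comm ε j l, mul_comm (theta ε l j),
      theta_comm ε l j, theta_mul ε k j l]
  ext ⟨i, k⟩ ⟨j, l⟩
  simp only [sub_mul, mul_sub, Matrix.smul_mul, Matrix.mul_smul, one_mul, mul_one,
    Matrix.sub_apply, Matrix.smul_apply, swapMat_mul, mul_swapMat, Prod.swap_prod_mk,
    fstMat_mul_sndMat, sndMat_mul_fstMat, transp_apply, smul_mul_smul_comm,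
    smul_comm z, smul_comm w]
  rw [hθ i j k l, mul_comm (theta ε k l), ← smul_sub,
    ← smul_sub]
  congr 1
  have := h.comm (-j) (-i) (-l) (-k)
  rw [smul_sub, smul_sub] at this
  rw [sub_eq_sub_iff_sub_eq_sub]
  exact this

/-- The relation `IsRTTPair.transp_mul_transp` for the pair `(N, M)`, conjugated by `P`. -/
theorem IsRTTPair.transp_mul_transp' {z w : R} {M N : Matrix Idx Idx B} (h : IsRTTPair z w M N)
    (ε : ℤˣ) :
    (z • (1 : Matrix _ _ B) + w • swapMat B) * (fstMat (transp ε M) * sndMat (transp ε N))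
      = sndMat (transp ε N) * fstMat (transp ε M) * (z • (1 : Matrix _ _ B) + w • swapMat B) := by
  have h1 := h.symm.transp_mul_transp ε
  have h2 := congrArg (swapMat B * · * swapMat B) h1
  have h3 : ∀ c d : R, Commute (swapMat B) (c • (1 : Matrix _ _ B) - d • swapMat B) := fun c d =>
    ((Commute.one_right _).smul_right c).sub_right ((Commute.refl _).smul_right d)
  have e1 : swapMat B * (fstMat (transp ε N) * sndMat (transp ε M)
      * (-z • (1 : Matrix _ _ B) - w • swapMat B)) * swapMat B
      = sndMat (transp ε N) * fstMat (transp ε M) * (-z • (1 : Matrix _ _ B) - w • swapMat B) := by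
    rw [mul_assoc, mul_assoc (_ * _), ← (h3 _ _).eq, ← mul_assoc, ← mul_assoc, ← mul_assoc,
      swapMat_mul_fstMat, mul_assoc (sndMat _), swapMat_mul_sndMat]
    simp only [← mul_assoc]
    rw [mul_assoc _ (swapMat B) (swapMat B), swapMat_mul_swapMat, mul_one]
  have e2 : swapMat B * ((-z • (1 : Matrix _ _ B) - w • swapMat B)
      * (sndMat (transp ε M) * fstMat (transp ε N))) * swapMat B
      = (-z • (1 : Matrix _ _ B) - w • swapMat B)
        * (fstMat (transp ε M) * sndMat (transp ε N)) := by
    rw [← mul_assoc (swapMat B), (h3 _ _).eq, mul_assoc _ (swapMat B), ← mul_assoc (swapMat B),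
      swapMat_mul_sndMat, mul_assoc (fstMat _), swapMat_mul_fstMat]
    simp only [← mul_assoc]
    rw [mul_assoc _ (swapMat B) (swapMat B), swapMat_mul_swapMat, mul_one]
  rw [e1, e2] at h2
  have e3 : z • (1 : Matrix (Idx × Idx) (Idx × Idx) B) + w • swapMat B
      = -(-z • (1 : Matrix _ _ B) - w • swapMat B) := by
    rw [neg_smul]; abel
  rw [e3, neg_mul, mul_neg, h2]

theorem IsRTTPair.mul_mul_transp {z w : R} {M N : Matrix Idx Idx B} (h : IsRTTPair z w M N)
    (ε : ℤˣ) :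
    fstMat M * (z • (1 : Matrix _ _ B) + w • swapMatT B ε) * sndMat (transp ε N)
      = sndMat (transp ε N) * (z • (1 : Matrix _ _ B) + w • swapMatT B ε) * fstMat M := by
  have h1 := h.symm.transp_mul_mul ε
  have h2 := congrArg (swapMat B * · * swapMat B) h1
  have h3 : ∀ c d : R, Commute (swapMat B) (c • (1 : Matrix _ _ B) - d • swapMatT B ε) :=
    fun c d => ((Commute.one_right _).smul_right c).sub_right
      (Commute.smul_right (commute_swapMat_swapMatT ε) d)
  have e3 : z • (1 : Matrix (Idx × Idx) (Idx × Idx) B) + w • swapMatT B ε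
      = -(-z • (1 : Matrix _ _ B) - w • swapMatT B ε) := by
    rw [neg_smul]; abel
  rw [e3]
  set D := -z • (1 : Matrix (Idx × Idx) (Idx × Idx) B) - w • swapMatT B ε
  have e1 : swapMat B * (fstMat (transp ε N) * D * sndMat M) * swapMat B
      = sndMat (transp ε N) * D * fstMat M := by
    rw [← mul_assoc, ← mul_assoc, swapMat_mul_fstMat, mul_assoc (sndMat _), (h3 _ _).eq,
      mul_assoc, mul_assoc, mul_assoc D, ← mul_assoc (swapMat B), swapMat_mul_sndMat,
      mul_assoc (fstMat _), swapMat_mul_swapMat, mul_one, ← mul_assoc]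
  have e2 : swapMat B * (sndMat M * D * fstMat (transp ε N)) * swapMat B
      = fstMat M * D * sndMat (transp ε N) := by
    rw [← mul_assoc, ← mul_assoc, swapMat_mul_sndMat, mul_assoc (fstMat _), (h3 _ _).eq,
      mul_assoc, mul_assoc, mul_assoc D, ← mul_assoc (swapMat B), swapMat_mul_fstMat,
      mul_assoc (sndMat _), swapMat_mul_swapMat, mul_one, ← mul_assoc]
  rw [e1, e2] at h2
  rw [mul_neg, neg_mul, mul_neg, neg_mul, h2]

/-- The reflection equation for `S₁ = T₁(u) T₁^t(-u)` and `S₂ = T₂(v) T₂^t(-v)`, with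
`u - v = m / w`, `u + v = p / w`. -/
theorem reflection_equation {m p w : R} {T T' U U' : Matrix Idx Idx B} (ε : ℤˣ)
    (h1 : IsRTTPair m w T U) (h2 : IsRTTPair p (-w) T' U) (h3 : IsRTTPair (-p) (-w) T U')
    (h4 : IsRTTPair (-m) w T' U') :
    (m • (1 : Matrix _ _ B) - w • swapMat B) * (fstMat (T * transp ε T')
        * (p • (1 : Matrix _ _ B) + w • swapMatT B ε) * sndMat (U * transp ε U'))
      = sndMat (U * transp ε U') * (p • (1 : Matrix _ _ B) + w • swapMatT B ε)
        * fstMat (T * transp ε T') * (m • (1 : Matrix _ _ B) - w • swapMat B) := by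
  have a1 := h1.mul_mul
  have a2 := h2.transp_mul_mul ε
  have a3 := h3.mul_mul_transp ε
  have a4 := h4.transp_mul_transp' ε
  rw [neg_smul, sub_neg_eq_add] at a2
  have e3 : (-p) • (1 : Matrix (Idx × Idx) (Idx × Idx) B) + (-w) • swapMatT B ε
      = -(p • (1 : Matrix _ _ B) + w • swapMatT B ε) := by
    simp only [neg_smul]; abel
  have e4 : (-m) • (1 : Matrix (Idx × Idx) (Idx × Idx) B) + w • swapMat B
      = -(m • (1 : Matrix _ _ B) - w • swapMat B) := by
    simp only [neg_smul]; abel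
  rw [e3, mul_neg, neg_mul, mul_neg, neg_mul, neg_inj] at a3
  rw [e4, neg_mul, mul_neg, neg_inj] at a4
  have hc : Commute (m • (1 : Matrix _ _ B) - w • swapMat B)
      (p • (1 : Matrix _ _ B) + w • swapMatT B ε) := by
    refine Commute.sub_left ((Commute.one_left _).smul_left m) (Commute.smul_left ?_ w)
    exact ((Commute.one_right _).smul_right p).add_right
      (Commute.smul_right (commute_swapMat_swapMatT ε) w)
  rw [← fstMat_mul_fstMat, ← sndMat_mul_sndMat]
  set r := m • (1 : Matrix (Idx × Idx) (Idx × Idx) B) - w • swapMat B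
  set q := p • (1 : Matrix (Idx × Idx) (Idx × Idx) B) + w • swapMatT B ε
  calc r * (fstMat T * fstMat (transp ε T') * q * (sndMat U * sndMat (transp ε U')))
      = r * fstMat T * (fstMat (transp ε T') * q * sndMat U) * sndMat (transp ε U') := by
        simp only [mul_assoc]
    _ = (r * (fstMat T * sndMat U)) * q * (fstMat (transp ε T') * sndMat (transp ε U')) := by
        rw [a2]; simp only [mul_assoc]
    _ = sndMat U * fstMat T * (r * q) * (fstMat (transp ε T') * sndMat (transp ε U')) := by
        rw [a1]; simp only [mul_assoc]
    _ = sndMat U * fstMat T * q * (r * (fstMat (transp ε T') * sndMat (transp ε U'))) := by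
        rw [hc.eq]; simp only [mul_assoc]
    _ = sndMat U * (fstMat T * q * sndMat (transp ε U')) * fstMat (transp ε T') * r := by
        rw [a4]; simp only [mul_assoc]
    _ = _ := by
        rw [a3]; simp only [mul_assoc]

end FourByFour


section ReflectionEntries

variable {R B : Type*} [CommRing R] [Ring B] [Algebra R B]

/-- The reflection equation, entry by entry. -/
theorem reflection_entries {m p w : R} {S S' : Matrix Idx Idx B} {ε : ℤˣ}
    (h : (m • (1 : Matrix _ _ B) - w • swapMat B) * (fstMat S
        * (p • (1 : Matrix _ _ B) + w • swapMatT B ε) * sndMat S')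
      = sndMat S' * (p • (1 : Matrix _ _ B) + w • swapMatT B ε)
        * fstMat S * (m • (1 : Matrix _ _ B) - w • swapMat B)) (i j k l : Idx) :
    m • (p • (S i j * S' k l) + w • theta ε k (-j) • (S i (-k) * S' (-j) l))
        - w • (p • (S k j * S' i l) + w • theta ε i (-j) • (S k (-i) * S' (-j) l))
      = m • (p • (S' k l * S i j) + w • theta ε i (-l) • (S' k (-i) * S (-l) j))
        - w • (p • (S' k j * S i l) + w • theta ε i (-j) • (S' k (-i) * S (-j) l)) := by
  have e1 : ∀ i k j l, (fstMat S * swapMatT B ε * sndMat S') (i, k) (j, l)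
      = theta ε k (-j) • (S i (-k) * S' (-j) l) := by
    intro i k j l
    simp only [mul_sndMat, fstMat_mul, sum_idx, swapMatT, Matrix.of_apply]
    rcases Int.units_eq_one_or ε with rfl | rfl <;>
    rcases Int.units_eq_one_or k with rfl | rfl <;> rcases Int.units_eq_one_or j with rfl | rfl <;>
      simp [theta]
  have e2 : ∀ i k j l, (sndMat S' * swapMatT B ε * fstMat S) (i, k) (j, l)
      = theta ε i (-l) • (S' k (-i) * S (-l) j) := by
    intro i k j l
    simp only [mul_fstMat, sndMat_mul, sum_idx, swapMatT, Matrix.of_apply]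
    rcases Int.units_eq_one_or ε with rfl | rfl <;>
    rcases Int.units_eq_one_or i with rfl | rfl <;> rcases Int.units_eq_one_or l with rfl | rfl <;>
      simp [theta]
  have := congrFun (congrFun h (i, k)) (j, l)
  simp only [sub_mul, mul_sub, add_mul, mul_add, Matrix.smul_mul, Matrix.mul_smul, one_mul,
    mul_one, Matrix.sub_apply, Matrix.add_apply, Matrix.smul_apply, swapMat_mul, mul_swapMat,
    Prod.swap_prod_mk, fstMat_mul_sndMat, sndMat_mul_fstMat, e1, e2] at this
  linear_combination (norm := module) this

/-- The trace `s₁₁ - s_{-1,-1}` of a solution of the reflection equation commutes with itself at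
different values of the spectral parameter. -/
theorem commute_of_reflection {m p w : R} {S S' : Matrix Idx Idx B} {ε : ℤˣ}
    (h : (m • (1 : Matrix _ _ B) - w • swapMat B) * (fstMat S
        * (p • (1 : Matrix _ _ B) + w • swapMatT B ε) * sndMat S')
      = sndMat S' * (p • (1 : Matrix _ _ B) + w • swapMatT B ε)
        * fstMat S * (m • (1 : Matrix _ _ B) - w • swapMat B))
    (hm : ∀ b : B, m • b = 0 → b = 0) (hp : ∀ b : B, p • b = 0 → b = 0)
    (hmw : ∀ b : B, (m - w) • b = 0 → b = 0) (hmw' : ∀ b : B, (m + w) • b = 0 → b = 0)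
    (hpw : ∀ b : B, (p - w) • b = 0 → b = 0) (hpw' : ∀ b : B, (p + w) • b = 0 → b = 0) :
    Commute (S 1 1 - S (-1) (-1)) (S' 1 1 - S' (-1) (-1)) := by
  have E := reflection_entries h
  -- the sign `ε`, as an element of the ground ring
  obtain ⟨e, he, hθ1, hθ2⟩ : ∃ e : R, e * e = 1 ∧ (∀ b : B, theta ε 1 (-1) • b = e • b)
      ∧ ∀ b : B, theta ε (-1) 1 • b = e • b := by
    rcases Int.units_eq_one_or ε with rfl | rfl
    · exact ⟨1, by simp, by simp [theta], by simp [theta]⟩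
    · exact ⟨-1, by simp, by simp [theta], by simp [theta]⟩
  have hθ3 : theta ε 1 1 = 1 := by simp [theta]
  have hθ4 : theta ε (-1) (-1) = 1 := by simp [theta]
  have E1 := E 1 1 1 1
  have E2 := E (-1) (-1) (-1) (-1)
  have E3 := E 1 1 (-1) (-1)
  have E4 := E (-1) (-1) 1 1
  have E5 := E 1 (-1) (-1) 1
  have E6 := E (-1) 1 1 (-1)
  simp only [neg_neg, hθ1, hθ2, hθ3, hθ4, one_smul] at E1 E2 E3 E4 E5 E6
  set A := S 1 1 * S' 1 1 - S' 1 1 * S 1 1 + (S (-1) (-1) * S' (-1) (-1)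
    - S' (-1) (-1) * S (-1) (-1)) with hA
  set F := S 1 1 * S' (-1) (-1) - S' (-1) (-1) * S 1 1 + (S (-1) (-1) * S' 1 1
    - S' 1 1 * S (-1) (-1)) with hF
  set Z := S 1 (-1) * S' (-1) 1 - S' 1 (-1) * S (-1) 1 + (S (-1) 1 * S' 1 (-1)
    - S' (-1) 1 * S 1 (-1)) with hZ
  -- six entries combine into three linear equations for the symmetrised commutators `A`, `F`, `Z`,
  -- whose determinant is a product of factors that act injectively
  have F1 : p • A + (w * e) • Z = 0 := by
    apply hmw
    rw [hA, hZ]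
    linear_combination (norm := module) E1 + E2
  have F2 : (m * (p + w)) • F = (w * p) • Z + (w * w * e) • A := by
    rw [hA, hF, hZ]
    linear_combination (norm := module) E3 + E4
  have F3 : (m * p) • Z + (m * w * e) • A = (w * (p + w)) • F := by
    rw [hA, hF, hZ]
    linear_combination (norm := module) E5 + E6
  have hZ0 : Z = 0 := by
    apply hmw
    apply hmw'
    apply hpw
    apply hpw'
    have hee : ∀ b : B, (e * e) • b = b := fun b => by rw [he, one_smul]
    linear_combination (norm := module) (m * p) • F3 + (w * p) • F2 - (m * m * w * e) • F1
      + (w * w * w * e) • F1 + (m * m * w * w - w * w * w * w) • hee Z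
  have hA0 : A = 0 := hp _ (by rw [hZ0, smul_zero, add_zero] at F1; exact F1)
  have hF0 : F = 0 := by
    apply hpw'
    apply hm
    rw [smul_smul, F2, hZ0, hA0, smul_zero, smul_zero, add_zero]
  have : A - F = 0 := by rw [hA0, hF0, sub_zero]
  rw [Commute, SemiconjBy, ← sub_eq_zero, ← this, hA, hF]
  noncomm_ring

end ReflectionEntries


/-! ### The commuting family of coefficients of `s₁₁(u) - s_{-1,-1}(u)` -/

section TwoVariables

variable {A : Type*} [Ring A]

/-- The substitution `u ↦ -u` as a ring homomorphism. -/
def negUHom (A : Type*) [Ring A] : PowerSeries A →+* PowerSeries A where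
  toFun := negU
  map_one' := by
    refine PowerSeries.ext fun n => ?_
    rcases n with _ | n <;> simp [coeff_negU, PowerSeries.coeff_one]
  map_mul' := negU_mul
  map_zero' := by
    refine PowerSeries.ext fun n => ?_
    simp [coeff_negU]
  map_add' f g := by
    refine PowerSeries.ext fun n => ?_
    simp [coeff_negU, mul_add]

theorem negUHom_apply (f : PowerSeries A) : negUHom A f = negU f := rfl

theorem negU_C (a : A) : negU (PowerSeries.C a) = PowerSeries.C a := by
  refine PowerSeries.ext fun n => ?_
  rcases n with _ | n <;> simp [coeff_negU, PowerSeries.coeff_C]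

theorem negU_X : negU (PowerSeries.X : PowerSeries A) = -PowerSeries.X := by
  refine PowerSeries.ext fun n => ?_
  rcases n with _ | _ | n <;> simp [coeff_negU, PowerSeries.coeff_X]

/-- `u ↦ -u` in a series in two variables `u`, `v`. -/
def negX (A : Type*) [Ring A] : PowerSeries (PowerSeries A) →+* PowerSeries (PowerSeries A) :=
  PowerSeries.map (negUHom A)

/-- `v ↦ -v` in a series in two variables `u`, `v`. -/
def negY (A : Type*) [Ring A] : PowerSeries (PowerSeries A) →+* PowerSeries (PowerSeries A) :=
  negUHom (PowerSeries A)

theorem negX_serX (f : PowerSeries A) : negX A (serX f) = serX (negU f) := by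
  simp [negX, serX, negUHom_apply]

theorem negX_serY (f : PowerSeries A) : negX A (serY f) = serY f := by
  refine PowerSeries.ext fun n => ?_
  simp [negX, serY, negUHom_apply, negU_C]

theorem negY_serX (f : PowerSeries A) : negY A (serX f) = serX f := negU_C f

theorem negY_serY (f : PowerSeries A) : negY A (serY f) = serY (negU f) :=
  (negU_map (PowerSeries.C (R := A)) f).symm

theorem serX_neg (f : PowerSeries A) : serX (-f) = -serX f := map_neg _ _

theorem serY_neg (f : PowerSeries A) : serY (-f) = -serY f := map_neg _ _

/-- The first variable `u⁻¹` as a central element. -/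
def centralX (A : Type*) [Ring A] : Subring.center (PowerSeries (PowerSeries A)) :=
  ⟨serX PowerSeries.X, Subring.mem_center_iff.mpr fun b => (commute_serX_X b).eq.symm⟩

/-- The second variable `v⁻¹` as a central element. -/
def centralY (A : Type*) [Ring A] : Subring.center (PowerSeries (PowerSeries A)) :=
  ⟨serY PowerSeries.X, Subring.mem_center_iff.mpr fun b => (commute_serY_X b).eq.symm⟩

theorem serX_serY_swap {t : ℕ → Idx → Idx → A} (h : IsRTT t) (i j k l : Idx) :
    serX (genMatrix t k j) * serY (genMatrix t i l)
        - serY (genMatrix t k j) * serX (genMatrix t i l)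
      = serY (genMatrix t i l) * serX (genMatrix t k j)
        - serX (genMatrix t i l) * serY (genMatrix t k j) := by
  refine PowerSeries.ext fun s => PowerSeries.ext fun r => ?_
  simp only [map_sub, coeff_serX_mul_serY, coeff_serY_mul_serX, coeff_genMatrix]
  rw [← h.comm r s i j k l, ← h.comm s r k l i j]
  abel

/-- The RTT relation between `T(±u)` and `T(±v)`. -/
theorem isRTTPair_ser {t : ℕ → Idx → Idx → A} (h : IsRTT t) :
    IsRTTPair (centralY A - centralX A) (centralX A * centralY A)
        ((genMatrix t).map serX) ((genMatrix t).map serY) ∧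
      IsRTTPair (centralX A + centralY A) (-(centralX A * centralY A))
        (((genMatrix t).map negU).map serX) ((genMatrix t).map serY) ∧
      IsRTTPair (-(centralX A + centralY A)) (-(centralX A * centralY A))
        ((genMatrix t).map serX) (((genMatrix t).map negU).map serY) ∧
      IsRTTPair (-(centralY A - centralX A)) (centralX A * centralY A)
        (((genMatrix t).map negU).map serX) (((genMatrix t).map negU).map serY) := by
  have hc := h.series
  have hs := serX_serY_swap h
  refine ⟨⟨fun i j k l => ?_, fun i j k l => ?_⟩, ⟨fun i j k l => ?_, fun i j k l => ?_⟩,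
    ⟨fun i j k l => ?_, fun i j k l => ?_⟩, ⟨fun i j k l => ?_, fun i j k l => ?_⟩⟩
  · exact hc i j k l
  · exact hs i j k l
  · have := congrArg (negX A) (hc i j k l)
    simp only [map_mul, map_sub, negX_serX, negX_serY, negU_X, serX_neg] at this
    simpa only [Matrix.map_apply, Subring.smul_def, Subring.coe_add, Subring.coe_neg,
      Subring.coe_mul, centralX, centralY, sub_neg_eq_add, neg_mul, add_comm (serY _),
      smul_eq_mul] using this
  · have := congrArg (negX A) (hs i j k l)
    simpa only [Matrix.map_apply, map_mul, map_sub, negX_serX, negX_serY] using this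
  · have := congrArg (negY A) (hc i j k l)
    simp only [map_mul, map_sub, negY_serX, negY_serY, negU_X, serY_neg] at this
    rw [← neg_add', add_comm] at this
    simpa only [Matrix.map_apply, Subring.smul_def, Subring.coe_add, Subring.coe_neg,
      Subring.coe_mul, centralX, centralY, neg_mul, mul_neg, smul_eq_mul] using this
  · have := congrArg (negY A) (hs i j k l)
    simpa only [Matrix.map_apply, map_mul, map_sub, negY_serX, negY_serY] using this
  · have := congrArg (fun F => negX A (negY A F)) (hc i j k l)
    simp only [map_mul, map_sub, negY_serX, negY_serY, negX_serX, negX_serY, negU_X, serY_neg,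
      serX_neg, map_neg] at this
    rw [neg_sub_neg, ← neg_sub] at this
    simpa only [Matrix.map_apply, Subring.smul_def, AddSubgroupClass.coe_sub, Subring.coe_neg,
      Subring.coe_mul, centralX, centralY, neg_mul, mul_neg, neg_neg, smul_eq_mul] using this
  · have := congrArg (fun F => negX A (negY A F)) (hs i j k l)
    simpa only [Matrix.map_apply, map_mul, map_sub, negY_serX, negY_serY, negX_serX,
      negX_serY] using this

/-- Left multiplication by a power series is injective if left multiplication by its constant
coefficient is. -/
theorem eq_zero_of_mul_eq_zero_of_coeff {G F : PowerSeries A}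
    (hG : ∀ a, PowerSeries.coeff 0 G * a = 0 → a = 0) (h : G * F = 0) : F = 0 := by
  refine PowerSeries.ext fun n => ?_
  induction n using Nat.strong_induction_on with
  | _ n ih =>
    apply hG
    have := congrArg (PowerSeries.coeff n) h
    rw [PowerSeries.coeff_mul, Finset.sum_eq_single (0, n)] at this
    · simpa using this
    · rintro ⟨a, b⟩ hab hne
      have hb : b < n := by
        rw [Finset.HasAntidiagonal.mem_antidiagonal] at hab
        rcases Nat.eq_zero_or_pos a with rfl | ha
        · exact absurd (by rw [← hab, zero_add]) hne
        · omega
      rw [ih b hb, map_zero, mul_zero]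
    · simp

/-- The constant coefficient with respect to `v⁻¹` of a central series. -/
def centralCoeff (A : Type*) [Ring A] :
    Subring.center (PowerSeries (PowerSeries A)) →+* PowerSeries A :=
  (PowerSeries.constantCoeff (R := PowerSeries A)).comp (Subring.center _).subtype

theorem centralCoeff_X : centralCoeff A (centralX A) = PowerSeries.X := by
  simp [centralCoeff, centralX, serX]

theorem centralCoeff_Y : centralCoeff A (centralY A) = 0 := by
  simp [centralCoeff, centralY, serY]

theorem smul_eq_zero_of_coeff {c : Subring.center (PowerSeries (PowerSeries A))}
    (hc : centralCoeff A c = PowerSeries.X ∨ centralCoeff A c = -PowerSeries.X)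
    (b : PowerSeries (PowerSeries A)) (h : c • b = 0) : b = 0 := by
  refine eq_zero_of_mul_eq_zero_of_coeff (fun a ha => ?_) h
  have hX : PowerSeries.X * a = 0 := by
    have e : PowerSeries.coeff 0 (c : PowerSeries (PowerSeries A)) = centralCoeff A c := by
      simp [centralCoeff]
    rw [e] at ha
    rcases hc with hc | hc
    · rwa [hc] at ha
    · rwa [hc, neg_mul, neg_eq_zero] at ha
  refine PowerSeries.ext fun n => ?_
  have := congrArg (PowerSeries.coeff (n + 1)) hX
  rwa [PowerSeries.coeff_succ_X_mul] at this

theorem map_transp {B : Type*} [Ring B] (φ : A →+* B) (ε : ℤˣ) (M : Matrix Idx Idx A) :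
    (transp ε M).map φ = transp ε (M.map φ) := by
  ext i j
  simp [transp]

/-- The series `s₁₁(u) - s_{-1,-1}(u)` for a matrix `S(u)`. -/
def trC (S : Matrix Idx Idx (PowerSeries A)) : PowerSeries A := S 1 1 - S (-1) (-1)

theorem commute_coeff_trC {t : ℕ → Idx → Idx → A} (h : IsRTT t) (ε : ℤˣ) (m n : ℕ) :
    Commute (PowerSeries.coeff m (trC (sMatrix ε (genMatrix t))))
      (PowerSeries.coeff n (trC (sMatrix ε (genMatrix t)))) := by
  obtain ⟨h1, h2, h3, h4⟩ := isRTTPair_ser h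
  have hRE := reflection_equation ε h1 h2 h3 h4
  have eX : (genMatrix t).map serX * transp ε (((genMatrix t).map negU).map serX)
      = (sMatrix ε (genMatrix t)).map serX := by
    have := Matrix.map_mul (L := genMatrix t) (M := transp ε ((genMatrix t).map negU))
      (f := PowerSeries.C (R := PowerSeries A))
    rw [map_transp] at this
    exact this.symm
  have eY : (genMatrix t).map serY * transp ε (((genMatrix t).map negU).map serY)
      = (sMatrix ε (genMatrix t)).map serY := by
    have := Matrix.map_mul (L := genMatrix t) (M := transp ε ((genMatrix t).map negU))
      (f := PowerSeries.map (PowerSeries.C (R := A)))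
    rw [map_transp] at this
    exact this.symm
  rw [eX, eY] at hRE
  have key := commute_of_reflection hRE
    (smul_eq_zero_of_coeff (by simp [centralCoeff_X, centralCoeff_Y]))
    (smul_eq_zero_of_coeff (by simp [centralCoeff_X, centralCoeff_Y]))
    (smul_eq_zero_of_coeff (by simp [centralCoeff_X, centralCoeff_Y]))
    (smul_eq_zero_of_coeff (by simp [centralCoeff_X, centralCoeff_Y]))
    (smul_eq_zero_of_coeff (by simp [centralCoeff_X, centralCoeff_Y]))
    (smul_eq_zero_of_coeff (by simp [centralCoeff_X, centralCoeff_Y]))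
  have e1 : (sMatrix ε (genMatrix t)).map serX 1 1 - (sMatrix ε (genMatrix t)).map serX (-1) (-1)
      = serX (trC (sMatrix ε (genMatrix t))) :=
    (map_sub (PowerSeries.C (R := PowerSeries A)) _ _).symm
  have e2 : (sMatrix ε (genMatrix t)).map serY 1 1 - (sMatrix ε (genMatrix t)).map serY (-1) (-1)
      = serY (trC (sMatrix ε (genMatrix t))) :=
    (map_sub (PowerSeries.map (PowerSeries.C (R := A))) _ _).symm
  rw [e1, e2] at key
  have := congrArg (fun F => PowerSeries.coeff m (PowerSeries.coeff n F)) key.eq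
  rw [coeff_serX_mul_serY, coeff_serY_mul_serX] at this
  exact this

end TwoVariables


/-! ### The series `σ₁` and `σ₂` -/

section SigmaFormulas

variable {A : Type*} [Ring A]

theorem onFirst_eq (M : Matrix Idx Idx (PowerSeries A)) : onFirst M = fstMat M := by
  ext1 ⟨i, k⟩ ⟨j, l⟩
  by_cases h : k = l <;> simp [onFirst, fstMat, h]

theorem onSecond_eq (M : Matrix Idx Idx (PowerSeries A)) : onSecond M = sndMat M := by
  ext1 ⟨i, k⟩ ⟨j, l⟩
  by_cases h : i = j <;> simp [onSecond, sndMat, h]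

theorem trace_antisym_mul (M : Matrix (Idx × Idx) (Idx × Idx) (PowerSeries A)) :
    Matrix.trace ((1 - swapMat (PowerSeries A)) * M)
      = (M (1, -1) (1, -1) - M (-1, 1) (1, -1)) + (M (-1, 1) (-1, 1) - M (1, -1) (-1, 1)) := by
  simp only [Matrix.trace, Matrix.diag_apply, Fintype.sum_prod_type, sum_idx, sub_mul, one_mul,
    Matrix.sub_apply, swapMat_mul, Prod.swap_prod_mk, sub_self, zero_add, add_zero]

theorem permOp_eq : permOp = swapMat ℂ := by
  ext1 ⟨i, k⟩ ⟨j, l⟩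
  simp only [permOp, sum_idx, Matrix.add_apply, Matrix.kroneckerMap_apply, Matrix.single_apply,
    swapMat, Matrix.of_apply]
  rcases Int.units_eq_one_or i with rfl | rfl <;> rcases Int.units_eq_one_or j with rfl | rfl <;>
    rcases Int.units_eq_one_or k with rfl | rfl <;>
    rcases Int.units_eq_one_or l with rfl | rfl <;> simp

theorem permOpT_eq (ε : ℤˣ) : permOpT ε = swapMatT ℂ ε := by
  ext1 ⟨i, k⟩ ⟨j, l⟩
  simp only [permOpT, sum_idx, Matrix.add_apply, Matrix.kroneckerMap_apply, Matrix.single_apply,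
    swapMatT, Matrix.of_apply, transp_apply]
  rcases Int.units_eq_one_or i with rfl | rfl <;> rcases Int.units_eq_one_or j with rfl | rfl <;>
    rcases Int.units_eq_one_or k with rfl | rfl <;>
    rcases Int.units_eq_one_or l with rfl | rfl <;> simp

variable [Algebra ℂ A]

/-- Scalar series as elements of `A[[u⁻¹]]`. -/
def scal (A : Type*) [Ring A] [Algebra ℂ A] : PowerSeries ℂ →+* PowerSeries A :=
  PowerSeries.map (algebraMap ℂ A)

theorem commute_scal (f : PowerSeries ℂ) (g : PowerSeries A) : Commute (scal A f) g := by
  refine PowerSeries.ext fun n => ?_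
  rw [PowerSeries.coeff_mul, PowerSeries.coeff_mul, ← Finset.Nat.sum_antidiagonal_swap]
  refine Finset.sum_congr rfl fun p _ => ?_
  simp only [Prod.fst_swap, Prod.snd_swap, scal, PowerSeries.coeff_map]
  exact Algebra.commutes _ _

/-- `A[[u⁻¹]]` as an algebra over `ℂ[[u⁻¹]]`. -/
abbrev seriesAlgebra (A : Type*) [Ring A] [Algebra ℂ A] :
    Algebra (PowerSeries ℂ) (PowerSeries A) :=
  (scal A).toAlgebra' fun f g => (commute_scal f g).eq

theorem liftConst_antisym : (liftConst antisym : Matrix _ _ (PowerSeries A))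
    = (PowerSeries.C (algebraMap ℂ A (1 / 2))) • (1 - swapMat (PowerSeries A)) := by
  ext1 ⟨i, k⟩ ⟨j, l⟩
  rw [antisym, permOp_eq]
  by_cases h1 : i = l ∧ k = j <;> by_cases h2 : i = j ∧ k = l <;>
    simp [liftConst, swapMat, Matrix.one_apply, h1, h2]

theorem liftSeries_rMatrixT (ε : ℤˣ) (c : ℂ) :
    (liftSeries (rMatrixT ε c) : Matrix _ _ (PowerSeries A))
    = 1 - scal A (invAffine c) • swapMatT (PowerSeries A) ε := by
  ext1 ⟨i, k⟩ ⟨j, l⟩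
  rw [rMatrixT, permOpT_eq]
  have e1 : (PowerSeries.map (algebraMap ℂ A)) ((1 : Matrix _ _ (PowerSeries ℂ)) (i, k) (j, l))
      = (1 : Matrix _ _ (PowerSeries A)) (i, k) (j, l) := by
    simp only [Matrix.one_apply, apply_ite (PowerSeries.map (algebraMap ℂ A)), map_one, map_zero]
  have e2 : PowerSeries.map (algebraMap ℂ A) (PowerSeries.C (swapMatT ℂ ε (i, k) (j, l)))
      = swapMatT (PowerSeries A) ε (i, k) (j, l) := by
    by_cases h1 : k = -i ∧ l = -j
    · simp only [swapMatT, Matrix.of_apply, if_pos h1, map_intCast]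
    · simp only [swapMatT, Matrix.of_apply, if_neg h1, map_zero]
  simp only [liftSeries, Matrix.map_apply, Matrix.sub_apply, Matrix.smul_apply, map_sub,
    smul_eq_mul, map_mul, e1, e2, scal]

/-- The scalar factor by which `σ₁(u)` differs from `s₁₁(u) - s_{-1,-1}(u)`. -/
def sigmaOneFactor (ε : ℤˣ) : PowerSeries ℂ :=
  -PowerSeries.C (1 / 2 : ℂ) * (1 - PowerSeries.C (((ε : ℤ) : ℂ) + 1) * invAffine 3)

theorem sigmaOne_eq (ε : ℤˣ) (S : Matrix Idx Idx (PowerSeries A)) :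
    sigmaOne ε S = scal A (sigmaOneFactor ε) * trC S := by
  have e1 : ∀ c : PowerSeries ℂ, ∀ i k j l,
      (fstMat S * (1 - scal A c • swapMatT (PowerSeries A) ε)
        * sndMat (liftConst fMatrix : Matrix _ _ (PowerSeries A))) (i, k) (j, l)
      = S i j * (liftConst fMatrix : Matrix _ _ (PowerSeries A)) k l - scal A c * (theta ε k (-j)
        • (S i (-k) * (liftConst fMatrix : Matrix _ _ (PowerSeries A)) (-j) l)) := by
    intro c i k j l
    rw [mul_sub, sub_mul, mul_one, Matrix.sub_apply, fstMat_mul_sndMat]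
    congr 1
    have : fstMat S * scal A c • swapMatT (PowerSeries A) ε
        = scal A c • (fstMat S * swapMatT (PowerSeries A) ε) := by
      ext1 a b
      simp only [Matrix.mul_apply, Matrix.smul_apply, smul_eq_mul, Finset.mul_sum]
      refine Finset.sum_congr rfl fun x _ => ?_
      rw [← mul_assoc, ← (commute_scal c _).eq, mul_assoc]
    rw [this, Matrix.smul_mul, Matrix.smul_apply, smul_eq_mul]
    congr 1
    simp only [mul_sndMat, fstMat_mul, sum_idx, swapMatT, Matrix.of_apply]
    rcases Int.units_eq_one_or ε with rfl | rfl <;>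
    rcases Int.units_eq_one_or k with rfl | rfl <;> rcases Int.units_eq_one_or j with rfl | rfl <;>
      simp [theta]
  have hf : (liftConst fMatrix : Matrix _ _ (PowerSeries A)) 1 1 = 1 := by
    simp [liftConst, fMatrix]
  have hf2 : (liftConst fMatrix : Matrix _ _ (PowerSeries A)) (-1) (-1) = -1 := by
    simp [liftConst, fMatrix]
  have hf3 : (liftConst fMatrix : Matrix _ _ (PowerSeries A)) 1 (-1) = 0 := by
    simp [liftConst, fMatrix]
  have hf4 : (liftConst fMatrix : Matrix _ _ (PowerSeries A)) (-1) 1 = 0 := by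
    simp [liftConst, fMatrix]
  rw [sigmaOne, onFirst_eq, onSecond_eq, liftConst_antisym, liftSeries_rMatrixT, Matrix.smul_mul,
    Matrix.smul_mul, Matrix.smul_mul, Matrix.trace_smul, mul_assoc, mul_assoc,
    trace_antisym_mul, ← mul_assoc]
  simp only [e1, hf, hf2, hf3, hf4, neg_neg, mul_zero]
  have hc : PowerSeries.C (algebraMap ℂ A (1 / 2)) = scal A (PowerSeries.C (1 / 2)) := by
    simp [scal]
  rw [hc, sigmaOneFactor, trC, map_mul, map_neg, map_sub, map_mul, map_one]
  generalize scal A (PowerSeries.C (1 / 2)) = x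
  generalize scal A (invAffine 3) = y
  rcases Int.units_eq_one_or ε with rfl | rfl
  · have h2 : scal A (PowerSeries.C ((((1 : ℤˣ) : ℤ) : ℂ) + 1)) = 1 + 1 := by
      rw [map_add, map_add, Units.val_one, Int.cast_one, map_one, map_one]
    rw [h2]
    simp only [theta, smul_eq_mul]
    simp
    noncomm_ring
  · have h2 : scal A (PowerSeries.C ((((-1 : ℤˣ) : ℤ) : ℂ) + 1)) = 0 := by
      simp
    rw [h2]
    simp only [theta, smul_eq_mul]
    simp
    noncomm_ring

end SigmaFormulas

section Shift

variable {A : Type*} [Ring A]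

theorem coeff_shiftU (f : PowerSeries A) (m : ℕ) : PowerSeries.coeff m (shiftU f)
    = ∑ r ∈ Finset.range (m + 1), (Nat.choose (m - 1) (m - r)) • PowerSeries.coeff r f := by
  simp [shiftU]

theorem shiftU_add (f g : PowerSeries A) : shiftU (f + g) = shiftU f + shiftU g := by
  refine PowerSeries.ext fun m => ?_
  simp [coeff_shiftU, smul_add, Finset.sum_add_distrib]

theorem shiftU_zero : shiftU (0 : PowerSeries A) = 0 := by
  refine PowerSeries.ext fun m => ?_
  simp [coeff_shiftU]

theorem shiftU_C_mul (a : A) (f : PowerSeries A) :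
    shiftU (PowerSeries.C a * f) = PowerSeries.C a * shiftU f := by
  refine PowerSeries.ext fun m => ?_
  simp only [coeff_shiftU, PowerSeries.coeff_C_mul, Finset.mul_sum, mul_smul_comm]

theorem shiftU_mul_C (a : A) (f : PowerSeries A) :
    shiftU (f * PowerSeries.C a) = shiftU f * PowerSeries.C a := by
  refine PowerSeries.ext fun m => ?_
  simp only [coeff_shiftU, PowerSeries.coeff_mul_C, Finset.sum_mul, smul_mul_assoc]

theorem shiftU_one : shiftU (1 : PowerSeries A) = 1 := by
  refine PowerSeries.ext fun m => ?_
  rw [coeff_shiftU, Finset.sum_eq_single 0]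
  · rcases m with _ | m
    · simp
    · simp [PowerSeries.coeff_one]
  · intro b _ hb
    simp [PowerSeries.coeff_one, hb]
  · simp

theorem shiftU_map {A' : Type*} [Ring A'] (φ : A →+* A') (f : PowerSeries A) :
    PowerSeries.map φ (shiftU f) = shiftU (PowerSeries.map φ f) := by
  refine PowerSeries.ext fun m => ?_
  simp [coeff_shiftU]

theorem shiftU_X_mul_aux (f : PowerSeries A) :
    (1 - PowerSeries.X) * shiftU (PowerSeries.X * f) = PowerSeries.X * shiftU f := by
  refine PowerSeries.ext fun m => ?_
  have h0 : ∀ m, PowerSeries.coeff (m + 1) (shiftU (PowerSeries.X * f))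
      = ∑ r ∈ Finset.range (m + 1), (Nat.choose m (m - r)) • PowerSeries.coeff r f := by
    intro m
    rw [coeff_shiftU, Finset.sum_range_succ']
    simp
  rcases m with _ | _ | m
  · rw [sub_mul, one_mul, map_sub, PowerSeries.coeff_zero_X_mul, PowerSeries.coeff_zero_X_mul,
      coeff_shiftU]
    simp
  · rw [sub_mul, one_mul, map_sub, PowerSeries.coeff_succ_X_mul, PowerSeries.coeff_succ_X_mul, h0]
    simp [coeff_shiftU]
  · rw [sub_mul, one_mul, map_sub, PowerSeries.coeff_succ_X_mul, PowerSeries.coeff_succ_X_mul, h0,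
      h0, coeff_shiftU, Finset.sum_range_succ, Finset.sum_range_succ _ (m + 1), add_sub_right_comm,
      ← Finset.sum_sub_distrib]
    congr 1
    · refine Finset.sum_congr rfl fun r hr => ?_
      rw [Finset.mem_range] at hr
      have e : m + 1 - r = (m - r) + 1 := by omega
      rw [e, Nat.choose_succ_succ, add_smul, add_sub_cancel_left]
      simp
    · simp

/-- The series `(u - 1)⁻¹`. -/
def shiftX (A : Type*) [Ring A] : PowerSeries A := shiftU PowerSeries.X

theorem one_sub_X_mul_shiftX : (1 - PowerSeries.X) * shiftX A = PowerSeries.X := by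
  have := shiftU_X_mul_aux (1 : PowerSeries A)
  rwa [mul_one, shiftU_one, mul_one] at this

theorem one_sub_X_mul_cancel {f g : PowerSeries A}
    (h : (1 - PowerSeries.X) * f = (1 - PowerSeries.X) * g) : f = g := by
  rw [← sub_eq_zero] at h ⊢
  rw [← mul_sub] at h
  exact eq_zero_of_mul_eq_zero_of_coeff (fun a ha => by simpa using ha) h

theorem shiftU_X_mul (f : PowerSeries A) :
    shiftU (PowerSeries.X * f) = shiftX A * shiftU f := by
  apply one_sub_X_mul_cancel
  rw [shiftU_X_mul_aux, ← mul_assoc, one_sub_X_mul_shiftX]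

theorem shiftX_sub_X : shiftX A - PowerSeries.X = PowerSeries.X * shiftX A := by
  have := one_sub_X_mul_shiftX (A := A)
  rw [sub_mul, one_mul] at this
  rw [sub_eq_iff_eq_add, ← sub_eq_iff_eq_add']
  exact this

end Shift


section Site

variable {R B : Type*} [CommRing R] [Ring B] [Algebra R B]

/-- The matrix `1 + m E`. -/
def siteMat (m : R) (E : Idx → Idx → B) : Matrix Idx Idx B :=
  Matrix.of fun i j => (if i = j then 1 else 0) + m • E i j

/-- With `u⁻¹ = m` and `v⁻¹ = n`, the relation on `ζ` says `ζ = (u - v)⁻¹`. -/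
theorem isRTTPair_siteMat {E : Idx → Idx → B} (hE : IsGL2 E) {m n ζ : R}
    (h : ζ * (n - m) = m * n) : IsRTTPair 1 ζ (siteMat m E) (siteMat n E) := by
  -- write the Kronecker symbols as scalars
  obtain ⟨δ, hδ⟩ : ∃ δ : Idx → Idx → R, ∀ i j (b : B), (if i = j then b else 0) = δ i j • b :=
    ⟨fun i j => if i = j then 1 else 0, fun i j b => by split_ifs with h <;> simp [h]⟩
  have hg : ∀ i j k l, E i j * E k l - E k l * E i j = δ k j • E i l - δ i l • E k j := by
    intro i j k l
    rw [hE, hδ, hδ]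
  have e : ∀ i j (c : R), siteMat c E i j = δ i j • 1 + c • E i j := by
    intro i j c
    rw [siteMat, Matrix.of_apply, hδ]
  refine ⟨fun i j k l => ?_, fun i j k l => ?_⟩
  · simp only [e, add_mul, mul_add, smul_mul_assoc, mul_smul_comm, one_mul, mul_one]
    linear_combination (norm := module) (m * n) • hg i j k l - h • (δ k j • E i l - δ i l • E k j)
  · simp only [e, add_mul, mul_add, smul_mul_assoc, mul_smul_comm, one_mul, mul_one]
    module

/-- The quantum determinant `t₁₁(u) t_{-1,-1}(u - 1) - t_{-1,1}(u) t_{1,-1}(u - 1)` of `1 + u⁻¹ E`,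
with `x = u⁻¹` and `y = (u - 1)⁻¹`, in terms of the trace and the Casimir element. -/
theorem qdet_aux {x y : R} (h : y - x = x * y) (p q r s : B) :
    (1 + x • p) * (1 + y • q) - x • r * y • s
      = 1 + x • (p + q) + (x * y) • ((p + q) + (p * q - r * s - p)) := by
  simp only [add_mul, mul_add, smul_mul_assoc, mul_smul_comm, one_mul, mul_one]
  linear_combination (norm := module) h • q

/-- The analogue of `qdet_aux` for the transposed matrix at `-u`. -/
theorem qdet_aux' {x y : R} (h : y - x = x * y) {p q : B} (r s : B) (hpq : q * p = p * q) :
    (1 + (-x) • q) * (1 + (-y) • p) - (-x) • r * (-y) • s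
      = 1 - x • (p + q) + (x * y) • (p * q - r * s - p) := by
  simp only [add_mul, mul_add, smul_mul_assoc, mul_smul_comm, one_mul, mul_one]
  linear_combination (norm := module) (x * y) • hpq - h • p

/-- `(1 - P) M` is a multiple of `1 - P` if it is also of the form `M' (1 - P)`: the image of
`1 - P` is one-dimensional. -/
theorem antisym_mul_eq {M M' : Matrix (Idx × Idx) (Idx × Idx) B}
    (h : (1 - swapMat B) * M = M' * (1 - swapMat B)) (a b : Idx × Idx) :
    ((1 - swapMat B) * M) a b
      = ((1 - swapMat B) * M) (1, -1) (1, -1) * (1 - swapMat B) a b := by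
  have h1 : ∀ a b, ((1 - swapMat B) * M) a.swap b = -((1 - swapMat B) * M) a b := by
    intro a b
    simp [sub_mul, swapMat_mul]
  have h2 : ∀ a b, ((1 - swapMat B) * M) a b.swap = -((1 - swapMat B) * M) a b := by
    intro a b
    simp [h, mul_sub, mul_swapMat]
  have h3 : ∀ i b, ((1 - swapMat B) * M) (i, i) b = 0 := by
    intro i b
    simp [sub_mul, swapMat_mul]
  have h4 : ∀ i a, ((1 - swapMat B) * M) a (i, i) = 0 := by
    intro i b
    simp [h, mul_sub, mul_swapMat]
  have h5 := fun b => h1 (1, -1) b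
  have h6 := fun a => h2 a (1, -1)
  simp only [Prod.swap_prod_mk] at h5 h6
  generalize (1 - swapMat B) * M = N at *
  obtain ⟨i, k⟩ := a
  obtain ⟨j, l⟩ := b
  rcases Int.units_eq_one_or i with rfl | rfl <;> rcases Int.units_eq_one_or j with rfl | rfl <;>
    rcases Int.units_eq_one_or k with rfl | rfl <;>
    rcases Int.units_eq_one_or l with rfl | rfl <;>
    simp [swapMat, h3, h4, h5, h6]

end Site

section Sigma

variable {A : Type*} [Ring A]

/-- The shift `u ↦ u - 1` as an additive map. -/
def shiftUHom (A : Type*) [Ring A] : PowerSeries A →+ PowerSeries A where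
  toFun := shiftU
  map_zero' := shiftU_zero
  map_add' := shiftU_add

theorem shiftU_sum {ι : Type*} (s : Finset ι) (f : ι → PowerSeries A) :
    shiftU (∑ a ∈ s, f a) = ∑ a ∈ s, shiftU (f a) := map_sum (shiftUHom A) f s

variable [Algebra ℂ A]

/-- The property that `(1 - P) S₁(u) R^t(1 - 2u) S₂(u - 1)` is the multiple of `1 - P` by the
scalar series `σ`. -/
def IsSigma (ε : ℤˣ) (S : Matrix Idx Idx (PowerSeries A)) (σ : PowerSeries ℂ) : Prop :=
  (1 - swapMat (PowerSeries A)) * (fstMat S * liftSeries (rMatrixT ε 1) * sndMat (S.map shiftU))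
    = scal A σ • (1 - swapMat (PowerSeries A))

theorem IsSigma.sigmaTwo_eq {ε : ℤˣ} {S : Matrix Idx Idx (PowerSeries A)} {σ : PowerSeries ℂ}
    (h : IsSigma ε S σ) : sigmaTwo ε S = scal A σ := by
  have h2 : PowerSeries.C (algebraMap ℂ A (1 / 2)) * (1 + 1) = (1 : PowerSeries A) := by
    rw [mul_add, mul_one, ← map_add, ← map_add]
    norm_num
  rw [sigmaTwo, onFirst_eq, onSecond_eq, liftConst_antisym, Matrix.smul_mul, Matrix.smul_mul,
    Matrix.smul_mul, Matrix.trace_smul, mul_assoc, mul_assoc, ← mul_assoc (fstMat S), h,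
    Matrix.trace_smul, ← mul_one (1 - swapMat (PowerSeries A)), trace_antisym_mul, smul_eq_mul,
    smul_eq_mul]
  have e : ((1 : Matrix (Idx × Idx) (Idx × Idx) (PowerSeries A)) (1, -1) (1, -1)
      - (1 : Matrix (Idx × Idx) (Idx × Idx) (PowerSeries A)) (-1, 1) (1, -1))
      + ((1 : Matrix (Idx × Idx) (Idx × Idx) (PowerSeries A)) (-1, 1) (-1, 1)
      - (1 : Matrix (Idx × Idx) (Idx × Idx) (PowerSeries A)) (1, -1) (-1, 1)) = 1 + 1 := by
    simp
  rw [e, (commute_scal _ _).eq, ← mul_assoc, h2, one_mul]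

theorem IsSigma.map {A' : Type*} [Ring A'] [Algebra ℂ A'] {ε : ℤˣ}
    {S : Matrix Idx Idx (PowerSeries A)} {σ : PowerSeries ℂ} (h : IsSigma ε S σ)
    (φ : A →ₐ[ℂ] A') : IsSigma ε (S.map (PowerSeries.map φ.toRingHom)) σ := by
  have h1 := congrArg (fun M => M.map (PowerSeries.map φ.toRingHom)) h
  have hs : ∀ f, PowerSeries.map φ.toRingHom (scal A f) = scal A' f := by
    intro f
    refine PowerSeries.ext fun n => ?_
    simp [scal]
  have hP : (1 - swapMat (PowerSeries A)).map (PowerSeries.map φ.toRingHom)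
      = 1 - swapMat (PowerSeries A') := by
    ext1 a b
    simp only [Matrix.map_apply, Matrix.sub_apply, Matrix.one_apply, swapMat, Matrix.of_apply,
      map_sub, apply_ite (PowerSeries.map φ.toRingHom), map_one, map_zero]
  have hF : ∀ M : Matrix Idx Idx (PowerSeries A),
      (fstMat M).map (PowerSeries.map φ.toRingHom)
        = fstMat (M.map (PowerSeries.map φ.toRingHom)) := by
    intro M
    ext1 a b
    simp only [Matrix.map_apply, fstMat, Matrix.of_apply,
      apply_ite (PowerSeries.map φ.toRingHom), map_zero]
  have hG : ∀ M : Matrix Idx Idx (PowerSeries A),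
      (sndMat M).map (PowerSeries.map φ.toRingHom)
        = sndMat (M.map (PowerSeries.map φ.toRingHom)) := by
    intro M
    ext1 a b
    simp only [Matrix.map_apply, sndMat, Matrix.of_apply,
      apply_ite (PowerSeries.map φ.toRingHom), map_zero]
  have hL : (liftSeries (rMatrixT ε 1) : Matrix _ _ (PowerSeries A)).map
      (PowerSeries.map φ.toRingHom) = liftSeries (rMatrixT ε 1) := by
    ext1 a b
    exact hs _
  have hR : (scal A σ • (1 - swapMat (PowerSeries A))).map (PowerSeries.map φ.toRingHom)
      = scal A' σ • (1 - swapMat (PowerSeries A')) := by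
    rw [← hP]
    ext1 a b
    simp only [Matrix.map_apply, Matrix.smul_apply, smul_eq_mul, map_mul, hs]
  rw [hR, Matrix.map_mul, Matrix.map_mul, Matrix.map_mul, hP, hF, hG, hL] at h1
  rw [IsSigma, ← h1]
  congr 3
  ext1 i j
  exact (shiftU_map _ _).symm

theorem invAffine_one_mul : invAffine 1 * (PowerSeries.X - 2) = PowerSeries.X := by
  rw [invAffine, map_one, one_mul, mul_assoc]
  have : (PowerSeries.X - PowerSeries.C (2 : ℂ))⁻¹ * (PowerSeries.X - 2) = 1 := by
    have e : (PowerSeries.C (2 : ℂ)) = 2 := map_ofNat _ 2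
    rw [e]
    refine PowerSeries.inv_mul_cancel _ ?_
    rw [map_sub, PowerSeries.constantCoeff_X, map_ofNat]
    norm_num
  rw [this, mul_one]

/-- The series `u⁻¹`, `(u - 1)⁻¹` and `(1 - 2u)⁻¹` are related as in the RTT relation between
`T(-u)` and `T(u - 1)`. -/
theorem invAffine_one_mul_add : invAffine 1 * (shiftX ℂ + PowerSeries.X)
    = -(PowerSeries.X * shiftX ℂ) := by
  have h1 := invAffine_one_mul
  have h2 := one_sub_X_mul_shiftX (A := ℂ)
  apply one_sub_X_mul_cancel
  linear_combination (-PowerSeries.X) * h1 + (invAffine 1 + PowerSeries.X) * h2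

/-- The generating matrix of an evaluation module, as a series in `u⁻¹`. -/
theorem genMatrix_evalFamily (E : Idx → Idx → A) (i j : Idx) :
    genMatrix (evalFamily 0 E) i j
      = (if i = j then 1 else 0) + PowerSeries.X * PowerSeries.C (E i j) := by
  refine PowerSeries.ext fun n => ?_
  rw [coeff_genMatrix]
  rcases n with _ | _ | n
  · split_ifs with h <;> simp [evalFamily, h]
  · split_ifs with h <;> rw [map_add, PowerSeries.coeff_succ_X_mul] <;>
      simp [evalFamily, PowerSeries.coeff_one]
  · split_ifs with h <;> rw [map_add, PowerSeries.coeff_succ_X_mul] <;>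
      simp [evalFamily, PowerSeries.coeff_one]

attribute [local instance] seriesAlgebra

theorem series_smul_def (f : PowerSeries ℂ) (g : PowerSeries A) : f • g = scal A f * g := rfl

theorem scal_X : scal A PowerSeries.X = PowerSeries.X := by simp [scal]

theorem scal_shiftX : scal A (shiftX ℂ) = shiftX A := by
  rw [shiftX, shiftX, scal, shiftU_map, PowerSeries.map_X]

theorem genMatrix_eq_siteMat (E : Idx → Idx → A) : genMatrix (evalFamily 0 E)
    = siteMat (PowerSeries.X : PowerSeries ℂ) fun i j => PowerSeries.C (E i j) := by
  ext1 i j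
  rw [genMatrix_evalFamily, siteMat, Matrix.of_apply, series_smul_def, scal_X]

theorem genMatrix_map_negU (E : Idx → Idx → A) : (genMatrix (evalFamily 0 E)).map negU
    = siteMat (-PowerSeries.X : PowerSeries ℂ) fun i j => PowerSeries.C (E i j) := by
  ext1 i j
  rw [Matrix.map_apply, genMatrix_evalFamily, siteMat, Matrix.of_apply, series_smul_def, map_neg,
    scal_X, ← negUHom_apply, map_add, map_mul, negUHom_apply, negUHom_apply, negUHom_apply, negU_X,
    negU_C, ← negUHom_apply, apply_ite (negUHom A), map_one, map_zero]

theorem shiftU_siteMat_mul (c : ℂ) (E : Idx → Idx → A) (i j : Idx) (f : PowerSeries A) :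
    shiftU (siteMat (PowerSeries.C c * PowerSeries.X : PowerSeries ℂ)
        (fun i j => PowerSeries.C (E i j)) i j * f)
      = siteMat (PowerSeries.C c * shiftX ℂ) (fun i j => PowerSeries.C (E i j)) i j * shiftU f := by
  have hc : ∀ g : PowerSeries ℂ, scal A (PowerSeries.C c * g)
      = PowerSeries.C (algebraMap ℂ A c) * scal A g := by
    intro g
    simp [scal]
  simp only [siteMat, Matrix.of_apply, series_smul_def, add_mul, shiftU_add]
  congr 1
  · split_ifs <;> simp [shiftU_zero]
  · rw [hc, hc, scal_X, scal_shiftX, mul_assoc, mul_assoc, mul_assoc, shiftU_C_mul, mul_assoc,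
      shiftU_X_mul, shiftU_C_mul]

theorem shiftU_mul_siteMat (c : ℂ) (E : Idx → Idx → A) (i j : Idx) (f : PowerSeries A) :
    shiftU (f * siteMat (PowerSeries.C c * PowerSeries.X : PowerSeries ℂ)
        (fun i j => PowerSeries.C (E i j)) i j)
      = shiftU f * siteMat (PowerSeries.C c * shiftX ℂ) (fun i j => PowerSeries.C (E i j)) i j := by
  have hc : ∀ g : PowerSeries ℂ, scal A (PowerSeries.C c * g)
      = PowerSeries.C (algebraMap ℂ A c) * scal A g := by
    intro g
    simp [scal]
  simp only [siteMat, Matrix.of_apply, series_smul_def, mul_add, shiftU_add]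
  congr 1
  · split_ifs <;> simp [shiftU_zero]
  · rw [← mul_assoc, ← mul_assoc, ← (commute_scal _ f).eq, ← (commute_scal _ (shiftU f)).eq,
      hc, hc, scal_X, scal_shiftX, mul_assoc, mul_assoc, mul_assoc, shiftU_C_mul,
      shiftU_X_mul, shiftU_mul_C, mul_assoc]

/-- Tensoring with an evaluation module multiplies `σ₂` by the scalar `q₁ q₂`, where `q₁` and `q₂`
are the quantum determinants of `T(u)` and `T^t(-u)` on this module. -/
theorem IsSigma.site {ε : ℤˣ} {S : Matrix Idx Idx (PowerSeries A)} {σ : PowerSeries ℂ}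
    (h : IsSigma ε S σ) {E : Idx → Idx → A} (hE : IsGL2 E)
    (hES : ∀ i j k l n, Commute (E i j) (PowerSeries.coeff n (S k l)))
    {a b : ℂ} (ha : E 1 1 + E (-1) (-1) = algebraMap ℂ A a)
    (hb : E 1 1 * E (-1) (-1) - E (-1) 1 * E 1 (-1) - E 1 1 = algebraMap ℂ A b) :
    IsSigma ε (genMatrix (evalFamily 0 E) * S
        * transp ε ((genMatrix (evalFamily 0 E)).map negU))
      ((1 + PowerSeries.C a * PowerSeries.X
          + PowerSeries.C (a + b) * (PowerSeries.X * shiftX ℂ))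
        * (1 - PowerSeries.C a * PowerSeries.X
          + PowerSeries.C b * (PowerSeries.X * shiftX ℂ)) * σ) := by
  set x : PowerSeries ℂ := PowerSeries.X with hx
  set y : PowerSeries ℂ := shiftX ℂ with hy
  set F : Idx → Idx → PowerSeries A := fun i j => PowerSeries.C (E i j) with hF
  have hxy : y - x = x * y := shiftX_sub_X
  have hFgl : IsGL2 F := by
    intro i j k l
    have := congrArg (PowerSeries.C (R := A)) (hE i j k l)
    simpa only [map_sub, map_mul, apply_ite (PowerSeries.C (R := A)), map_zero] using this
  have hFS : ∀ i j k l, Commute (F i j) (S k l) := by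
    intro i j k l
    refine commute_of_coeff fun m n => ?_
    rcases m with _ | m
    · simpa [hF] using hES i j k l n
    · simp [hF]
  have hFS' : ∀ i j k l, Commute (F i j) (S.map shiftU k l) := by
    intro i j k l
    have := congrArg shiftU (hFS i j k l).eq
    rw [hF, shiftU_C_mul, shiftU_mul_C] at this
    exact this
  have hTS : ∀ (m : PowerSeries ℂ) i j k l, Commute (siteMat m F i j) (S k l) := by
    intro m i j k l
    refine Commute.add_left ?_ ((hFS i j k l).smul_left m)
    split_ifs <;> simp
  have hTS' : ∀ (m : PowerSeries ℂ) i j k l, Commute (siteMat m F i j) (S.map shiftU k l) := by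
    intro m i j k l
    refine Commute.add_left ?_ ((hFS' i j k l).smul_left m)
    split_ifs <;> simp
  have hshift : (siteMat x F * S * transp ε (siteMat (-x) F)).map shiftU
      = siteMat y F * S.map shiftU * transp ε (siteMat (-y) F) := by
    have e1 : ∀ i j (f : PowerSeries A), shiftU (siteMat x F i j * f)
        = siteMat y F i j * shiftU f := by
      intro i j f
      have := shiftU_siteMat_mul 1 E i j f
      rwa [map_one, one_mul, one_mul] at this
    have e2 : ∀ i j (f : PowerSeries A), shiftU (f * siteMat (-x) F i j)
        = shiftU f * siteMat (-y) F i j := by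
      intro i j f
      have := shiftU_mul_siteMat (-1) E i j f
      rwa [map_neg, map_one, neg_one_mul, neg_one_mul] at this
    have e3 : ∀ (n : ℤ) (f : PowerSeries A), shiftU (n • f) = n • shiftU f :=
      fun n f => map_zsmul (shiftUHom A) n f
    ext1 i j
    simp only [Matrix.map_apply, Matrix.mul_apply, shiftU_sum, transp_apply, mul_smul_comm, e3, e2,
      Finset.sum_mul, e1]
  -- exchange relations between `T(u)`, `T(u - 1)` and their transposes at the negative arguments;
  -- the scalars `±1` make `1 ∓ P` appear
  have hR : liftSeries (rMatrixT ε 1) = (1 : PowerSeries ℂ) • (1 : Matrix _ _ (PowerSeries A))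
      - invAffine 1 • swapMatT (PowerSeries A) ε := by
    rw [liftSeries_rMatrixT, one_smul]
    rfl
  have r1 := (isRTTPair_siteMat hFgl (m := x) (n := y) (ζ := 1) (by rw [one_mul, hxy])).mul_mul
  have r2 := (isRTTPair_siteMat hFgl (m := -x) (n := y) (ζ := invAffine 1) (by
    rw [sub_neg_eq_add, invAffine_one_mul_add, neg_mul])).transp_mul_mul ε
  have r3 := (isRTTPair_siteMat hFgl (m := -x) (n := -y) (ζ := -1) (by
    linear_combination hxy)).transp_mul_transp' ε
  rw [← hR] at r2
  simp only [one_smul, neg_smul, ← sub_eq_add_neg] at r1 r3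
  have hEa : F 1 1 + F (-1) (-1) = scal A (PowerSeries.C a) := by
    have := congrArg (PowerSeries.C (R := A)) ha
    simpa [scal] using this
  have hEb : F 1 1 * F (-1) (-1) - F (-1) 1 * F 1 (-1) - F 1 1 = scal A (PowerSeries.C b) := by
    have := congrArg (PowerSeries.C (R := A)) hb
    simpa [scal] using this
  have hEc : F (-1) (-1) * F 1 1 = F 1 1 * F (-1) (-1) := by
    have := hFgl (-1) (-1) 1 1
    simpa [sub_eq_zero] using this
  have q1 : (1 - swapMat (PowerSeries A)) * (fstMat (siteMat x F) * sndMat (siteMat y F))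
      = scal A (1 + PowerSeries.C a * x + PowerSeries.C (a + b) * (x * y))
        • (1 - swapMat (PowerSeries A)) := by
    ext1 p q
    rw [antisym_mul_eq r1 p q, Matrix.smul_apply, smul_eq_mul]
    congr 1
    rw [sub_mul, one_mul, Matrix.sub_apply, swapMat_mul, Prod.swap_prod_mk, fstMat_mul_sndMat,
      fstMat_mul_sndMat]
    simp only [siteMat, Matrix.of_apply, if_true, if_neg neg_one_ne_one_idx,
      if_neg neg_one_ne_one_idx.symm, zero_add]
    have e : scal A (1 + PowerSeries.C a * x + PowerSeries.C (a + b) * (x * y))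
        = 1 + x • scal A (PowerSeries.C a)
          + (x * y) • (scal A (PowerSeries.C a) + scal A (PowerSeries.C b)) := by
      simp only [series_smul_def, ← map_mul, ← map_add, ← map_one (scal A)]
      congr 1
      ring
    rw [e, ← hEa, ← hEb]
    exact qdet_aux hxy _ _ _ _
  have q2 : (1 - swapMat (PowerSeries A)) * (fstMat (transp ε (siteMat (-x) F))
        * sndMat (transp ε (siteMat (-y) F)))
      = scal A (1 - PowerSeries.C a * x + PowerSeries.C b * (x * y))
        • (1 - swapMat (PowerSeries A)) := by
    ext1 p q
    rw [antisym_mul_eq r3 p q, Matrix.smul_apply, smul_eq_mul]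
    congr 1
    rw [sub_mul, one_mul, Matrix.sub_apply, swapMat_mul, Prod.swap_prod_mk, fstMat_mul_sndMat,
      fstMat_mul_sndMat]
    simp only [transp_apply, neg_neg, siteMat, Matrix.of_apply, if_true,
      if_neg neg_one_ne_one_idx, if_neg neg_one_ne_one_idx.symm, zero_add]
    have e : scal A (1 - PowerSeries.C a * x + PowerSeries.C b * (x * y))
        = 1 - x • scal A (PowerSeries.C a) + (x * y) • scal A (PowerSeries.C b) := by
      simp only [series_smul_def, ← map_mul, ← map_add, ← map_sub, ← map_one (scal A)]
      congr 1
      ring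
    have ht : theta ε 1 1 = 1 := by simp [theta]
    have ht' : theta ε (-1) (-1) = 1 := by simp [theta]
    have ht2 : theta ε (-1) 1 * theta ε 1 (-1) = 1 := by rw [theta_mul, ht']
    rw [e, ← hEa, ← hEb, ht, ht', one_smul, one_smul, smul_mul_smul_comm, ht2, one_smul]
    exact qdet_aux' hxy _ _ hEc
  have c1 : fstMat S * sndMat (siteMat y F) = sndMat (siteMat y F) * fstMat S :=
    fstMat_mul_sndMat_comm fun i j k l => (hTS y k l i j).symm
  have c2 : fstMat (transp ε (siteMat (-x) F)) * sndMat (S.map shiftU)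
      = sndMat (S.map shiftU) * fstMat (transp ε (siteMat (-x) F)) :=
    fstMat_mul_sndMat_comm fun i j k l => by
      rw [transp_apply]
      exact (hTS' (-x) _ _ k l).smul_left _
  rw [IsSigma] at h ⊢
  rw [genMatrix_map_negU, genMatrix_eq_siteMat, hshift]
  simp only [← fstMat_mul_fstMat, ← sndMat_mul_sndMat]
  set N := 1 - swapMat (PowerSeries A)
  set Q : Matrix _ _ (PowerSeries A) := liftSeries (rMatrixT ε 1)
  have hsc : ∀ (f : PowerSeries ℂ) (M M' : Matrix (Idx × Idx) (Idx × Idx) (PowerSeries A)),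
      (scal A f • M) * M' = scal A f • (M * M') := fun f M M' => Matrix.smul_mul _ _ _
  calc N * (fstMat (siteMat x F) * fstMat S * fstMat (transp ε (siteMat (-x) F)) * Q
        * (sndMat (siteMat y F) * sndMat (S.map shiftU) * sndMat (transp ε (siteMat (-y) F))))
      = N * (fstMat (siteMat x F) * fstMat S
        * (fstMat (transp ε (siteMat (-x) F)) * Q * sndMat (siteMat y F))
        * sndMat (S.map shiftU) * sndMat (transp ε (siteMat (-y) F))) := by
        simp only [mul_assoc]
    _ = N * (fstMat (siteMat x F) * (fstMat S * sndMat (siteMat y F)) * Q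
        * (fstMat (transp ε (siteMat (-x) F)) * sndMat (S.map shiftU))
        * sndMat (transp ε (siteMat (-y) F))) := by
        rw [r2]; simp only [mul_assoc]
    _ = N * (fstMat (siteMat x F) * sndMat (siteMat y F)) * (fstMat S * Q * sndMat (S.map shiftU))
        * (fstMat (transp ε (siteMat (-x) F)) * sndMat (transp ε (siteMat (-y) F))) := by
        rw [c1, c2]; simp only [mul_assoc]
    _ = _ := by
        rw [q1, hsc, hsc, h, hsc, q2, smul_smul, smul_smul, map_mul, map_mul]
        congr 1
        rw [mul_assoc, (commute_scal σ _).eq, ← mul_assoc]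

end Sigma


/-! ### Matrices of the modules -/

/-- The set indexing the standard basis of `L(α₁, β₁) ⊗ ⋯ ⊗ L(α_k, β_k)`, `α_i - β_i = d_i`. -/
def Conf : (k : ℕ) → (Fin k → ℕ) → Type
  | 0, _ => Unit
  | k + 1, d => Fin (d 0 + 1) × Conf k fun i => d i.succ

instance instFintypeConf : (k : ℕ) → (d : Fin k → ℕ) → Fintype (Conf k d)
  | 0, _ => inferInstanceAs (Fintype Unit)
  | k + 1, d =>
    have := instFintypeConf k fun i => d i.succ
    inferInstanceAs (Fintype (Fin (d 0 + 1) × Conf k fun i => d i.succ))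

instance instDecidableEqConf : (k : ℕ) → (d : Fin k → ℕ) → DecidableEq (Conf k d)
  | 0, _ => inferInstanceAs (DecidableEq Unit)
  | k + 1, d =>
    have := instDecidableEqConf k fun i => d i.succ
    inferInstanceAs (DecidableEq (Fin (d 0 + 1) × Conf k fun i => d i.succ))

section Kronecker

variable {I J : Type*} [Fintype I] [DecidableEq I] [Fintype J] [DecidableEq J]

/-- `M ↦ M ⊗ 1`. -/
def headHom (I J : Type*) [Fintype I] [DecidableEq I] [Fintype J] [DecidableEq J] :
    Matrix I I ℂ →ₐ[ℂ] Matrix (I × J) (I × J) ℂ :=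
  AlgHom.ofLinearMap
    { toFun := fun M => Matrix.kroneckerMap (· * ·) M 1
      map_add' := fun M N => Matrix.add_kronecker M N 1
      map_smul' := fun c M => Matrix.smul_kronecker c M 1 }
    (Matrix.one_kronecker_one) (fun M N => by
      simpa using Matrix.mul_kronecker_mul M N (1 : Matrix J J ℂ) 1)

/-- `M ↦ 1 ⊗ M`. -/
def tailHom (I J : Type*) [Fintype I] [DecidableEq I] [Fintype J] [DecidableEq J] :
    Matrix J J ℂ →ₐ[ℂ] Matrix (I × J) (I × J) ℂ :=
  AlgHom.ofLinearMap
    { toFun := fun M => Matrix.kroneckerMap (· * ·) 1 M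
      map_add' := fun M N => Matrix.kronecker_add 1 M N
      map_smul' := fun c M => Matrix.kronecker_smul c 1 M }
    (Matrix.one_kronecker_one) (fun M N => by
      simpa using Matrix.mul_kronecker_mul (1 : Matrix I I ℂ) 1 M N)

theorem headHom_mul_tailHom (M : Matrix I I ℂ) (N : Matrix J J ℂ) :
    headHom I J M * tailHom I J N = Matrix.kroneckerMap (· * ·) M N := by
  have h := Matrix.mul_kronecker_mul M (1 : Matrix I I ℂ) (1 : Matrix J J ℂ) N
  rw [mul_one, one_mul] at h
  exact h.symm

theorem commute_headHom_tailHom (M : Matrix I I ℂ) (N : Matrix J J ℂ) :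
    Commute (headHom I J M) (tailHom I J N) := by
  have h := Matrix.mul_kronecker_mul (1 : Matrix I I ℂ) M N (1 : Matrix J J ℂ)
  rw [mul_one, one_mul] at h
  exact (headHom_mul_tailHom M N).trans h

end Kronecker

/-- The matrix `T(u)` on `L(α₁, β₁) ⊗ ⋯ ⊗ L(α_k, β_k)` in the standard basis. -/
def stringT : (k : ℕ) → (Fin k → ℂ) → (d : Fin k → ℕ) →
    Matrix Idx Idx (PowerSeries (Matrix (Conf k d) (Conf k d) ℂ))
  | 0, _, _ => 1
  | k + 1, α, d =>
    (genMatrix (evalFamily 0 (irrepMatrix (α 0) (d 0)))).map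
        (PowerSeries.map (headHom (Fin (d 0 + 1)) (Conf k fun i => d i.succ)).toRingHom)
      * (stringT k (fun i => α i.succ) (fun i => d i.succ)).map
        (PowerSeries.map (tailHom (Fin (d 0 + 1)) (Conf k fun i => d i.succ)).toRingHom)

theorem toMatrix_act_evalModule (α : ℂ) (d r : ℕ) (i j : Idx) :
    LinearMap.toMatrix (Pi.basisFun ℂ (Fin (d + 1))) (Pi.basisFun ℂ (Fin (d + 1)))
        ((evalModule α d).act (Yangian.t r i j))
      = evalFamily 0 (irrepMatrix α d) r i j := by
  have h : (evalModule α d).act (Yangian.t r i j) = evalFamily 0 (irrepE α d) r i j :=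
    Yangian.lift_t _ (isRTT_evalFamily 0 (isGL2_irrepE α d)) _ _ _
  rw [h]
  rcases r with _ | r
  · simp only [evalFamily]
    split_ifs
    · exact LinearMap.toMatrix_one _
    · exact map_zero _
  · simp only [evalFamily, map_smul, irrepE]
    congr 1
    exact LinearMap.toMatrix'_toLin' _

theorem tensor_act_t (M N : YangianModule) (r : ℕ) (i j : Idx) :
    (M.tensor N).act (Yangian.t r i j)
      = ∑ p ∈ Finset.HasAntidiagonal.antidiagonal r, ∑ a : Idx,
        TensorProduct.map (M.act (Yangian.t p.1 i a)) (N.act (Yangian.t p.2 a j)) := by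
  simp only [AlgHom.comp_apply]
  rw [Yangian.comul, Yangian.lift_t, comulFamily, mulFamily, map_sum, map_sum]
  refine Finset.sum_congr rfl fun p _ => ?_
  rw [map_sum, map_sum]
  refine Finset.sum_congr rfl fun a _ => ?_
  rw [Algebra.TensorProduct.tmul_mul_tmul, one_mul, mul_one, Algebra.TensorProduct.map_tmul,
    Module.endTensorEndAlgHom_apply]
  rfl

theorem toMatrix_tensor_act_t {I J : Type*} [Fintype I] [DecidableEq I] [Fintype J]
    [DecidableEq J] (M N : YangianModule) (b : Module.Basis I ℂ M.carrier)
    (c : Module.Basis J ℂ N.carrier) (r : ℕ) (i j : Idx) :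
    LinearMap.toMatrix (b.tensorProduct c) (b.tensorProduct c)
        ((M.tensor N).act (Yangian.t r i j))
      = ∑ p ∈ Finset.HasAntidiagonal.antidiagonal r, ∑ a : Idx,
        headHom I J (LinearMap.toMatrix b b (M.act (Yangian.t p.1 i a)))
          * tailHom I J (LinearMap.toMatrix c c (N.act (Yangian.t p.2 a j))) := by
  rw [tensor_act_t, map_sum]
  refine Finset.sum_congr rfl fun p _ => ?_
  rw [map_sum]
  refine Finset.sum_congr rfl fun a _ => ?_
  rw [TensorProduct.toMatrix_map, headHom_mul_tailHom]

theorem coeff_head_mul_tail {I J : Type*} [Fintype I] [DecidableEq I] [Fintype J]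
    [DecidableEq J] (M : Matrix Idx Idx (PowerSeries (Matrix I I ℂ)))
    (N : Matrix Idx Idx (PowerSeries (Matrix J J ℂ))) (r : ℕ) (i j : Idx) :
    PowerSeries.coeff r ((M.map (PowerSeries.map (headHom I J).toRingHom)
        * N.map (PowerSeries.map (tailHom I J).toRingHom)) i j)
      = ∑ p ∈ Finset.HasAntidiagonal.antidiagonal r, ∑ a : Idx,
        headHom I J (PowerSeries.coeff p.1 (M i a))
          * tailHom I J (PowerSeries.coeff p.2 (N a j)) := by
  rw [Matrix.mul_apply, map_sum, Finset.sum_comm]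
  refine Finset.sum_congr rfl fun a _ => ?_
  rw [PowerSeries.coeff_mul]
  rfl

/-- The matrices of the generators `t_{ij}^{(r)}` in the standard basis. -/
theorem exists_basis_stringModule : ∀ (k : ℕ) (α : Fin k → ℂ) (d : Fin k → ℕ),
    ∃ b : Module.Basis (Conf k d) ℂ (stringModule α d).carrier, ∀ r i j,
      LinearMap.toMatrix b b ((stringModule α d).act (Yangian.t r i j))
        = PowerSeries.coeff r (stringT k α d i j)
  | 0, α, d => by
    refine ⟨Module.Basis.singleton Unit ℂ, fun r i j => ?_⟩
    have hz : IsGL2 (fun _ _ => (0 : Module.End ℂ ℂ)) := by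
      intro i j k l
      rw [ite_self, ite_self, mul_zero]
    have h : (stringModule α d).act (Yangian.t r i j)
        = evalFamily 0 (fun _ _ => (0 : Module.End ℂ ℂ)) r i j :=
      Yangian.lift_t _ (isRTT_evalFamily 0 hz) _ _ _
    rw [h]
    rcases r with _ | r
    · simp only [evalFamily, stringT, Matrix.one_apply]
      split_ifs
      · rw [PowerSeries.coeff_zero_one]
        exact LinearMap.toMatrix_one _
      · exact map_zero _
    · simp only [evalFamily, stringT, Matrix.one_apply, smul_zero]
      split_ifs
      · rw [PowerSeries.coeff_one, if_neg (Nat.succ_ne_zero r)]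
        exact map_zero _
      · exact map_zero _
  | k + 1, α, d => by
    obtain ⟨b, hb⟩ := exists_basis_stringModule k (fun i => α i.succ) (fun i => d i.succ)
    refine ⟨(Pi.basisFun ℂ (Fin (d 0 + 1))).tensorProduct b, fun r i j => ?_⟩
    refine (toMatrix_tensor_act_t (evalModule (α 0) (d 0))
      (stringModule (fun i => α i.succ) (fun i => d i.succ)) _ b r i j).trans ?_
    refine Eq.trans ?_ (coeff_head_mul_tail _ _ r i j).symm
    refine Finset.sum_congr rfl fun p _ => Finset.sum_congr rfl fun a _ => ?_
    rw [toMatrix_act_evalModule, hb, coeff_genMatrix]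

/-- The matrix `T(u) K(u) T^t(-u)` with `T(u)` as in `stringT` and `K(u)` with scalar entries. -/
def stringS (ε : ℤˣ) (k : ℕ) (α : Fin k → ℂ) (d : Fin k → ℕ)
    (K : Matrix Idx Idx (PowerSeries ℂ)) :
    Matrix Idx Idx (PowerSeries (Matrix (Conf k d) (Conf k d) ℂ)) :=
  stringT k α d * liftSeries K * transp ε ((stringT k α d).map negU)

/-- The matrix `S(u)` of the module `W(δ)`. -/
def kMatrix (δ : ℂ) : Matrix Idx Idx (PowerSeries ℂ) := Matrix.of (charSeries δ)

theorem kMatrix_half : kMatrix (1 / 2) = 1 := by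
  ext1 i j
  by_cases h : i = j
  · subst h
    simp [kMatrix, charSeries]
  · simp [kMatrix, charSeries, h]

theorem map_liftSeries_series {A B : Type*} [Ring A] [Algebra ℂ A] [Ring B] [Algebra ℂ B]
    (φ : A →ₐ[ℂ] B) (K : Matrix Idx Idx (PowerSeries ℂ)) :
    (liftSeries K : Matrix _ _ (PowerSeries A)).map (PowerSeries.map φ.toRingHom)
      = liftSeries K := by
  ext i j n
  simp [liftSeries]

/-- The basis `b` of `N` identifies the action of `S(u)` with the matrix `stringS`. -/
def Realizes {ε : ℤˣ} (N : TwistedModule ε) {k : ℕ} (α : Fin k → ℂ) (d : Fin k → ℕ) (δ : ℂ)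
    (b : Module.Basis (Conf k d) ℂ N.carrier) : Prop :=
  ∀ M i j, LinearMap.toMatrixAlgEquiv b (N.act (sGen ε M i j))
    = PowerSeries.coeff M (stringS ε k α d (kMatrix δ) i j)

theorem genMatrix_map {A B : Type*} [Ring A] [Ring B] (φ : A →+* B) (t : ℕ → Idx → Idx → A) :
    (genMatrix t).map (PowerSeries.map φ) = genMatrix fun r i j => φ (t r i j) := by
  ext i j n
  simp [genMatrix]

theorem exists_realizes_restrict (ε : ℤˣ) (k : ℕ) (α : Fin k → ℂ) (d : Fin k → ℕ) :
    ∃ b, Realizes ((stringModule α d).restrict ε) α d (1 / 2) b := by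
  obtain ⟨b, hb⟩ := exists_basis_stringModule k α d
  refine ⟨b, fun M i j => ?_⟩
  set φ : Yangian →ₐ[ℂ] Matrix (Conf k d) (Conf k d) ℂ :=
    (LinearMap.toMatrixAlgEquiv b).toAlgHom.comp (stringModule α d).act
  have h1 : (genMatrix Yangian.t).map (PowerSeries.map φ.toRingHom) = stringT k α d := by
    rw [genMatrix_map]
    ext1 i j
    refine PowerSeries.ext fun n => ?_
    rw [coeff_genMatrix]
    exact hb n i j
  have h2 : liftSeries (1 : Matrix Idx Idx (PowerSeries ℂ))
      = (1 : Matrix Idx Idx (PowerSeries (Matrix (Conf k d) (Conf k d) ℂ))) :=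
    Matrix.map_one _ (map_zero _) (map_one _)
  rw [kMatrix_half, stringS, h2, mul_one, ← h1, ← sMatrix, ← sMatrix_map, Matrix.map_apply,
    PowerSeries.coeff_map]
  rfl

/-- The coaction on the generating matrix: `S(u) ↦ T(u) S(u) T^t(-u)`, with the entries of `T` in
the first tensor factor and those of `S` in the second one. -/
theorem coaction_sGen (ε : ℤˣ) (M : ℕ) (i j : Idx) : coaction ε (sGen ε M i j)
    = PowerSeries.coeff M (((genMatrix fun r i j => Yangian.t r i j ⊗ₜ[ℂ] (1 : TwistedYangian ε))
      * (genMatrix fun r i j => (1 : Yangian) ⊗ₜ[ℂ] sGen ε r i j)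
      * transp ε ((genMatrix fun r i j =>
        Yangian.t r i j ⊗ₜ[ℂ] (1 : TwistedYangian ε)).map negU)) i j) := by
  apply coidealIncl_injective
  rw [coidealIncl_coaction]
  set ι₁ : Yangian →+* Yangian ⊗[ℂ] Yangian :=
    (Algebra.TensorProduct.includeLeft : Yangian →ₐ[ℂ] Yangian ⊗[ℂ] Yangian).toRingHom with hι₁
  set ι₂ : Yangian →+* Yangian ⊗[ℂ] Yangian :=
    (Algebra.TensorProduct.includeRight : Yangian →ₐ[ℂ] Yangian ⊗[ℂ] Yangian).toRingHom with hι₂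
  set T := genMatrix Yangian.t
  set T' := T.map (PowerSeries.map ι₁)
  set T'' := T.map (PowerSeries.map ι₂)
  have hcomm : ∀ a b, Commute (ι₁ a) (ι₂ b) := by
    intro a b
    simp [hι₁, hι₂, Commute, SemiconjBy]
  have hT : T.map (PowerSeries.map Yangian.comul.toRingHom) = T' * T'' := by
    have e1 : T.map (PowerSeries.map Yangian.comul.toRingHom) = genMatrix comulFamily := by
      ext i j n
      simp [T, genMatrix, Yangian.comul, Yangian.lift_t]
    rw [e1, comulFamily, genMatrix_mulFamily]
    simp only [T', T'', T, genMatrix_map]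
    rfl
  have hS : (sMatrix ε T).map (PowerSeries.map Yangian.comul.toRingHom)
      = T' * (sMatrix ε T).map (PowerSeries.map ι₂) * transp ε (T'.map negU) := by
    rw [sMatrix_map, hT, sMatrix_mul, sMatrix_map]
    intro i j k l
    refine commute_of_coeff fun m n => ?_
    simp only [T', T'', Matrix.map_apply, ← negU_map, PowerSeries.coeff_map]
    exact hcomm _ _
  have e : Yangian.comul (sElement ε M i j)
      = PowerSeries.coeff M
          ((T' * (sMatrix ε T).map (PowerSeries.map ι₂) * transp ε (T'.map negU)) i j) := by
    rw [← hS, Matrix.map_apply, PowerSeries.coeff_map]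
    rfl
  refine e.trans ?_
  set κ : Yangian ⊗[ℂ] TwistedYangian ε →+* Yangian ⊗[ℂ] Yangian := (coidealIncl ε).toRingHom
  have k1 : (genMatrix fun r i j => Yangian.t r i j ⊗ₜ[ℂ] (1 : TwistedYangian ε)).map
      (PowerSeries.map κ) = T' := by
    simp only [T', T, genMatrix_map]
    congr 1
  have k2 : (genMatrix fun r i j => (1 : Yangian) ⊗ₜ[ℂ] sGen ε r i j).map
      (PowerSeries.map κ) = (sMatrix ε T).map (PowerSeries.map ι₂) := by
    rw [genMatrix_map]
    ext1 i j
    refine PowerSeries.ext fun n => ?_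
    rw [coeff_genMatrix, Matrix.map_apply, PowerSeries.coeff_map]
    simp [κ, coidealIncl, hι₂, sGen, sElement, T]
  have k3 : ((genMatrix fun r i j => Yangian.t r i j ⊗ₜ[ℂ] (1 : TwistedYangian ε)).map negU).map
      (PowerSeries.map κ) = T'.map negU := by
    rw [← k1]
    ext1 i j
    exact negU_map κ _
  rw [← k1, ← k2, k1, ← k3, ← map_transp, ← k1, ← Matrix.map_mul, ← Matrix.map_mul,
    Matrix.map_apply, PowerSeries.coeff_map]
  rfl

theorem exists_realizes_stringModuleW (k : ℕ) (α : Fin k → ℂ) (d : Fin k → ℕ) (δ : ℂ) :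
    ∃ b, Realizes (stringModuleW α d δ) α d δ b := by
  obtain ⟨b, hb⟩ := exists_basis_stringModule k α d
  set b' : Module.Basis (Conf k d) ℂ ((stringModule α d).carrier ⊗[ℂ] ℂ) :=
    b.map (TensorProduct.rid ℂ (stringModule α d).carrier).symm with hb'
  refine ⟨b', fun M i j => ?_⟩
  set φ : Yangian ⊗[ℂ] TwistedYangian 1 →ₐ[ℂ] Matrix (Conf k d) (Conf k d) ℂ :=
    ((LinearMap.toMatrixAlgEquiv b').toAlgHom.comp (Module.endTensorEndAlgHom (R := ℂ) (S := ℂ)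
      (A := ℂ) (M := (stringModule α d).carrier) (N := ℂ))).comp
      (Algebra.TensorProduct.map (stringModule α d).act (moduleW δ).act) with hφ
  have hφt : ∀ y s, φ (y ⊗ₜ s) = charW δ s • LinearMap.toMatrix b b ((stringModule α d).act y) := by
    intro y s
    ext p q
    simp only [hφ, AlgHom.comp_apply, Algebra.TensorProduct.map_tmul,
      Module.endTensorEndAlgHom_apply]
    change (LinearMap.toMatrix b' b' _) p q = _
    rw [LinearMap.toMatrix_apply, Matrix.smul_apply, LinearMap.toMatrix_apply, hb',
      Module.Basis.map_apply, TensorProduct.rid_symm_apply, Module.Basis.map_repr]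
    simp [Algebra.ofId_apply]
  have h1 : (genMatrix fun r i j => Yangian.t r i j ⊗ₜ[ℂ] (1 : TwistedYangian 1)).map
      (PowerSeries.map φ.toRingHom) = stringT k α d := by
    rw [genMatrix_map]
    ext1 i j
    refine PowerSeries.ext fun n => ?_
    rw [coeff_genMatrix, ← hb]
    exact (hφt _ _).trans (by rw [map_one, one_smul])
  have h2 : (genMatrix fun r i j => (1 : Yangian) ⊗ₜ[ℂ] sGen 1 r i j).map
      (PowerSeries.map φ.toRingHom) = liftSeries (kMatrix δ) := by
    rw [genMatrix_map]
    ext1 i j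
    refine PowerSeries.ext fun n => ?_
    rw [coeff_genMatrix]
    refine (hφt _ _).trans ?_
    rw [map_one, charW_sGen]
    simp only [liftSeries, Matrix.map_apply, PowerSeries.coeff_map, kMatrix, Matrix.of_apply,
      Algebra.algebraMap_eq_smul_one]
    congr 1
    exact LinearMap.toMatrix_one _
  have h3 : ((genMatrix fun r i j => Yangian.t r i j ⊗ₜ[ℂ] (1 : TwistedYangian 1)).map negU).map
      (PowerSeries.map φ.toRingHom) = (stringT k α d).map negU := by
    rw [← h1]
    ext1 i j
    exact negU_map φ.toRingHom _
  rw [stringS, ← h3, ← map_transp, ← h2, ← h1, ← Matrix.map_mul, ← Matrix.map_mul,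
    Matrix.map_apply, PowerSeries.coeff_map]
  change φ (coaction 1 (sGen 1 M i j)) = _
  rw [coaction_sGen]
  rfl


/-! ### Operators with separable characteristic polynomial -/

section Separable

open scoped Topology in
/-- The resultant of the characteristic polynomial and its derivative is a polynomial in the
entries of the matrix, so its non-vanishing is an open condition. -/
theorem eventually_charpoly_separable {I : Type*} [Fintype I] [DecidableEq I] {h : I → ℂ}
    (hh : Function.Injective h) :
    ∀ᶠ M in 𝓝 (Matrix.diagonal h), M.charpoly.Separable := by
  set n := Fintype.card I
  set U := Matrix.charpoly.univ ℂ I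
  have hdeg : ∀ M : Matrix I I ℂ, M.charpoly.natDegree = n := fun M =>
    Matrix.charpoly_natDegree_eq_dim M
  have hsep : ∀ M : Matrix I I ℂ, M.charpoly.Separable ↔
      MvPolynomial.eval (fun p : I × I => M p.1 p.2)
        (Polynomial.resultant U (Polynomial.derivative U) n (n - 1)) ≠ 0 := by
    intro M
    have hU : U.map (MvPolynomial.eval fun p : I × I => M p.1 p.2) = M.charpoly :=
      Matrix.charpoly.univ_map_eval₂Hom I (RingHom.id ℂ) fun p => M p.1 p.2
    have hd : (Polynomial.derivative M.charpoly).natDegree = n - 1 := by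
      rw [Polynomial.natDegree_derivative, hdeg]
    rw [← Polynomial.resultant_map_map, ← Polynomial.derivative_map, hU, ← isUnit_iff_ne_zero]
    conv_rhs => rw [← hd, ← hdeg M]
    exact (Polynomial.isUnit_resultant_iff_isCoprime M.charpoly_monic).symm
  have hd : (Matrix.diagonal h).charpoly.Separable := by
    rw [Matrix.charpoly_diagonal]
    exact Polynomial.separable_prod_X_sub_C_iff.mpr hh
  have hc : Continuous fun M : Matrix I I ℂ =>
      MvPolynomial.eval (fun p : I × I => M p.1 p.2)
        (Polynomial.resultant U (Polynomial.derivative U) n (n - 1)) :=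
    (MvPolynomial.continuous_eval _).comp
      (continuous_pi fun p => continuous_id.matrix_elem p.1 p.2)
  filter_upwards [hc.continuousAt.eventually_ne ((hsep _).mp hd)] with M hM
  exact (hsep M).mpr hM

/-- A separable characteristic polynomial has as many distinct roots as the dimension. -/
theorem exists_eigenbasis {V : Type*} [AddCommGroup V] [Module ℂ V] [FiniteDimensional ℂ V]
    {f : Module.End ℂ V} (hf : f.charpoly.Separable) :
    ∃ (N : ℕ) (b : Module.Basis (Fin N) ℂ V) (μ : Fin N → ℂ), Function.Injective μ ∧
      ∀ n, f (b n) = μ n • b n := by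
  have hroot : ∀ r : f.charpoly.roots.toFinset, ∃ v, f.HasEigenvector r v := by
    rintro ⟨r, hr⟩
    rw [Multiset.mem_toFinset, Polynomial.mem_roots f.charpoly_monic.ne_zero] at hr
    exact (Module.End.hasEigenvalue_iff_isRoot_charpoly f r).mpr hr |>.exists_hasEigenvector
  choose v hv using hroot
  have hli := Module.End.eigenvectors_linearIndependent' f
    (fun r : f.charpoly.roots.toFinset => (r : ℂ)) Subtype.val_injective v hv
  have hcard : Fintype.card f.charpoly.roots.toFinset = Module.finrank ℂ V := by
    rw [Fintype.card_coe, Multiset.toFinset_card_of_nodup (Polynomial.nodup_roots hf),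
      ← f.charpoly_natDegree, (IsAlgClosed.splits _).natDegree_eq_card_roots]
  have e := Fintype.equivFin f.charpoly.roots.toFinset
  obtain ⟨b, hb⟩ : ∃ b : Module.Basis f.charpoly.roots.toFinset ℂ V, ∀ r, b r = v r := by
    by_cases hne : Nonempty f.charpoly.roots.toFinset
    · exact ⟨basisOfLinearIndependentOfCardEqFinrank hli hcard, fun r => by simp⟩
    · rw [not_nonempty_iff] at hne
      rw [Fintype.card_of_isEmpty] at hcard
      have := Module.finrank_zero_iff.mp hcard.symm
      exact ⟨Module.Basis.empty V, fun r => isEmptyElim r⟩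
  refine ⟨_, b.reindex e, fun n => e.symm n, Subtype.val_injective.comp e.symm.injective,
    fun n => ?_⟩
  rw [Module.Basis.reindex_apply, hb]
  exact (hv _).apply_eq_smul

variable {ε : ℤˣ} {B : Subalgebra ℂ (TwistedYangian ε)} {M : TwistedModule ε}

/-- The eigenspaces of `y` are one-dimensional, hence preserved by everything commuting with `y`. -/
theorem hasSimpleSpectrum_of_charpoly [FiniteDimensional ℂ M.carrier] {y : TwistedYangian ε}
    (hy : y ∈ B) (hsep : (M.act y).charpoly.Separable)
    (hcomm : ∀ x ∈ B, Commute (M.act x) (M.act y)) : HasSimpleSpectrum B M := by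
  obtain ⟨N, b, μ, hμ, hb⟩ := exists_eigenbasis hsep
  have key : ∀ n, ∀ x ∈ B, M.act x (b n) = b.repr (M.act x (b n)) n • b n := by
    intro n x hx
    have h1 : M.act y (M.act x (b n)) = μ n • M.act x (b n) := by
      rw [← Module.End.mul_apply, ← (hcomm x hx).eq, Module.End.mul_apply, hb, map_smul]
    have h2 : ∀ w m, b.repr (M.act y w) m = μ m * b.repr w m := by
      intro w m
      conv_lhs => rw [← b.sum_repr w]
      simp only [map_sum, map_smul, hb, Module.Basis.repr_self, Finsupp.coe_finsetSum,
        Finset.sum_apply, Finsupp.smul_apply, Finsupp.single_apply, smul_eq_mul, mul_ite, mul_one,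
        mul_zero, Finset.sum_ite_eq', Finset.mem_univ, if_true]
      exact mul_comm _ _
    refine b.repr.injective (Finsupp.ext fun m => ?_)
    have h3 := congrArg (fun w => b.repr w m) h1
    simp only [h2, map_smul, Finsupp.smul_apply, smul_eq_mul] at h3
    rw [map_smul, Finsupp.smul_apply, Module.Basis.repr_self, Finsupp.single_apply]
    split_ifs with h
    · rw [h, smul_eq_mul, mul_one]
    · rw [smul_zero]
      by_contra h4
      exact h (hμ (mul_right_cancel₀ h4 h3)).symm
  refine ⟨N, b, fun n x => b.repr (M.act x (b n)) n, key, fun m n hmn => ⟨y, hy, ?_⟩⟩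
  simpa [hb] using hμ.ne hmn

/-- Two modules with simple spectrum on which some element acts by different scalars have a direct
sum with simple spectrum. -/
theorem HasSimpleSpectrum.directSum {M' : TwistedModule ε} (h : HasSimpleSpectrum B M)
    (h' : HasSimpleSpectrum B M') {x : TwistedYangian ε} (hx : x ∈ B) {c c' : ℂ}
    (hc : M.act x = algebraMap ℂ _ c) (hc' : M'.act x = algebraMap ℂ _ c') (hne : c ≠ c') :
    HasSimpleSpectrum B (M.directSum M') := by
  obtain ⟨N, b, χ, h1, h2⟩ := h
  obtain ⟨N', b', χ', h1', h2'⟩ := h'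
  have e1 : ∀ n, χ n x = c := by
    intro n
    have := h1 n x hx
    rw [hc, Module.algebraMap_end_apply] at this
    exact (smul_left_injective ℂ (b.ne_zero n) this).symm
  have e2 : ∀ n, χ' n x = c' := by
    intro n
    have := h1' n x hx
    rw [hc', Module.algebraMap_end_apply] at this
    exact (smul_left_injective ℂ (b'.ne_zero n) this).symm
  have hact : ∀ (z : TwistedYangian ε) (p : M.carrier × M'.carrier),
      (M.directSum M').act z p = (M.act z p.1, M'.act z p.2) := fun _ _ => rfl
  refine ⟨N + N', (b.prod b').reindex finSumFinEquiv,
    fun n => Sum.elim χ χ' (finSumFinEquiv.symm n), fun n y hy => ?_, fun m n hmn => ?_⟩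
  · rw [Module.Basis.reindex_apply, hact]
    dsimp only
    rcases finSumFinEquiv.symm n with m | m
    · simp [h1 m y hy]
    · simp [h1' m y hy]
  · have hmn' := finSumFinEquiv.symm.injective.ne hmn
    dsimp only
    revert hmn'
    rcases finSumFinEquiv.symm m with m' | m' <;>
      rcases finSumFinEquiv.symm n with n' | n'
    · exact fun hmn' => h2 m' n' fun e => hmn' (by rw [e])
    · exact fun _ => ⟨x, hx, by simpa [e1, e2] using hne⟩
    · exact fun _ => ⟨x, hx, by simpa [e1, e2] using hne.symm⟩
    · exact fun hmn' => h2' m' n' fun e => hmn' (by rw [e])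

end Separable


/-! ### The action of `σ₂` -/

theorem scal_self (f : PowerSeries ℂ) : scal ℂ f = f := by
  refine PowerSeries.ext fun n => ?_
  simp [scal]

/-- For `C(u) = diag(f, g)` the entries of `(1 - P) C₁(u) R^t(1 - 2u) C₂(u - 1)` in the rows
`(1, -1)` and `(-1, 1)` are given by two series, which have to agree. -/
theorem isSigma_of_diagonal (ε : ℤˣ) {K : Matrix Idx Idx (PowerSeries ℂ)} {σ : PowerSeries ℂ}
    (h0 : K 1 (-1) = 0) (h1 : K (-1) 1 = 0)
    (hp : (K 1 1 - invAffine 1 * (K 1 1 - (ε : ℤ) • K (-1) (-1))) * shiftU (K (-1) (-1)) = σ)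
    (hm : (K (-1) (-1) - invAffine 1 * (K (-1) (-1) - (ε : ℤ) • K 1 1)) * shiftU (K 1 1) = σ) :
    IsSigma ε K σ := by
  have t1 : theta ε 1 (-1) = (ε : ℤ) := by
    rcases Int.units_eq_one_or ε with rfl | rfl <;> simp [theta]
  have t2 : theta ε (-1) 1 = (ε : ℤ) := by
    rcases Int.units_eq_one_or ε with rfl | rfl <;> simp [theta]
  have t3 : theta ε 1 1 = 1 := by simp [theta]
  have t4 : theta ε (-1) (-1) = 1 := by simp [theta]
  have n1 : (1 : Idx) ≠ -1 := by decide
  rw [zsmul_eq_mul] at hp hm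
  rw [IsSigma, liftSeries_rMatrixT, scal_self, scal_self]
  ext1 ⟨i, k⟩ ⟨j, l⟩
  rw [sub_mul, one_mul, Matrix.sub_apply, swapMat_mul, Prod.swap_prod_mk]
  simp only [mul_sndMat, fstMat_mul, sum_idx, Matrix.sub_apply, Matrix.smul_apply,
    Matrix.one_apply, swapMatT, swapMat, Matrix.of_apply, Prod.mk.injEq]
  rcases Int.units_eq_one_or i with rfl | rfl <;> rcases Int.units_eq_one_or j with rfl | rfl <;>
    rcases Int.units_eq_one_or k with rfl | rfl <;>
    rcases Int.units_eq_one_or l with rfl | rfl <;>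
    simp [t1, t2, t3, t4, n1, h0, h1, shiftU_zero] <;>
    first
      | linear_combination hp
      | linear_combination hm
      | linear_combination -hp
      | linear_combination -hm

/-- The scalar by which `σ₂(u)` acts on the trivial representation of `Y^-(2)`. -/
theorem isSigma_one_neg : IsSigma (-1) (1 : Matrix Idx Idx (PowerSeries ℂ))
    (1 - 2 * invAffine 1) := by
  refine isSigma_of_diagonal (-1) (by simp) (by simp) ?_ ?_ <;>
  · simp [shiftU_one]
    ring

/-- `σ₂(u)` acts on `W(δ)` by a scalar series. -/
theorem isSigma_kMatrix (δ : ℂ) : ∃ σ, IsSigma 1 (kMatrix δ) σ := by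
  have n1 : (1 : Idx) ≠ -1 := by decide
  refine ⟨_, isSigma_of_diagonal 1 (by simp [kMatrix, charSeries, n1])
    (by simp [kMatrix, charSeries, n1.symm]) rfl ?_⟩
  set p := kMatrix δ 1 1 with hp
  set m := kMatrix δ (-1) (-1) with hm
  have e1 : (1 + PowerSeries.C (1 / 2 : ℂ) * PowerSeries.X) * p
      = 1 + PowerSeries.C δ * PowerSeries.X := by
    have := charW_aux (δ - 1 / 2)
    rw [sub_add_cancel] at this
    rw [← this, hp]
    simp [kMatrix, charSeries]
  have e2 : (1 + PowerSeries.C (1 / 2 : ℂ) * PowerSeries.X) * m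
      = 1 + PowerSeries.C (1 - δ) * PowerSeries.X := by
    have := charW_aux (1 / 2 - δ)
    rw [show (1 / 2 - δ + 1 / 2 : ℂ) = 1 - δ by ring] at this
    rw [← this, hm]
    simp [kMatrix, charSeries]
  have hs : ∀ {f : PowerSeries ℂ} {c : ℂ},
      (1 + PowerSeries.C (1 / 2 : ℂ) * PowerSeries.X) * f = 1 + PowerSeries.C c * PowerSeries.X →
      (1 - PowerSeries.C (1 / 2 : ℂ) * PowerSeries.X) * shiftU f
        = 1 + PowerSeries.C (c - 1) * PowerSeries.X := by
    intro f c h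
    have h' := congrArg shiftU h
    rw [add_mul, shiftU_add, mul_assoc, shiftU_C_mul, shiftU_X_mul, shiftU_add, shiftU_C_mul,
      shiftU_one, one_mul] at h'
    have hx := one_sub_X_mul_shiftX (A := ℂ)
    have hX : shiftU PowerSeries.X = shiftX ℂ := rfl
    rw [hX] at h'
    have hC : (PowerSeries.C (1 / 2 : ℂ)) + PowerSeries.C (1 / 2 : ℂ) = 1 := by
      rw [← map_add, ← map_one (PowerSeries.C (R := ℂ))]; norm_num
    rw [map_sub, map_one]
    linear_combination (1 - PowerSeries.X) * h'
      + (PowerSeries.C c - PowerSeries.C (1 / 2 : ℂ) * shiftU f) * hx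
      - PowerSeries.X * shiftU f * hC
  have e3 := hs e1
  have e4 := hs e2
  have e5 := invAffine_one_mul
  set x : PowerSeries ℂ := PowerSeries.X
  have hne : ∀ c : ℂ, (1 + PowerSeries.C c * x) ≠ 0 := by
    intro c h
    have := congrArg (PowerSeries.coeff 0) h
    simp [x] at this
  have hne2 : x - 2 ≠ 0 := by
    intro h
    have := congrArg PowerSeries.constantCoeff h
    rw [map_sub, PowerSeries.constantCoeff_X, map_ofNat, map_zero] at this
    norm_num at this
  have hne3 : (1 - PowerSeries.C (1 / 2 : ℂ) * x) ≠ 0 := by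
    have := hne (-(1 / 2))
    rwa [map_neg, neg_mul, ← sub_eq_add_neg] at this
  have hD : PowerSeries.C (1 - δ) = 1 - PowerSeries.C δ := by rw [map_sub, map_one]
  have hD2 : PowerSeries.C (1 - δ - 1) = - PowerSeries.C δ := by rw [← map_neg]; congr 1; ring
  have hD3 : PowerSeries.C (δ - 1) = PowerSeries.C δ - 1 := by rw [map_sub, map_one]
  rw [hD] at e2
  rw [hD2] at e4
  rw [hD3] at e3
  generalize shiftU p = p' at *
  generalize shiftU m = m' at *
  generalize invAffine 1 = ρ at *
  refine mul_left_cancel₀ (mul_ne_zero (mul_ne_zero (hne (1 / 2)) hne3) hne2) ?_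
  simp only [Units.val_one, one_smul]
  set h := PowerSeries.C (1 / 2 : ℂ) * x
  set D := PowerSeries.C δ
  have a1 : (1 + h) * (1 - h) * (x - 2) * ((m - ρ * (m - p)) * p')
      = ((1 + h) * m * (x - 2) - (ρ * (x - 2)) * ((1 + h) * m - (1 + h) * p)) * ((1 - h) * p') := by
    ring
  have a2 : (1 + h) * (1 - h) * (x - 2) * ((p - ρ * (p - m)) * m')
      = ((1 + h) * p * (x - 2) - (ρ * (x - 2)) * ((1 + h) * p - (1 + h) * m)) * ((1 - h) * m') := by
    ring
  rw [a1, a2, e1, e2, e3, e4, e5]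
  ring

theorem isGL2_irrepMatrix (α : ℂ) (d : ℕ) : IsGL2 (irrepMatrix α d) := by
  intro i j k l
  apply Matrix.toLin'.injective
  simp only [map_sub, Matrix.toLin'_mul, apply_ite Matrix.toLin', map_zero]
  exact isGL2_irrepE α d i j k l

theorem IsGL2.map {A B : Type*} [Ring A] [Ring B] {E : Idx → Idx → A} (h : IsGL2 E)
    (φ : A →+* B) : IsGL2 fun i j => φ (E i j) := by
  intro i j k l
  have := congrArg φ (h i j k l)
  simpa only [map_sub, map_mul, apply_ite φ, map_zero] using this

theorem irrepMatrix_trace (α : ℂ) (d : ℕ) :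
    irrepMatrix α d 1 1 + irrepMatrix α d (-1) (-1) = algebraMap ℂ _ (2 * α - d) := by
  rw [irrepMatrix_pos_pos, irrepMatrix_neg_neg, Matrix.diagonal_add, Matrix.algebraMap_eq_diagonal]
  congr 1
  ext n
  simp
  ring

theorem irrepMatrix_casimir (α : ℂ) (d : ℕ) :
    irrepMatrix α d 1 1 * irrepMatrix α d (-1) (-1)
      - irrepMatrix α d (-1) 1 * irrepMatrix α d 1 (-1) - irrepMatrix α d 1 1
      = algebraMap ℂ _ (α * (α - d - 1)) := by
  rw [irrepMatrix_lower_mul_raise, irrepMatrix_pos_pos, irrepMatrix_neg_neg,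
    Matrix.diagonal_mul_diagonal, Matrix.diagonal_sub, Matrix.diagonal_sub,
    Matrix.algebraMap_eq_diagonal]
  congr 1
  ext n
  simp
  ring

/-- The factor contributed by `L(α, α - d)` to the scalar by which `σ₂(u)` acts. -/
def siteFactor (α : ℂ) (d : ℕ) : PowerSeries ℂ :=
  (1 + PowerSeries.C (2 * α - d) * PowerSeries.X
      + PowerSeries.C (2 * α - d + α * (α - d - 1)) * (PowerSeries.X * shiftX ℂ))
    * (1 - PowerSeries.C (2 * α - d) * PowerSeries.X
      + PowerSeries.C (α * (α - d - 1)) * (PowerSeries.X * shiftX ℂ))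

theorem evalFamily_map {A B : Type*} [Ring A] [Algebra ℂ A] [Ring B] [Algebra ℂ B]
    (φ : A →ₐ[ℂ] B) (E : Idx → Idx → A) (c : ℂ) (r : ℕ) (i j : Idx) :
    φ (evalFamily c E r i j) = evalFamily c (fun i j => φ (E i j)) r i j := by
  cases r with
  | zero => simp [evalFamily, apply_ite φ]
  | succ r => simp [evalFamily]

theorem transp_mul {A : Type*} [Ring A] (ε : ℤˣ) {M N : Matrix Idx Idx A}
    (h : ∀ i j k l, Commute (M i j) (N k l)) :
    transp ε (M * N) = transp ε N * transp ε M := by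
  ext1 i j
  simp only [transp, Matrix.of_apply, Matrix.mul_apply]
  rw [Finset.smul_sum, ← Equiv.sum_comp (Equiv.neg Idx)]
  refine Finset.sum_congr rfl fun b _ => ?_
  rw [Equiv.neg_apply, (h _ _ _ _).eq, smul_mul_smul_comm, theta_mul]

section Sandwich

variable {A₁ A₂ A : Type*} [Ring A₁] [Algebra ℂ A₁] [Ring A₂] [Algebra ℂ A₂] [Ring A] [Algebra ℂ A]

/-- The matrix `S(u)` of a tensor product is obtained from that of the second factor by
conjugation with the matrix `T(u)` of the first one. -/
theorem sandwich_eq (ε : ℤˣ) {η : A₁ →ₐ[ℂ] A} {τ : A₂ →ₐ[ℂ] A} (hητ : ∀ x y, Commute (η x) (τ y))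
    (t : ℕ → Idx → Idx → A₁) (T : Matrix Idx Idx (PowerSeries A₂))
    (K : Matrix Idx Idx (PowerSeries ℂ)) :
    (genMatrix t).map (PowerSeries.map η.toRingHom) * T.map (PowerSeries.map τ.toRingHom)
        * liftSeries K
        * transp ε (((genMatrix t).map (PowerSeries.map η.toRingHom)
          * T.map (PowerSeries.map τ.toRingHom)).map negU)
      = genMatrix (fun r i j => η (t r i j))
          * (T * liftSeries K * transp ε (T.map negU)).map (PowerSeries.map τ.toRingHom)
          * transp ε ((genMatrix fun r i j => η (t r i j)).map negU) := by
  have hG : (genMatrix t).map (PowerSeries.map η.toRingHom)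
      = genMatrix fun r i j => η (t r i j) := genMatrix_map η.toRingHom t
  rw [hG]
  set G := genMatrix fun r i j => η (t r i j) with hG
  have hneg : (G * T.map (PowerSeries.map τ.toRingHom)).map negU
      = G.map negU * (T.map negU).map (PowerSeries.map τ.toRingHom) := by
    ext1 i j
    simp only [Matrix.map_apply, Matrix.mul_apply, negU_sum, negU_mul]
    refine Finset.sum_congr rfl fun a _ => ?_
    rw [negU_map τ.toRingHom]
  have hc : ∀ i j k l, Commute (G.map negU i j)
      ((T.map negU).map (PowerSeries.map τ.toRingHom) k l) := by
    intro i j k l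
    refine commute_of_coeff fun m n => ?_
    simp only [Matrix.map_apply, PowerSeries.coeff_map, hG]
    rw [coeff_negU, coeff_genMatrix]
    refine Commute.mul_left ?_ (hητ _ _)
    exact (Commute.neg_one_left _).pow_left m
  rw [hneg, transp_mul ε hc, ← map_transp, Matrix.map_mul, Matrix.map_mul,
    map_liftSeries_series]
  simp only [Matrix.mul_assoc]

theorem IsSigma.sandwich {ε : ℤˣ} {η : A₁ →ₐ[ℂ] A} {τ : A₂ →ₐ[ℂ] A}
    (hητ : ∀ x y, Commute (η x) (τ y)) {E : Idx → Idx → A₁} (hE : IsGL2 E)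
    {T : Matrix Idx Idx (PowerSeries A₂)} {K : Matrix Idx Idx (PowerSeries ℂ)} {σ : PowerSeries ℂ}
    (h : IsSigma ε (T * liftSeries K * transp ε (T.map negU)) σ)
    {a b : ℂ} (ha : E 1 1 + E (-1) (-1) = algebraMap ℂ A₁ a)
    (hb : E 1 1 * E (-1) (-1) - E (-1) 1 * E 1 (-1) - E 1 1 = algebraMap ℂ A₁ b) :
    IsSigma ε ((genMatrix (evalFamily 0 E)).map (PowerSeries.map η.toRingHom)
          * T.map (PowerSeries.map τ.toRingHom) * liftSeries K
        * transp ε (((genMatrix (evalFamily 0 E)).map (PowerSeries.map η.toRingHom)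
          * T.map (PowerSeries.map τ.toRingHom)).map negU))
      ((1 + PowerSeries.C a * PowerSeries.X
          + PowerSeries.C (a + b) * (PowerSeries.X * shiftX ℂ))
        * (1 - PowerSeries.C a * PowerSeries.X
          + PowerSeries.C b * (PowerSeries.X * shiftX ℂ)) * σ) := by
  rw [sandwich_eq ε hητ]
  have e : (fun r i j => η (evalFamily 0 E r i j)) = evalFamily 0 fun i j => η (E i j) := by
    funext r i j
    exact evalFamily_map η _ _ _ _ _
  rw [e]
  refine (h.map τ).site (hE.map η.toRingHom) (fun i j k l n => ?_) ?_ ?_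
  · rw [Matrix.map_apply, PowerSeries.coeff_map]
    exact hητ _ _
  · rw [← map_add, ha]
    exact η.commutes a
  · rw [← map_mul, ← map_mul, ← map_sub, ← map_sub, hb]
    exact η.commutes b

end Sandwich

/-- `σ₂(u)` acts on a tensor product of evaluation modules and a one-dimensional module by a scalar
series. -/
theorem isSigma_stringS {ε : ℤˣ} {K : Matrix Idx Idx (PowerSeries ℂ)} {σ : PowerSeries ℂ}
    (h : IsSigma ε K σ) : ∀ (k : ℕ) (α : Fin k → ℂ) (d : Fin k → ℕ),
      IsSigma ε (stringS ε k α d K) ((∏ i, siteFactor (α i) (d i)) * σ)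
  | 0, α, d => by
    have h1 : (transp ε (1 : Matrix Idx Idx (PowerSeries (Matrix (Conf 0 d) (Conf 0 d) ℂ))))
        = 1 := by
      ext1 i j
      rw [transp_apply]
      by_cases hij : i = j
      · subst hij
        simp [theta]
      · simp [hij, Ne.symm hij]
    have h2 : ((1 : Matrix Idx Idx (PowerSeries (Matrix (Conf 0 d) (Conf 0 d) ℂ))).map negU)
        = 1 := by
      ext1 i j
      rw [Matrix.map_apply, ← negUHom_apply, Matrix.one_apply, apply_ite (negUHom _), map_one,
        map_zero]
    have h3 := h.map (Algebra.ofId ℂ (Matrix (Conf 0 d) (Conf 0 d) ℂ))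
    rw [Fintype.prod_empty, one_mul, stringS, stringT, h2, h1, one_mul, mul_one]
    exact h3
  | k + 1, α, d => by
    rw [Fin.prod_univ_succ, mul_assoc]
    exact (isSigma_stringS h k (fun i => α i.succ) (fun i => d i.succ)).sandwich
      commute_headHom_tailHom (isGL2_irrepMatrix (α 0) (d 0)) (irrepMatrix_trace (α 0) (d 0))
      (irrepMatrix_casimir (α 0) (d 0))

theorem sigmaTwo_map {A A' : Type*} [Ring A] [Algebra ℂ A] [Ring A'] [Algebra ℂ A'] (ε : ℤˣ)
    (φ : A →ₐ[ℂ] A') (S : Matrix Idx Idx (PowerSeries A)) :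
    sigmaTwo ε (S.map (PowerSeries.map φ.toRingHom))
      = PowerSeries.map φ.toRingHom (sigmaTwo ε S) := by
  have h1 : (liftConst antisym : Matrix _ _ (PowerSeries A')) =
      (liftConst antisym : Matrix _ _ (PowerSeries A)).map (PowerSeries.map φ.toRingHom) := by
    ext1 a b
    simp [liftConst]
  have h2 : (liftSeries (rMatrixT ε 1) : Matrix _ _ (PowerSeries A')) =
      (liftSeries (rMatrixT ε 1) : Matrix _ _ (PowerSeries A)).map
        (PowerSeries.map φ.toRingHom) := by
    ext1 a b
    refine PowerSeries.ext fun n => ?_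
    simp [liftSeries]
  have h3 : onFirst (S.map (PowerSeries.map φ.toRingHom))
      = (onFirst S).map (PowerSeries.map φ.toRingHom) := by
    ext1 a b
    rw [onFirst, onFirst, Matrix.kroneckerMap_apply, Matrix.map_apply, Matrix.map_apply,
      Matrix.kroneckerMap_apply, map_mul, Matrix.one_apply, Matrix.one_apply,
      apply_ite (PowerSeries.map φ.toRingHom), map_one, map_zero]
  have h4 : onSecond ((S.map (PowerSeries.map φ.toRingHom)).map shiftU)
      = (onSecond (S.map shiftU)).map (PowerSeries.map φ.toRingHom) := by
    ext1 a b
    rw [onSecond, onSecond, Matrix.kroneckerMap_apply, Matrix.map_apply, Matrix.map_apply,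
      Matrix.map_apply, Matrix.kroneckerMap_apply, map_mul, Matrix.map_apply, shiftU_map,
      Matrix.one_apply, Matrix.one_apply, apply_ite (PowerSeries.map φ.toRingHom), map_one,
      map_zero]
  rw [sigmaTwo, sigmaTwo, h1, h2, h3, h4, ← Matrix.map_mul, ← Matrix.map_mul, ← Matrix.map_mul]
  exact (AddMonoidHom.map_trace (PowerSeries.map φ.toRingHom) _).symm

section Realizes

variable {ε : ℤˣ} {N : TwistedModule ε} {k : ℕ} {α : Fin k → ℂ} {d : Fin k → ℕ} {δ : ℂ}
  {b : Module.Basis (Conf k d) ℂ N.carrier}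

theorem Realizes.map_genMatrix (h : Realizes N α d δ b) :
    (genMatrix (sGen ε)).map
        (PowerSeries.map ((LinearMap.toMatrixAlgEquiv b).toAlgHom.comp N.act).toRingHom)
      = stringS ε k α d (kMatrix δ) := by
  rw [genMatrix_map]
  ext1 i j
  refine PowerSeries.ext fun n => ?_
  rw [coeff_genMatrix]
  exact h n i j

theorem Realizes.act_sigmaTwo (h : Realizes N α d δ b) {σ : PowerSeries ℂ}
    (hσ : IsSigma ε (kMatrix δ) σ) (n : ℕ) :
    N.act (PowerSeries.coeff n (sigmaTwo ε (genMatrix (sGen ε))))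
      = algebraMap ℂ _ (PowerSeries.coeff n ((∏ i, siteFactor (α i) (d i)) * σ)) := by
  have h1 := sigmaTwo_map ε ((LinearMap.toMatrixAlgEquiv b).toAlgHom.comp N.act)
    (genMatrix (sGen ε))
  rw [h.map_genMatrix, (isSigma_stringS hσ k α d).sigmaTwo_eq] at h1
  have h2 := congrArg (PowerSeries.coeff n) h1
  rw [PowerSeries.coeff_map] at h2
  apply (LinearMap.toMatrixAlgEquiv b).injective
  rw [AlgEquiv.commutes]
  refine h2.symm.trans ?_
  rw [scal, PowerSeries.coeff_map]

end Realizes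

theorem isSigma_one_pos : IsSigma 1 (1 : Matrix Idx Idx (PowerSeries ℂ)) 1 := by
  refine isSigma_of_diagonal 1 (by simp) (by simp) ?_ ?_ <;>
  · simp [shiftU_one]

theorem exists_isSigma_half (ε : ℤˣ) : ∃ σ, IsSigma ε (kMatrix (1 / 2)) σ := by
  rw [kMatrix_half]
  rcases Int.units_eq_one_or ε with rfl | rfl
  · exact ⟨_, isSigma_one_pos⟩
  · exact ⟨_, isSigma_one_neg⟩

theorem siteFactor_ne_zero (α : ℂ) (d : ℕ) : siteFactor α d ≠ 0 := by
  intro h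
  have := congrArg PowerSeries.constantCoeff h
  simp [siteFactor] at this

/-- Clearing denominators in `siteFactor`: with `α` and `β = α - d`, the first factor is
`(1 + α u⁻¹) (1 + (β - 1) u⁻¹)`. -/
theorem one_sub_X_mul_siteFactor (α : ℂ) (d : ℕ) :
    (1 - PowerSeries.X) ^ 2 * siteFactor α d
      = (1 + PowerSeries.C (2 * α - d - 1) * PowerSeries.X
          + PowerSeries.C (α * (α - d - 1)) * PowerSeries.X ^ 2)
        * (1 - PowerSeries.C (2 * α - d + 1) * PowerSeries.X
          + PowerSeries.C (2 * α - d + α * (α - d - 1)) * PowerSeries.X ^ 2) := by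
  have hx := one_sub_X_mul_shiftX (A := ℂ)
  rw [siteFactor]
  generalize 2 * α - (d : ℂ) = a
  generalize α * (α - d - 1) = b
  have e1 : (1 - PowerSeries.X) * (1 + PowerSeries.C a * PowerSeries.X
      + PowerSeries.C (a + b) * (PowerSeries.X * shiftX ℂ))
      = 1 + PowerSeries.C (a - 1) * PowerSeries.X + PowerSeries.C b * PowerSeries.X ^ 2 := by
    rw [map_add, map_sub, map_one]
    linear_combination (PowerSeries.C a + PowerSeries.C b) * PowerSeries.X * hx
  have e2 : (1 - PowerSeries.X) * (1 - PowerSeries.C a * PowerSeries.X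
      + PowerSeries.C b * (PowerSeries.X * shiftX ℂ))
      = 1 - PowerSeries.C (a + 1) * PowerSeries.X + PowerSeries.C (a + b) * PowerSeries.X ^ 2 := by
    rw [map_add, map_add, map_one]
    linear_combination PowerSeries.C b * PowerSeries.X * hx
  rw [← e1, ← e2]
  ring

theorem coeff_three_one_sub_X_mul_siteFactor (α : ℂ) (d : ℕ) :
    PowerSeries.coeff 3 ((1 - PowerSeries.X) ^ 2 * siteFactor α d)
      = α ^ 2 + (α - d) ^ 2 + d := by
  rw [one_sub_X_mul_siteFactor]
  have e : ∀ p q r s : ℂ, PowerSeries.coeff 3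
      ((1 + PowerSeries.C p * PowerSeries.X + PowerSeries.C q * PowerSeries.X ^ 2)
        * (1 - PowerSeries.C r * PowerSeries.X + PowerSeries.C s * PowerSeries.X ^ 2)
          : PowerSeries ℂ) = p * s - q * r := by
    intro p q r s
    have : ((1 + PowerSeries.C p * PowerSeries.X + PowerSeries.C q * PowerSeries.X ^ 2)
        * (1 - PowerSeries.C r * PowerSeries.X + PowerSeries.C s * PowerSeries.X ^ 2)
          : PowerSeries ℂ)
        = 1 + PowerSeries.C (p - r) * PowerSeries.X ^ 1
          + PowerSeries.C (q + s - p * r) * PowerSeries.X ^ 2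
          + PowerSeries.C (p * s - q * r) * PowerSeries.X ^ 3
          + PowerSeries.C (q * s) * PowerSeries.X ^ 4 := by
      simp only [map_sub, map_add, map_mul]
      ring
    rw [this, map_add, map_add, map_add, map_add]
    simp only [PowerSeries.coeff_C_mul, PowerSeries.coeff_X_pow, PowerSeries.coeff_one]
    norm_num
  rw [e]
  ring

/-- The scalars by which `σ₂(u)` acts tell `L(α, α - d)` from `L(α - 1, α - 1 - d)`: after
multiplication by `(1 - u⁻¹)²` the third coefficients are `α² + β² + d`, where `β = α - d`, and they
differ by `2 (α + β - 1)`. -/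
theorem siteFactor_sub_one_ne {α : ℂ} {d : ℕ} (h : 2 * α - d ≠ 1) :
    siteFactor α d ≠ siteFactor (α - 1) d := by
  intro e
  have h1 := coeff_three_one_sub_X_mul_siteFactor α d
  rw [e, coeff_three_one_sub_X_mul_siteFactor] at h1
  apply h
  linear_combination -h1 / 2


/-! ### Evaluation of polynomial series -/

section EvalsTo

variable {A : Type*} [Ring A] [Algebra ℂ A]

/-- The series `F` is a polynomial in `u⁻¹` whose value at `u⁻¹ = z` is `a`. -/
def EvalsTo (z : ℂ) (F : PowerSeries A) (a : A) : Prop :=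
  ∃ p : Polynomial A, (p : PowerSeries A) = F ∧ p.eval (algebraMap ℂ A z) = a

variable {z : ℂ} {F G : PowerSeries A} {a b : A}

theorem EvalsTo.add (hF : EvalsTo z F a) (hG : EvalsTo z G b) : EvalsTo z (F + G) (a + b) := by
  obtain ⟨p, rfl, rfl⟩ := hF
  obtain ⟨q, rfl, rfl⟩ := hG
  exact ⟨p + q, Polynomial.coe_add _ _, Polynomial.eval_add⟩

theorem EvalsTo.mul (hF : EvalsTo z F a) (hG : EvalsTo z G b) : EvalsTo z (F * G) (a * b) := by
  obtain ⟨p, rfl, rfl⟩ := hF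
  obtain ⟨q, rfl, rfl⟩ := hG
  exact ⟨p * q, Polynomial.coe_mul _ _,
    Polynomial.eval₂_mul_noncomm _ _ fun k => (Algebra.commutes z (q.coeff k)).symm⟩

theorem evalsTo_C (z : ℂ) (a : A) : EvalsTo z (PowerSeries.C a) a :=
  ⟨Polynomial.C a, Polynomial.coe_C _, Polynomial.eval_C⟩

theorem evalsTo_X (z : ℂ) : EvalsTo z (PowerSeries.X : PowerSeries A) (algebraMap ℂ A z) :=
  ⟨Polynomial.X, Polynomial.coe_X, Polynomial.eval_X⟩

theorem EvalsTo.sub (hF : EvalsTo z F a) (hG : EvalsTo z G b) : EvalsTo z (F - G) (a - b) := by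
  have := hF.add ((evalsTo_C z (-1)).mul hG)
  rwa [map_neg, map_one, neg_one_mul, neg_one_mul, ← sub_eq_add_neg, ← sub_eq_add_neg] at this

theorem evalsTo_ite (z : ℂ) (P : Prop) [Decidable P] :
    EvalsTo z (if P then 1 else 0 : PowerSeries A) (if P then 1 else 0) := by
  split_ifs
  · simpa using evalsTo_C z (1 : A)
  · simpa using evalsTo_C z (0 : A)

theorem EvalsTo.sum {ι : Type*} (s : Finset ι) {F : ι → PowerSeries A} {a : ι → A}
    (h : ∀ i ∈ s, EvalsTo z (F i) (a i)) : EvalsTo z (∑ i ∈ s, F i) (∑ i ∈ s, a i) := by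
  classical
  induction s using Finset.induction_on with
  | empty => simpa using evalsTo_C z (0 : A)
  | insert i s hi ih =>
    rw [Finset.sum_insert hi, Finset.sum_insert hi]
    exact (h i (Finset.mem_insert_self i s)).add
      (ih fun j hj => h j (Finset.mem_insert_of_mem hj))

theorem EvalsTo.map {A' : Type*} [Ring A'] [Algebra ℂ A'] (hF : EvalsTo z F a) (φ : A →ₐ[ℂ] A') :
    EvalsTo z (PowerSeries.map φ.toRingHom F) (φ a) := by
  obtain ⟨p, rfl, rfl⟩ := hF
  refine ⟨p.map φ.toRingHom, ?_, ?_⟩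
  · refine PowerSeries.ext fun n => ?_
    simp
  · rw [Polynomial.eval_map, ← φ.commutes]
    exact Polynomial.eval₂_at_apply φ.toRingHom _

theorem EvalsTo.eventually_eq (hF : EvalsTo z F a) :
    ∀ᶠ n in Filter.atTop, ∑ i ∈ Finset.range n, z ^ i • PowerSeries.coeff i F = a := by
  obtain ⟨p, rfl, rfl⟩ := hF
  filter_upwards [Filter.eventually_gt_atTop p.natDegree] with n hn
  rw [Polynomial.eval_eq_sum_range' hn]
  refine Finset.sum_congr rfl fun i _ => ?_
  rw [Polynomial.coeff_coe, ← map_pow, ← Algebra.commutes, ← Algebra.smul_def]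

theorem EvalsTo.negU (hF : EvalsTo (-z) F a) : EvalsTo z (negU F) a := by
  obtain ⟨p, rfl, rfl⟩ := hF
  induction p using Polynomial.induction_on' with
  | add p q hp hq =>
    rw [Polynomial.coe_add, ← negUHom_apply, map_add, Polynomial.eval_add]
    exact hp.add hq
  | monomial n a =>
    have h1 : ((Polynomial.monomial n ((-1) ^ n * a) : Polynomial A) : PowerSeries A)
        = TwistedBethe.negU ((Polynomial.monomial n a : Polynomial A) : PowerSeries A) := by
      refine PowerSeries.ext fun m => ?_
      rw [coeff_negU, Polynomial.coeff_coe, Polynomial.coeff_coe, Polynomial.coeff_monomial,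
        Polynomial.coeff_monomial]
      split_ifs with h
      · rw [h]
      · rw [mul_zero]
    refine ⟨_, h1, ?_⟩
    rw [Polynomial.eval_monomial, Polynomial.eval_monomial, map_neg, neg_pow (algebraMap ℂ A z),
      ← mul_assoc, ((Commute.neg_one_left a).pow_left n).eq]

theorem EvalsTo.zsmul (hF : EvalsTo z F a) (n : ℤ) : EvalsTo z (n • F) (n • a) := by
  have := (evalsTo_C z (n : A)).mul hF
  rwa [map_intCast, ← zsmul_eq_mul, ← zsmul_eq_mul] at this

theorem evalsTo_transp {M : Matrix Idx Idx (PowerSeries A)} {N : Matrix Idx Idx A}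
    (h : ∀ i j, EvalsTo z (M i j) (N i j)) (ε : ℤˣ) (i j : Idx) :
    EvalsTo z (transp ε M i j) (transp ε N i j) :=
  (h (-j) (-i)).zsmul _

theorem evalsTo_matrix_mul {M M' : Matrix Idx Idx (PowerSeries A)} {N N' : Matrix Idx Idx A}
    (h : ∀ i j, EvalsTo z (M i j) (N i j)) (h' : ∀ i j, EvalsTo z (M' i j) (N' i j)) (i j : Idx) :
    EvalsTo z ((M * M') i j) ((N * N') i j) :=
  EvalsTo.sum Finset.univ fun a _ => (h i a).mul (h' a j)

end EvalsTo

/-! ### First order expansions -/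

section FirstOrder

variable {A : Type*} [Ring A] [Algebra ℂ A] [TopologicalSpace A] [IsTopologicalRing A]
  [ContinuousSMul ℂ A]

/-- `F(s) = a + s b + O(s²)`, in the strong form that the remainder is `s²` times a continuous
function. -/
def FirstOrder (F : ℂ → A) (a b : A) : Prop :=
  ∃ c : ℂ → A, Continuous c ∧ ∀ s, F s = a + s • b + s ^ 2 • c s

variable {F G : ℂ → A} {a a' b b' : A}

theorem FirstOrder.add (hF : FirstOrder F a b) (hG : FirstOrder G a' b') :
    FirstOrder (fun s => F s + G s) (a + a') (b + b') := by
  obtain ⟨c, hc, h⟩ := hF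
  obtain ⟨c', hc', h'⟩ := hG
  refine ⟨fun s => c s + c' s, hc.add hc', fun s => ?_⟩
  beta_reduce
  rw [h, h']
  module

theorem FirstOrder.const (a : A) : FirstOrder (fun _ => a) a 0 :=
  ⟨fun _ => 0, continuous_const, fun s => by simp⟩

theorem FirstOrder.id (a b : A) : FirstOrder (fun s => a + s • b) a b :=
  ⟨fun _ => 0, continuous_const, fun s => by simp⟩

theorem FirstOrder.mul (hF : FirstOrder F a b) (hG : FirstOrder G a' b') :
    FirstOrder (fun s => F s * G s) (a * a') (a * b' + b * a') := by
  obtain ⟨c, hc, h⟩ := hF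
  obtain ⟨c', hc', h'⟩ := hG
  refine ⟨fun s => a * c' s + b * b' + c s * a' + s • (b * c' s) + s • (c s * b')
    + s ^ 2 • (c s * c' s), by fun_prop, fun s => ?_⟩
  beta_reduce
  rw [h, h']
  simp only [add_mul, mul_add, smul_mul_assoc, mul_smul_comm]
  module

theorem FirstOrder.sum {ι : Type*} (s : Finset ι) {F : ι → ℂ → A} {a b : ι → A}
    (h : ∀ i ∈ s, FirstOrder (F i) (a i) (b i)) :
    FirstOrder (fun x => ∑ i ∈ s, F i x) (∑ i ∈ s, a i) (∑ i ∈ s, b i) := by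
  classical
  induction s using Finset.induction_on with
  | empty => simpa using FirstOrder.const (0 : A)
  | insert i s hi ih =>
    simp only [Finset.sum_insert hi]
    exact (h i (Finset.mem_insert_self i s)).add
      (ih fun j hj => h j (Finset.mem_insert_of_mem hj))

theorem FirstOrder.map {A' : Type*} [Ring A'] [Algebra ℂ A'] [TopologicalSpace A']
    [IsTopologicalRing A'] [ContinuousSMul ℂ A'] (hF : FirstOrder F a b) (φ : A →ₗ[ℂ] A')
    (hφ : Continuous φ) : FirstOrder (fun s => φ (F s)) (φ a) (φ b) := by
  obtain ⟨c, hc, h⟩ := hF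
  exact ⟨fun s => φ (c s), hφ.comp hc, fun s => by simp [h]⟩

open scoped Topology in
theorem FirstOrder.tendsto (hF : FirstOrder F 0 b) :
    Filter.Tendsto (fun s => s⁻¹ • F s) (𝓝[≠] 0) (𝓝 b) := by
  obtain ⟨c, hc, h⟩ := hF
  have h1 : Continuous fun s : ℂ => b + s • c s := by fun_prop
  have h2 : Filter.Tendsto (fun s : ℂ => b + s • c s) (𝓝[≠] 0) (𝓝 b) := by
    have := h1.tendsto 0
    rw [zero_smul, add_zero] at this
    exact this.mono_left nhdsWithin_le_nhds
  refine h2.congr' ?_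
  filter_upwards [self_mem_nhdsWithin] with s hs
  rw [h, zero_add, smul_add, smul_smul, smul_smul, inv_mul_cancel₀ hs, one_smul, pow_two,
    inv_mul_cancel_left₀ hs]

theorem FirstOrder.matrix_mul {F G : ℂ → Matrix Idx Idx A} {M D M' D' : Matrix Idx Idx A}
    (h : ∀ i j, FirstOrder (fun s => F s i j) (M i j) (D i j))
    (h' : ∀ i j, FirstOrder (fun s => G s i j) (M' i j) (D' i j)) (i j : Idx) :
    FirstOrder (fun s => (F s * G s) i j) ((M * M') i j) ((M * D' + D * M') i j) := by
  have := FirstOrder.sum Finset.univ fun a _ => (h i a).mul (h' a j)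
  rw [Finset.sum_add_distrib] at this
  exact this

theorem FirstOrder.zsmul (hF : FirstOrder F a b) (n : ℤ) :
    FirstOrder (fun s => n • F s) (n • a) (n • b) := by
  have := (FirstOrder.const (n : A)).mul hF
  simpa only [← zsmul_eq_mul, zero_mul, add_zero] using this

theorem FirstOrder.sub (hF : FirstOrder F a b) (hG : FirstOrder G a' b') :
    FirstOrder (fun s => F s - G s) (a - a') (b - b') := by
  have := hF.add (hG.zsmul (-1))
  simpa only [neg_one_smul, ← sub_eq_add_neg] using this

theorem FirstOrder.transp {F : ℂ → Matrix Idx Idx A} {M D : Matrix Idx Idx A}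
    (h : ∀ i j, FirstOrder (fun s => F s i j) (M i j) (D i j)) (ε : ℤˣ) (i j : Idx) :
    FirstOrder (fun s => transp ε (F s) i j) (transp ε M i j) (transp ε D i j) :=
  (h (-j) (-i)).zsmul _

end FirstOrder


/-! ### The leading term for large spectral parameters -/

/-- The weights `d_p - 2 m_p` of a basis vector `v_{m₁} ⊗ ⋯ ⊗ v_{m_k}` with respect to
`E₁₁ - E_{-1,-1}` in the individual tensor factors. -/
def confWeight : (k : ℕ) → (d : Fin k → ℕ) → Conf k d → Fin k → ℂ
  | 0, _, _ => Fin.elim0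
  | k + 1, d, c => Fin.cons ((d 0 : ℂ) - 2 * ((c.1 : Fin (d 0 + 1)) : ℕ))
      (confWeight k (fun i => d i.succ) c.2)

section Step

variable {I J : Type*} [Fintype I] [DecidableEq I] [Fintype J] [DecidableEq J]

theorem headHom_diagonal (f : I → ℂ) :
    headHom I J (Matrix.diagonal f) = Matrix.diagonal fun p : I × J => f p.1 := by
  change Matrix.kroneckerMap (· * ·) (Matrix.diagonal f) 1 = _
  rw [← Matrix.diagonal_one, Matrix.kroneckerMap_diagonal_diagonal _ (by simp) (by simp)]
  simp

theorem tailHom_diagonal (f : J → ℂ) :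
    tailHom I J (Matrix.diagonal f) = Matrix.diagonal fun p : I × J => f p.2 := by
  change Matrix.kroneckerMap (· * ·) 1 (Matrix.diagonal f) = _
  rw [← Matrix.diagonal_one, Matrix.kroneckerMap_diagonal_diagonal _ (by simp) (by simp)]
  simp

theorem irrepMatrix_add (c α : ℂ) (d : ℕ) (i j : Idx) :
    irrepMatrix (c + α) d i j = c • (if i = j then 1 else 0) + irrepMatrix α d i j := by
  have n1 : (1 : Idx) ≠ -1 := by decide
  rcases Int.units_eq_one_or i with rfl | rfl <;> rcases Int.units_eq_one_or j with rfl | rfl <;>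
    ext m n <;> by_cases h : m = n <;>
    simp [irrepMatrix, n1, h] <;> ring

/-- For `u⁻¹ = s w` the matrix `T(u)` of `L(s⁻¹ x + α, s⁻¹ x + α - d)` depends linearly on `s`. -/
theorem evalsTo_genMatrix_irrep (w x α : ℂ) (d : ℕ) {s : ℂ} (hs : s ≠ 0) (i j : Idx) :
    EvalsTo (s * w) (genMatrix (evalFamily 0 (irrepMatrix (s⁻¹ * x + α) d)) i j)
      (((1 + w * x) • (1 : Matrix Idx Idx (Matrix (Fin (d + 1)) (Fin (d + 1)) ℂ))) i j
        + s • (w • irrepMatrix α d i j)) := by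
  rw [genMatrix_evalFamily]
  have h := (evalsTo_ite (A := Matrix (Fin (d + 1)) (Fin (d + 1)) ℂ) (s * w) (i = j)).add
    ((evalsTo_X (s * w)).mul (evalsTo_C (s * w) (irrepMatrix (s⁻¹ * x + α) d i j)))
  convert h using 1
  rw [irrepMatrix_add, ← Algebra.smul_def, Matrix.smul_apply, Matrix.one_apply, smul_add,
    smul_smul, smul_smul, show s * w * (s⁻¹ * x) = w * x by field_simp]
  module

/-- Tensoring with one more evaluation module multiplies the leading scalar by `1 + w x` and adds
the weight of the new factor, divided by `1 + w x`. -/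
theorem leadingTerm_step {w x τ : ℂ} {d : ℕ} (α : ℂ) {F : ℂ → Matrix Idx Idx (Matrix J J ℂ)}
    {D : Matrix Idx Idx (Matrix J J ℂ)} {T : ℂ → Matrix Idx Idx (PowerSeries (Matrix J J ℂ))}
    {f : J → ℂ} (hx : 1 + w * x ≠ 0)
    (h1 : ∀ s, s ≠ 0 → ∀ i j, EvalsTo (s * w) (T s i j) (F s i j))
    (h2 : ∀ i j, FirstOrder (fun s => F s i j) ((τ • (1 : Matrix Idx Idx (Matrix J J ℂ))) i j)
      (D i j))
    (h3 : D 1 1 - D (-1) (-1) = Matrix.diagonal fun c => τ * (w * f c)) :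
    ∃ (F' : ℂ → Matrix Idx Idx (Matrix (Fin (d + 1) × J) (Fin (d + 1) × J) ℂ))
      (D' : Matrix Idx Idx (Matrix (Fin (d + 1) × J) (Fin (d + 1) × J) ℂ)),
      (∀ s, s ≠ 0 → ∀ i j, EvalsTo (s * w)
        (((genMatrix (evalFamily 0 (irrepMatrix (s⁻¹ * x + α) d))).map
          (PowerSeries.map (headHom (Fin (d + 1)) J).toRingHom)
          * (T s).map (PowerSeries.map (tailHom (Fin (d + 1)) J).toRingHom)) i j) (F' s i j)) ∧
      (∀ i j, FirstOrder (fun s => F' s i j) ((((1 + w * x) * τ) •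
        (1 : Matrix Idx Idx (Matrix (Fin (d + 1) × J) (Fin (d + 1) × J) ℂ))) i j) (D' i j)) ∧
      D' 1 1 - D' (-1) (-1) = Matrix.diagonal fun p : Fin (d + 1) × J => (1 + w * x) * τ *
        (w * (((d : ℂ) - 2 * (p.1 : ℕ)) * (1 + w * x)⁻¹ + f p.2)) := by
  set η := headHom (Fin (d + 1)) J
  set θ := tailHom (Fin (d + 1)) J
  set G : ℂ → Matrix Idx Idx (Matrix (Fin (d + 1) × J) (Fin (d + 1) × J) ℂ) := fun s =>
    Matrix.of fun i j => η (((1 + w * x) •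
      (1 : Matrix Idx Idx (Matrix (Fin (d + 1)) (Fin (d + 1)) ℂ))) i j
        + s • (w • irrepMatrix α d i j)) with hG
  set M : Matrix Idx Idx (Matrix (Fin (d + 1) × J) (Fin (d + 1) × J) ℂ) := Matrix.of fun i j =>
    η (((1 + w * x) • (1 : Matrix Idx Idx (Matrix (Fin (d + 1)) (Fin (d + 1)) ℂ))) i j) with hM
  set N : Matrix Idx Idx (Matrix (Fin (d + 1) × J) (Fin (d + 1) × J) ℂ) := Matrix.of fun i j =>
    η (w • irrepMatrix α d i j) with hN
  set M' : Matrix Idx Idx (Matrix (Fin (d + 1) × J) (Fin (d + 1) × J) ℂ) := Matrix.of fun i j =>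
    θ ((τ • (1 : Matrix Idx Idx (Matrix J J ℂ))) i j) with hM'
  have eM : M = (1 + w * x) • 1 := by
    ext1 i j
    rw [hM, Matrix.of_apply, Matrix.smul_apply, Matrix.smul_apply, map_smul, Matrix.one_apply,
      Matrix.one_apply, apply_ite η, map_one, map_zero]
  have eM' : M' = τ • 1 := by
    ext1 i j
    rw [hM', Matrix.of_apply, Matrix.smul_apply, Matrix.smul_apply, map_smul, Matrix.one_apply,
      Matrix.one_apply, apply_ite θ, map_one, map_zero]
  have f1 : ∀ i j, FirstOrder (fun s => G s i j) (M i j) (N i j) := fun i j =>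
    (FirstOrder.id _ _).map η.toLinearMap (LinearMap.continuous_of_finiteDimensional _)
  have f2 : ∀ i j, FirstOrder (fun s => (F s).map θ i j) (M' i j) (D.map θ i j) := fun i j =>
    (h2 i j).map θ.toLinearMap (LinearMap.continuous_of_finiteDimensional _)
  refine ⟨fun s => G s * (F s).map θ, M * D.map θ + N * M', fun s hs => ?_, fun i j => ?_, ?_⟩
  · exact evalsTo_matrix_mul (fun i j => (evalsTo_genMatrix_irrep w x α d hs i j).map η)
      (fun i j => (h1 s hs i j).map θ)
  · have := FirstOrder.matrix_mul f1 f2 i j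
    rwa [show M * M' = ((1 + w * x) * τ) • 1 by
      rw [eM, eM', Matrix.smul_mul, Matrix.mul_smul, one_mul, smul_smul]] at this
  · have e1 : θ (D 1 1) - θ (D (-1) (-1))
        = Matrix.diagonal fun p : Fin (d + 1) × J => τ * (w * f p.2) := by
      rw [← map_sub, h3, tailHom_diagonal]
    have e2 : η (irrepMatrix α d 1 1) - η (irrepMatrix α d (-1) (-1))
        = Matrix.diagonal fun p : Fin (d + 1) × J => (d : ℂ) - 2 * (p.1 : ℕ) := by
      rw [← map_sub, irrepMatrix_pos_pos, irrepMatrix_neg_neg, Matrix.diagonal_sub,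
        headHom_diagonal]
      congr 1
      ext p
      ring
    have e3 : ∀ i, (M * D.map θ + N * M') i i
        = (1 + w * x) • θ (D i i) + (τ * w) • η (irrepMatrix α d i i) := by
      intro i
      rw [eM, eM', Matrix.smul_mul, Matrix.mul_smul, one_mul, mul_one, Matrix.add_apply,
        Matrix.smul_apply, Matrix.smul_apply, Matrix.map_apply, hN, Matrix.of_apply, map_smul,
        smul_smul]
    rw [e3, e3, add_sub_add_comm, ← smul_sub, ← smul_sub, e1, e2, ← Matrix.diagonal_smul,
      ← Matrix.diagonal_smul, Matrix.diagonal_add]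
    congr 1
    ext p
    simp only [Pi.smul_apply, smul_eq_mul]
    field_simp
    ring

end Step

/-- The expansion of `T(u)` at `u⁻¹ = s w` on `⨂ L(s⁻¹ x_i + α_i, s⁻¹ x_i + α_i - d_i)` for
`s → 0`: the leading term is scalar, and the next one is diagonal after taking
`t₁₁ - t_{-1,-1}`. -/
theorem exists_leadingTerm (w : ℂ) : ∀ (k : ℕ) (x α : Fin k → ℂ) (d : Fin k → ℕ),
    (∀ i, 1 + w * x i ≠ 0) →
    ∃ (F : ℂ → Matrix Idx Idx (Matrix (Conf k d) (Conf k d) ℂ))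
      (D : Matrix Idx Idx (Matrix (Conf k d) (Conf k d) ℂ)),
      (∀ s, s ≠ 0 → ∀ i j, EvalsTo (s * w) (stringT k (fun i => s⁻¹ * x i + α i) d i j)
        (F s i j)) ∧
      (∀ i j, FirstOrder (fun s => F s i j) (((∏ p, (1 + w * x p)) •
        (1 : Matrix Idx Idx (Matrix (Conf k d) (Conf k d) ℂ))) i j) (D i j)) ∧
      D 1 1 - D (-1) (-1) = Matrix.diagonal fun c => (∏ p, (1 + w * x p)) *
        (w * ∑ p, confWeight k d c p * (1 + w * x p)⁻¹)
  | 0, x, α, d, _ => by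
    refine ⟨fun _ => 1, 0, fun s _ i j => ?_, fun i j => ?_, ?_⟩
    · beta_reduce
      rw [stringT, Matrix.one_apply, Matrix.one_apply]
      exact evalsTo_ite _ _
    · rw [Fintype.prod_empty, one_smul]
      exact FirstOrder.const _
    · simp only [Finset.univ_eq_empty, Finset.sum_empty, mul_zero]
      rw [Matrix.diagonal_zero]
      simp
  | k + 1, x, α, d, hx => by
    obtain ⟨F, D, h1, h2, h3⟩ := exists_leadingTerm w k (fun i => x i.succ) (fun i => α i.succ)
      (fun i => d i.succ) (fun i => hx i.succ)
    obtain ⟨F', D', h1', h2', h3'⟩ := leadingTerm_step (d := d 0) (α 0) (hx 0) h1 h2 h3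
    refine ⟨F', D', h1', ?_, ?_⟩
    · rw [Fin.prod_univ_succ]
      exact h2'
    · refine h3'.trans ?_
      rw [Fin.prod_univ_succ]
      congr 1
      funext c
      rw [Fin.sum_univ_succ]
      rfl

/-- The multiple `(1 + u⁻¹/2) (s₁₁(u) - s_{-1,-1}(u))` of `σ₁(u)`. -/
def betheSeries {A : Type*} [Ring A] [Algebra ℂ A] (S : Matrix Idx Idx (PowerSeries A)) :
    PowerSeries A :=
  scal A (1 + PowerSeries.C (1 / 2 : ℂ) * PowerSeries.X) * trC S

theorem half_mul_kMatrix (δ : ℂ) (i j : Idx) :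
    (1 + PowerSeries.C (1 / 2 : ℂ) * PowerSeries.X) * kMatrix δ i j
      = if i = j then 1 + PowerSeries.C (((i : ℤ) : ℂ) * (δ - 1 / 2) + 1 / 2) * PowerSeries.X
        else 0 := by
  rw [kMatrix, Matrix.of_apply, charSeries]
  split_ifs
  · exact charW_aux _
  · exact mul_zero _

theorem scal_mul_mul_mul {A : Type*} [Ring A] [Algebra ℂ A] (f : PowerSeries ℂ)
    (T T' : Matrix Idx Idx (PowerSeries A)) (K : Matrix Idx Idx (PowerSeries ℂ)) (i j : Idx) :
    scal A f * (T * liftSeries K * T' : Matrix Idx Idx (PowerSeries A)) i j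
      = (T * (Matrix.of fun i j => scal A (f * K i j)) * T' : Matrix Idx Idx _) i j := by
  simp only [Matrix.mul_apply, Finset.mul_sum, Finset.sum_mul, Matrix.of_apply, map_mul]
  refine Finset.sum_congr rfl fun a _ => Finset.sum_congr rfl fun c _ => ?_
  rw [← mul_assoc, ← mul_assoc, ← mul_assoc (T i c), (commute_scal f (T i c)).eq]
  rfl

section Middle

variable {A : Type*} [Ring A] [Algebra ℂ A]

/-- The value of `(1 + u⁻¹/2) diag(s₁₁(u), s_{-1,-1}(u))` on `W(δ)` at `u⁻¹ = s w`. -/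
def middleValue (A : Type*) [Ring A] [Algebra ℂ A] (w δ s : ℂ) : Matrix Idx Idx A :=
  Matrix.of fun i j => (1 : Matrix Idx Idx A) i j
    + s • (Matrix.diagonal fun i : Idx => (w * (((i : ℤ) : ℂ) * (δ - 1 / 2) + 1 / 2)) • (1 : A)) i j

theorem evalsTo_middleValue (w δ s : ℂ) (i j : Idx) :
    EvalsTo (s * w) ((Matrix.of fun i j => scal A
      ((1 + PowerSeries.C (1 / 2 : ℂ) * PowerSeries.X) * kMatrix δ i j)) i j)
      (middleValue A w δ s i j) := by
  rw [Matrix.of_apply, half_mul_kMatrix, middleValue, Matrix.of_apply]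
  by_cases hij : i = j
  · subst hij
    rw [if_pos rfl, Matrix.one_apply_eq, Matrix.diagonal_apply_eq, map_add, map_one, map_mul,
      scal_X]
    generalize ((i : ℤ) : ℂ) * (δ - 1 / 2) + 1 / 2 = e
    have h := (evalsTo_C (s * w) (1 : A)).add
      ((evalsTo_C (s * w) (algebraMap ℂ A e)).mul (evalsTo_X (s * w)))
    convert h using 1
    · simp [scal]
    · rw [← map_mul, Algebra.algebraMap_eq_smul_one, smul_smul]
      congr 2
      ring
  · rw [if_neg hij, map_zero, Matrix.one_apply_ne hij, Matrix.diagonal_apply_ne _ hij, smul_zero,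
      add_zero]
    simpa using evalsTo_C (s * w) (0 : A)

theorem evalsTo_betheSeries (ε : ℤˣ) {w s : ℂ} (δ : ℂ) {T : Matrix Idx Idx (PowerSeries A)}
    {F F' : Matrix Idx Idx A} (h : ∀ i j, EvalsTo (s * w) (T i j) (F i j))
    (h' : ∀ i j, EvalsTo (s * -w) (T i j) (F' i j)) :
    EvalsTo (s * w) (betheSeries (T * liftSeries (kMatrix δ) * transp ε (T.map negU)))
      ((F * middleValue A w δ s * transp ε F' : Matrix Idx Idx A) 1 1
        - (F * middleValue A w δ s * transp ε F' : Matrix Idx Idx A) (-1) (-1)) := by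
  rw [betheSeries, trC, mul_sub, scal_mul_mul_mul, scal_mul_mul_mul]
  have n1 : ∀ i j, EvalsTo (s * w) ((T.map negU) i j) (F' i j) := fun i j => by
    have := h' i j
    rw [mul_neg] at this
    exact this.negU
  have n2 := evalsTo_matrix_mul (evalsTo_matrix_mul h (evalsTo_middleValue w δ s))
    (evalsTo_transp n1 ε)
  exact (n2 1 1).sub (n2 (-1) (-1))

/-- The first order term of `F K F'^t` only involves the differences of the diagonal entries of the
first order terms; the transposition exchanges these entries and so produces a sign. -/
theorem firstOrder_betheSeries [TopologicalSpace A] [IsTopologicalRing A] [ContinuousSMul ℂ A]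
    (ε : ℤˣ) (w δ : ℂ) {F F' : ℂ → Matrix Idx Idx A} {τ τ' : ℂ} {D D' : Matrix Idx Idx A}
    (h : ∀ i j, FirstOrder (fun s => F s i j) ((τ • (1 : Matrix Idx Idx A)) i j) (D i j))
    (h' : ∀ i j, FirstOrder (fun s => F' s i j) ((τ' • (1 : Matrix Idx Idx A)) i j) (D' i j)) :
    FirstOrder (fun s => (F s * middleValue A w δ s * transp ε (F' s) : Matrix Idx Idx A) 1 1
        - (F s * middleValue A w δ s * transp ε (F' s) : Matrix Idx Idx A) (-1) (-1)) 0
      (-(τ • (D' 1 1 - D' (-1) (-1))) + τ' • (D 1 1 - D (-1) (-1))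
          + (τ * τ' * w * (2 * (δ - 1 / 2))) • (1 : A)) := by
  set Kd : Matrix Idx Idx A :=
    Matrix.diagonal fun i : Idx => (w * (((i : ℤ) : ℂ) * (δ - 1 / 2) + 1 / 2)) • (1 : A) with hKd
  have k2 : ∀ i j, FirstOrder (fun s => middleValue A w δ s i j) ((1 : Matrix Idx Idx A) i j)
      (Kd i j) := fun i j => FirstOrder.id _ _
  have m1 := fun i j => FirstOrder.matrix_mul (FirstOrder.matrix_mul h k2)
    (FirstOrder.transp h' ε) i j
  have t1 : transp ε (τ' • (1 : Matrix Idx Idx A)) = τ' • 1 := by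
    ext1 i j
    rw [transp_apply]
    by_cases hij : i = j
    · subst hij
      simp [theta]
    · simp [hij, Ne.symm hij]
  have t2 : ∀ i, transp ε D' i i = D' (-i) (-i) := by
    intro i
    rw [transp_apply]
    simp [theta]
  have t3 : ∀ i, ((τ • (1 : Matrix Idx Idx A) * 1) * transp ε D'
      + ((τ • (1 : Matrix Idx Idx A)) * Kd + D * 1) * transp ε (τ' • (1 : Matrix Idx Idx A))
        : Matrix Idx Idx A) i i
      = τ • D' (-i) (-i) + τ' • (τ • Kd i i + D i i) := by
    intro i
    rw [t1, mul_one, mul_one, Matrix.smul_mul, Matrix.smul_mul, Matrix.mul_smul, one_mul, one_mul,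
      mul_one, Matrix.add_apply, Matrix.smul_apply, Matrix.smul_apply, Matrix.add_apply,
      Matrix.smul_apply, t2]
  have t4 : ∀ i, ((τ • (1 : Matrix Idx Idx A) * 1) * transp ε (τ' • (1 : Matrix Idx Idx A))
      : Matrix Idx Idx A) i i = (τ * τ') • (1 : A) := by
    intro i
    rw [t1, mul_one, Matrix.smul_mul, Matrix.mul_smul, mul_one, smul_smul, Matrix.smul_apply,
      Matrix.one_apply_eq]
  have m2 := (m1 1 1).sub (m1 (-1) (-1))
  rw [t3, t3, t4, t4, sub_self, hKd, Matrix.diagonal_apply_eq, Matrix.diagonal_apply_eq,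
    neg_neg] at m2
  convert m2 using 1
  simp only [Units.val_one, Units.val_neg, Int.cast_one, Int.cast_neg]
  module

end Middle

/-- The leading term of `betheSeries` at `u⁻¹ = s w`, for `s → 0`. -/
theorem exists_leadingTerm_betheSeries (ε : ℤˣ) {w : ℂ} (δ : ℂ) {k : ℕ} {x : Fin k → ℂ}
    (α : Fin k → ℂ) (d : Fin k → ℕ) (hx : ∀ i, 1 - w ^ 2 * x i ^ 2 ≠ 0) :
    ∃ G : ℂ → Matrix (Conf k d) (Conf k d) ℂ,
      (∀ s, s ≠ 0 → EvalsTo (s * w)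
        (betheSeries (stringS ε k (fun i => s⁻¹ * x i + α i) d (kMatrix δ))) (G s)) ∧
      FirstOrder G 0 (Matrix.diagonal fun c => (2 * w * ∏ p, (1 - w ^ 2 * x p ^ 2)) *
        (∑ p, confWeight k d c p * (1 - w ^ 2 * x p ^ 2)⁻¹ + (δ - 1 / 2))) := by
  have hx' : ∀ i, (1 + w * x i) * (1 + -w * x i) ≠ 0 := fun i => by
    convert hx i using 1
    ring
  obtain ⟨F, D, h1, h2, h3⟩ := exists_leadingTerm w k x α d fun i => left_ne_zero_of_mul (hx' i)
  obtain ⟨F', D', h1', h2', h3'⟩ :=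
    exists_leadingTerm (-w) k x α d fun i => right_ne_zero_of_mul (hx' i)
  refine ⟨_, fun s hs => evalsTo_betheSeries ε δ (h1 s hs) (h1' s hs), ?_⟩
  have h4 := firstOrder_betheSeries ε w δ h2 h2'
  rw [h3, h3', ← Matrix.diagonal_one, ← Matrix.diagonal_smul, ← Matrix.diagonal_smul,
    ← Matrix.diagonal_smul, Matrix.diagonal_neg, Matrix.diagonal_add, Matrix.diagonal_add] at h4
  refine cast (congrArg (FirstOrder _ 0) (congrArg Matrix.diagonal (funext fun c => ?_))) h4
  have a3 : ∏ p, (1 - w ^ 2 * x p ^ 2) = (∏ p, (1 + w * x p)) * ∏ p, (1 + -w * x p) := by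
    rw [← Finset.prod_mul_distrib]
    exact Finset.prod_congr rfl fun p _ => by ring
  have a4 : ∀ p, (1 - w ^ 2 * x p ^ 2)⁻¹ = ((1 + w * x p)⁻¹ + (1 + -w * x p)⁻¹) / 2 := by
    intro p
    have b1 := left_ne_zero_of_mul (hx' p)
    have b2 := right_ne_zero_of_mul (hx' p)
    rw [show 1 - w ^ 2 * x p ^ 2 = (1 + w * x p) * (1 + -w * x p) by ring]
    have b3 : (1 + w * x p) + (1 + -w * x p) = 2 := by ring
    generalize 1 + w * x p = q at *
    generalize 1 + -w * x p = r at *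
    field_simp
    exact b3.symm.trans (add_comm q r)
  have a5 : ∑ p, confWeight k d c p * (1 - w ^ 2 * x p ^ 2)⁻¹
      = (∑ p, confWeight k d c p * (1 + w * x p)⁻¹
        + ∑ p, confWeight k d c p * (1 + -w * x p)⁻¹) / 2 := by
    rw [← Finset.sum_add_distrib, Finset.sum_div]
    exact Finset.sum_congr rfl fun p _ => by rw [a4]; ring
  rw [a3, a5]
  simp only [Pi.smul_apply, smul_eq_mul]
  ring


/-! ### Elements of the Bethe subalgebra -/

section Elements

variable {A : Type*} [Ring A] [Algebra ℂ A]

theorem scal_map {A' : Type*} [Ring A'] [Algebra ℂ A'] (φ : A →ₐ[ℂ] A') (f : PowerSeries ℂ) :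
    PowerSeries.map φ.toRingHom (scal A f) = scal A' f := by
  refine PowerSeries.ext fun n => ?_
  simp [scal]

theorem betheSeries_map {A' : Type*} [Ring A'] [Algebra ℂ A'] (φ : A →ₐ[ℂ] A')
    (S : Matrix Idx Idx (PowerSeries A)) :
    betheSeries (S.map (PowerSeries.map φ.toRingHom))
      = PowerSeries.map φ.toRingHom (betheSeries S) := by
  rw [betheSeries, betheSeries, map_mul, scal_map, trC, trC, map_sub]
  rfl

theorem sigmaOneFactor_ne_zero (ε : ℤˣ) : PowerSeries.constantCoeff (sigmaOneFactor ε) ≠ 0 := by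
  simp [sigmaOneFactor, invAffine]

theorem coeff_scal_mem (P : Subalgebra ℂ A) (f : PowerSeries ℂ) (n : ℕ) :
    PowerSeries.coeff n (scal A f) ∈ P := by
  rw [scal, PowerSeries.coeff_map]
  exact P.algebraMap_mem _

/-- The series `σ₁(u)` and `s₁₁(u) - s_{-1,-1}(u)` differ by an invertible scalar series. -/
theorem coeff_trC_mem (ε : ℤˣ) (n : ℕ) :
    PowerSeries.coeff n (trC (genMatrix (sGen ε))) ∈ betheSubalgebra ε := by
  have h : trC (genMatrix (sGen ε))
      = scal _ (sigmaOneFactor ε)⁻¹ * sigmaOne ε (genMatrix (sGen ε)) := by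
    rw [sigmaOne_eq, ← mul_assoc, ← map_mul, PowerSeries.inv_mul_cancel _
      (sigmaOneFactor_ne_zero ε), map_one, one_mul]
  rw [h]
  exact coeff_mul_mem (betheSubalgebra ε) (coeff_scal_mem _ _)
    (fun m => Algebra.subset_adjoin (Or.inl ⟨m, rfl⟩)) n

theorem coeff_betheSeries_mem (ε : ℤˣ) (n : ℕ) :
    PowerSeries.coeff n (betheSeries (genMatrix (sGen ε))) ∈ betheSubalgebra ε :=
  coeff_mul_mem _ (coeff_scal_mem _ _) (coeff_trC_mem ε) n

theorem commute_coeff_trC_sGen (ε : ℤˣ) (m n : ℕ) :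
    Commute (PowerSeries.coeff m (trC (genMatrix (sGen ε))))
      (PowerSeries.coeff n (trC (genMatrix (sGen ε)))) := by
  have e : ∀ n, ((PowerSeries.coeff n (trC (genMatrix (sGen ε))) : TwistedYangian ε) : Yangian)
      = PowerSeries.coeff n (trC (sMatrix ε (genMatrix Yangian.t))) := by
    intro n
    rw [trC, trC, map_sub, map_sub, coeff_genMatrix, coeff_genMatrix]
    rfl
  refine Subtype.ext ?_
  rw [Subalgebra.coe_mul, Subalgebra.coe_mul, e, e]
  exact commute_coeff_trC Yangian.isRTT_t ε m n

theorem commute_coeff_scal_mul {f g : PowerSeries A} (p q : PowerSeries ℂ)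
    (h : ∀ m n, Commute (PowerSeries.coeff m f) (PowerSeries.coeff n g)) (m n : ℕ) :
    Commute (PowerSeries.coeff m (scal A p * f)) (PowerSeries.coeff n (scal A q * g)) := by
  rw [PowerSeries.coeff_mul, PowerSeries.coeff_mul]
  refine Commute.sum_left _ _ _ fun i _ => Commute.sum_right _ _ _ fun j _ => ?_
  simp only [scal, PowerSeries.coeff_map]
  exact ((Algebra.commute_algebraMap_left _ _).mul_right
    (Algebra.commute_algebraMap_left _ _)).mul_left
      ((Algebra.commute_algebraMap_right _ _).mul_right (h _ _))

theorem commute_sigmaOne_betheSeries (ε : ℤˣ) (m n : ℕ) :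
    Commute (PowerSeries.coeff m (sigmaOne ε (genMatrix (sGen ε))))
      (PowerSeries.coeff n (betheSeries (genMatrix (sGen ε)))) := by
  rw [sigmaOne_eq, betheSeries]
  exact commute_coeff_scal_mul _ _ (commute_coeff_trC_sGen ε) m n

end Elements

/-- The partial sums of `c (b₀ + b₁ z + b₂ z² + ⋯)`, where the `b_i` are the coefficients of
`betheSeries`. -/
def bethePoint (ε : ℤˣ) (c z : ℂ) (n : ℕ) : TwistedYangian ε :=
  c • ∑ i ∈ Finset.range n, z ^ i • PowerSeries.coeff i (betheSeries (genMatrix (sGen ε)))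

theorem bethePoint_mem (ε : ℤˣ) (c z : ℂ) (n : ℕ) : bethePoint ε c z n ∈ betheSubalgebra ε :=
  Subalgebra.smul_mem _ (Subalgebra.sum_mem _ fun _ _ =>
    Subalgebra.smul_mem _ (coeff_betheSeries_mem ε _) _) _

/-- To commute with the Bethe subalgebra, `bethePoint` only has to commute with `σ₂(u)`. -/
theorem commute_act_bethePoint {ε : ℤˣ} {N : TwistedModule ε} {c z : ℂ} {m : ℕ}
    (h : ∀ n, Commute (N.act (PowerSeries.coeff n (sigmaTwo ε (genMatrix (sGen ε)))))
      (N.act (bethePoint ε c z m))) {x : TwistedYangian ε} (hx : x ∈ betheSubalgebra ε) :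
    Commute (N.act x) (N.act (bethePoint ε c z m)) := by
  induction hx using Algebra.adjoin_induction with
  | mem x hx =>
    rcases hx with ⟨n, rfl⟩ | ⟨n, rfl⟩
    · refine Commute.map (Commute.smul_right (Commute.sum_right _ _ _ fun i _ =>
        Commute.smul_right (commute_sigmaOne_betheSeries ε n i) _) _) N.act
    · exact h n
  | algebraMap r =>
    rw [AlgHom.commutes]
    exact Algebra.commute_algebraMap_left _ _
  | add x y _ _ hx hy =>
    rw [map_add]
    exact hx.add_left hy
  | mul x y _ _ hx hy =>
    rw [map_mul]
    exact hx.mul_left hy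

theorem Realizes.eventually_bethePoint {ε : ℤˣ} {N : TwistedModule ε} {k : ℕ} {α : Fin k → ℂ}
    {d : Fin k → ℕ} {δ : ℂ} {b : Module.Basis (Conf k d) ℂ N.carrier} (h : Realizes N α d δ b)
    {z : ℂ} {G : Matrix (Conf k d) (Conf k d) ℂ}
    (hG : EvalsTo z (betheSeries (stringS ε k α d (kMatrix δ))) G) (c : ℂ) :
    ∀ᶠ n in Filter.atTop, LinearMap.toMatrix b b (N.act (bethePoint ε c z n)) = c • G := by
  filter_upwards [hG.eventually_eq] with n hn
  rw [← hn, ← h.map_genMatrix, betheSeries_map]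
  set φ := (LinearMap.toMatrixAlgEquiv b).toAlgHom.comp N.act
  change φ (bethePoint ε c z n) = _
  simp only [bethePoint, map_smul, map_sum, PowerSeries.coeff_map]
  rfl

open scoped Topology in
/-- The perturbation argument: the matrix of an element of the Bethe subalgebra tends to a diagonal
matrix with distinct entries. The element `bethePoint ε s⁻¹ (s * w) n` depends on `s`, and `n` only
has to exceed the degree of a polynomial in `u⁻¹`. -/
theorem eventually_hasSimpleSpectrum_of_tendsto {ε : ℤˣ} {M : ℂ → TwistedModule ε} {I : Type*}
    [Fintype I] [DecidableEq I] {b : ∀ s, Module.Basis I ℂ (M s).carrier} {w : ℂ}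
    {G : ℂ → Matrix I I ℂ} {h : I → ℂ} (hh : Function.Injective h)
    (hG : Filter.Tendsto (fun s => s⁻¹ • G s) (𝓝[≠] 0) (𝓝 (Matrix.diagonal h)))
    (h1 : ∀ s, s ≠ 0 → ∀ᶠ n in Filter.atTop, LinearMap.toMatrix (b s) (b s)
      ((M s).act (bethePoint ε s⁻¹ (s * w) n)) = s⁻¹ • G s)
    (h2 : ∀ s c z m n, Commute ((M s).act (PowerSeries.coeff n (sigmaTwo ε (genMatrix (sGen ε)))))
      ((M s).act (bethePoint ε c z m))) :
    ∀ᶠ s in 𝓝[≠] 0, HasSimpleSpectrum (betheSubalgebra ε) (M s) := by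
  filter_upwards [hG.eventually (eventually_charpoly_separable hh), self_mem_nhdsWithin]
    with s hs hs0
  obtain ⟨n, hn⟩ := (h1 s hs0).exists
  have := Module.Finite.of_basis (b s)
  refine hasSimpleSpectrum_of_charpoly (bethePoint_mem ε s⁻¹ (s * w) n) ?_
    fun x hx => commute_act_bethePoint (h2 s _ _ _) hx
  rwa [← LinearMap.charpoly_toMatrix _ (b s), hn]

/-- The leading eigenvalue attached to a basis vector with weights `h`, up to the common factor
`2 w ∏ (1 - w² x_p²)` and the common summand `-1/2`. -/
def leadingLabel {k : ℕ} (x : Fin k → ℂ) (w : ℂ) (h : Fin k → ℂ) (δ : ℂ) : ℂ :=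
  ∑ p, h p * (1 - w ^ 2 * x p ^ 2)⁻¹ + δ

section Families

open scoped Topology

variable {ε : ℤˣ} {k : ℕ} {x α α' : Fin k → ℂ} {d d' : Fin k → ℕ} {δ δ' w : ℂ}
  {N N' : ℂ → TwistedModule ε}

theorem eventually_hasSimpleSpectrum {b : ∀ s, Module.Basis (Conf k d) ℂ (N s).carrier}
    (hb : ∀ s, Realizes (N s) (fun i => s⁻¹ * x i + α i) d δ (b s)) {σ : PowerSeries ℂ}
    (hσ : IsSigma ε (kMatrix δ) σ) (hw : w ≠ 0) (hx : ∀ i, 1 - w ^ 2 * x i ^ 2 ≠ 0)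
    (hinj : Function.Injective fun c => leadingLabel x w (confWeight k d c) δ) :
    ∀ᶠ s in 𝓝[≠] 0, HasSimpleSpectrum (betheSubalgebra ε) (N s) := by
  obtain ⟨G, hG1, hG2⟩ := exists_leadingTerm_betheSeries ε δ α d hx
  refine eventually_hasSimpleSpectrum_of_tendsto (b := b) (w := w) ?_ hG2.tendsto
    (fun s hs => (hb s).eventually_bethePoint (hG1 s hs) s⁻¹) fun s c z m n => ?_
  · intro c c' h
    have hne : (2 * w * ∏ p, (1 - w ^ 2 * x p ^ 2)) ≠ 0 :=
      mul_ne_zero (mul_ne_zero two_ne_zero hw) (Finset.prod_ne_zero_iff.mpr fun i _ => hx i)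
    refine hinj ?_
    simp only [leadingLabel]
    linear_combination mul_left_cancel₀ hne h
  · rw [(hb s).act_sigmaTwo hσ]
    exact Algebra.commute_algebraMap_left _ _

theorem eventually_hasSimpleSpectrum_directSum
    {b : ∀ s, Module.Basis (Conf k d) ℂ (N s).carrier}
    {b' : ∀ s, Module.Basis (Conf k d') ℂ (N' s).carrier}
    (hb : ∀ s, Realizes (N s) (fun i => s⁻¹ * x i + α i) d δ (b s))
    (hb' : ∀ s, Realizes (N' s) (fun i => s⁻¹ * x i + α' i) d' δ' (b' s)) {σ σ' : PowerSeries ℂ}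
    (hσ : IsSigma ε (kMatrix δ) σ) (hσ' : IsSigma ε (kMatrix δ') σ') (hw : w ≠ 0)
    (hx : ∀ i, 1 - w ^ 2 * x i ^ 2 ≠ 0)
    (hinj : Function.Injective (Sum.elim (fun c => leadingLabel x w (confWeight k d c) δ)
      fun c => leadingLabel x w (confWeight k d' c) δ')) :
    ∀ᶠ s in 𝓝[≠] 0, HasSimpleSpectrum (betheSubalgebra ε) ((N s).directSum (N' s)) := by
  obtain ⟨G, hG1, hG2⟩ := exists_leadingTerm_betheSeries ε δ α d hx
  obtain ⟨G', hG1', hG2'⟩ := exists_leadingTerm_betheSeries ε δ' α' d' hx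
  set κ := 2 * w * ∏ p, (1 - w ^ 2 * x p ^ 2) with hκ
  have hne : κ ≠ 0 :=
    mul_ne_zero (mul_ne_zero two_ne_zero hw) (Finset.prod_ne_zero_iff.mpr fun i _ => hx i)
  have hact : ∀ s (z : TwistedYangian ε), ((N s).directSum (N' s)).act z
      = LinearMap.prodMap ((N s).act z) ((N' s).act z) := fun _ _ => rfl
  have hh : Function.Injective (Sum.elim
      (fun c => κ * (∑ p, confWeight k d c p * (1 - w ^ 2 * x p ^ 2)⁻¹ + (δ - 1 / 2)))
      fun c => κ * (∑ p, confWeight k d' c p * (1 - w ^ 2 * x p ^ 2)⁻¹ + (δ' - 1 / 2))) := by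
    have e : (Sum.elim
      (fun c => κ * (∑ p, confWeight k d c p * (1 - w ^ 2 * x p ^ 2)⁻¹ + (δ - 1 / 2)))
      fun c => κ * (∑ p, confWeight k d' c p * (1 - w ^ 2 * x p ^ 2)⁻¹ + (δ' - 1 / 2)))
      = (fun l => κ * (l - 1 / 2)) ∘ (Sum.elim (fun c => leadingLabel x w (confWeight k d c) δ)
        fun c => leadingLabel x w (confWeight k d' c) δ') := by
      funext c
      rcases c with c | c <;>
        simp only [Function.comp_apply, Sum.elim_inl, Sum.elim_inr, leadingLabel] <;> ring
    rw [e]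
    refine Function.Injective.comp (fun l l' h => ?_) hinj
    linear_combination mul_left_cancel₀ hne h
  have hcont : Continuous fun p :
      Matrix (Conf k d) (Conf k d) ℂ × Matrix (Conf k d') (Conf k d') ℂ =>
      Matrix.fromBlocks p.1 0 0 p.2 := by fun_prop
  have htend := (hcont.tendsto _).comp (hG2.tendsto.prodMk_nhds hG2'.tendsto)
  rw [Matrix.fromBlocks_diagonal] at htend
  refine eventually_hasSimpleSpectrum_of_tendsto (M := fun s => (N s).directSum (N' s))
    (b := fun s => (b s).prod (b' s)) (w := w) (G := fun s => Matrix.fromBlocks (G s) 0 0 (G' s))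
    hh ?_ (fun s hs => ?_) fun s c z m n => ?_
  · refine htend.congr fun s => ?_
    simp [Matrix.fromBlocks_smul]
  · filter_upwards [(hb s).eventually_bethePoint (hG1 s hs) s⁻¹,
      (hb' s).eventually_bethePoint (hG1' s hs) s⁻¹] with n hn hn'
    rw [hact, LinearMap.toMatrix_prodMap, hn, hn', Matrix.fromBlocks_smul, smul_zero, smul_zero]
  · rw [hact, (hb s).act_sigmaTwo hσ, (hb' s).act_sigmaTwo hσ', hact]
    refine LinearMap.ext fun p => ?_
    simp [Module.algebraMap_end_apply]

end Families


/-! ### Separation of the leading eigenvalues -/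

section Labels

variable {k : ℕ} {x : Fin k → ℂ}

/-- The numerator of `leadingLabel` as a polynomial in `y = w²`. -/
def labelNumerator (x : Fin k → ℂ) (g : Fin k → ℂ) (e : ℂ) : Polynomial ℂ :=
  ∑ p, Polynomial.C (g p) * ∏ q ∈ Finset.univ.erase p, (1 - Polynomial.C (x q ^ 2) * Polynomial.X)
    + Polynomial.C e * ∏ q, (1 - Polynomial.C (x q ^ 2) * Polynomial.X)

theorem eval_labelNumerator (x g : Fin k → ℂ) (e y : ℂ) :
    (labelNumerator x g e).eval y = ∑ p, g p * ∏ q ∈ Finset.univ.erase p, (1 - x q ^ 2 * y)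
      + e * ∏ q, (1 - x q ^ 2 * y) := by
  simp [labelNumerator, Polynomial.eval_finsetSum, Polynomial.eval_prod]

/-- Partial fractions with distinct poles: a label that vanishes identically has vanishing residues
at `y = x_p⁻²` whenever `x_p ≠ 0`, and vanishing value at `y = 0`. -/
theorem labelNumerator_ne_zero (hx : ∀ i j, i ≠ j → x i ^ 2 ≠ x j ^ 2) {g : Fin k → ℂ} {e : ℂ}
    (h : (∀ p, x p ≠ 0 → g p = 0) → ∑ p, g p + e ≠ 0) : labelNumerator x g e ≠ 0 := by
  intro h0
  have hev := fun y => eval_labelNumerator x g e y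
  simp only [h0, Polynomial.eval_zero] at hev
  refine h (fun p hp => ?_) ?_
  · have h1 := hev (x p ^ 2)⁻¹
    have h2 : 1 - x p ^ 2 * (x p ^ 2)⁻¹ = 0 := by
      rw [mul_inv_cancel₀ (pow_ne_zero 2 hp), sub_self]
    rw [Finset.prod_eq_zero (Finset.mem_univ p) h2, mul_zero, add_zero,
      Finset.sum_eq_single p] at h1
    · refine (mul_eq_zero.mp h1.symm).resolve_right (Finset.prod_ne_zero_iff.mpr fun q hq => ?_)
      intro h3
      apply hx q p (Finset.ne_of_mem_erase hq)
      have h4 := pow_ne_zero 2 hp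
      field_simp at h3
      linear_combination -h3
    · intro q _ hq
      rw [Finset.prod_eq_zero (Finset.mem_erase.mpr ⟨hq.symm, Finset.mem_univ p⟩) h2, mul_zero]
    · exact fun h => absurd (Finset.mem_univ p) h
  · have h1 := hev 0
    simpa using h1.symm

/-- A finite family of labels is pairwise distinct at some `w`, as soon as no two of them have the
same residues and the same value at `w = 0`. -/
theorem exists_separating_point {L : Type*} [Finite L] (hx : ∀ i j, i ≠ j → x i ^ 2 ≠ x j ^ 2)
    (h : L → Fin k → ℂ) (δ : L → ℂ)
    (H : ∀ l l', (∀ p, x p ≠ 0 → h l p = h l' p) → ∑ p, h l p + δ l = ∑ p, h l' p + δ l' →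
      l = l') :
    ∃ w : ℂ, w ≠ 0 ∧ (∀ p, 1 - w ^ 2 * x p ^ 2 ≠ 0) ∧
      Function.Injective fun l => leadingLabel x w (h l) (δ l) := by
  have := Fintype.ofFinite {q : L × L // q.1 ≠ q.2}
  set Q : Polynomial ℂ := ∏ p, (1 - Polynomial.C (x p ^ 2) * Polynomial.X)
  set P : Polynomial ℂ := ∏ q : {q : L × L // q.1 ≠ q.2},
    labelNumerator x (fun p => h q.1.1 p - h q.1.2 p) (δ q.1.1 - δ q.1.2)
  have hQ : Q ≠ 0 := by
    refine Finset.prod_ne_zero_iff.mpr fun p _ h0 => ?_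
    have := congrArg (Polynomial.eval 0) h0
    simp at this
  have hP : P ≠ 0 := by
    refine Finset.prod_ne_zero_iff.mpr fun q _ => labelNumerator_ne_zero hx fun h1 h2 => q.2 ?_
    refine H _ _ (fun p hp => sub_eq_zero.mp (h1 p hp)) ?_
    rw [Finset.sum_sub_distrib] at h2
    linear_combination h2
  obtain ⟨y, hy⟩ : ∃ y, (Polynomial.X * Q * P).eval y ≠ 0 := by
    by_contra! h0
    exact mul_ne_zero (mul_ne_zero Polynomial.X_ne_zero hQ) hP
      (Polynomial.funext fun y => by rw [h0, Polynomial.eval_zero])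
  obtain ⟨w, rfl⟩ := IsAlgClosed.exists_pow_nat_eq y two_pos
  rw [Polynomial.eval_mul, Polynomial.eval_mul, Polynomial.eval_X] at hy
  have h1 := right_ne_zero_of_mul (left_ne_zero_of_mul hy)
  have h2 := right_ne_zero_of_mul hy
  rw [Polynomial.eval_prod, Finset.prod_ne_zero_iff] at h1 h2
  have h3 : ∀ p, 1 - w ^ 2 * x p ^ 2 ≠ 0 := fun p => by
    have := h1 p (Finset.mem_univ p)
    rw [mul_comm]
    simpa using this
  refine ⟨w, fun h0 => left_ne_zero_of_mul (left_ne_zero_of_mul hy) (by rw [h0]; simp), h3,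
    fun l l' hl => ?_⟩
  by_contra hne
  refine h2 ⟨(l, l'), hne⟩ (Finset.mem_univ _) ?_
  rw [eval_labelNumerator]
  simp only [leadingLabel] at hl
  have e1 : ∀ p, ∏ q ∈ Finset.univ.erase p, (1 - x q ^ 2 * w ^ 2)
      = (1 - w ^ 2 * x p ^ 2)⁻¹ * ∏ q, (1 - x q ^ 2 * w ^ 2) := by
    intro p
    rw [← Finset.mul_prod_erase _ _ (Finset.mem_univ p), mul_comm (x p ^ 2), ← mul_assoc,
      inv_mul_cancel₀ (h3 p), one_mul]
  have e2 : ∑ p, (h l p - h l' p) * ((1 - w ^ 2 * x p ^ 2)⁻¹ * ∏ q, (1 - x q ^ 2 * w ^ 2))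
      = (∑ p, h l p * (1 - w ^ 2 * x p ^ 2)⁻¹ - ∑ p, h l' p * (1 - w ^ 2 * x p ^ 2)⁻¹)
        * ∏ q, (1 - x q ^ 2 * w ^ 2) := by
    rw [← Finset.sum_sub_distrib, Finset.sum_mul]
    exact Finset.sum_congr rfl fun p _ => by ring
  simp only [e1]
  rw [e2]
  linear_combination (∏ q, (1 - x q ^ 2 * w ^ 2)) * hl

theorem confWeight_injective : ∀ (k : ℕ) (d : Fin k → ℕ), Function.Injective (confWeight k d)
  | 0, _, _, _, _ => Subsingleton.elim (α := Unit) _ _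
  | k + 1, d, c, c', h => by
    have h0 := congrFun h 0
    simp only [confWeight, Fin.cons_zero] at h0
    have h1 : confWeight k (fun i => d i.succ) c.2 = confWeight k (fun i => d i.succ) c'.2 := by
      funext i
      have := congrFun h i.succ
      simpa only [confWeight, Fin.cons_succ] using this
    refine Prod.ext (Fin.ext ?_) (confWeight_injective k _ h1)
    have h2 : (((c.1 : Fin (d 0 + 1)) : ℕ) : ℂ) = ((c'.1 : Fin (d 0 + 1)) : ℕ) := by
      linear_combination -h0 / 2
    exact_mod_cast h2

/-- The parity of the total weight is constant on a module. -/
theorem exists_sum_confWeight : ∀ (k : ℕ) (d : Fin k → ℕ) (c : Conf k d),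
    ∃ m : ℤ, ∑ p, confWeight k d c p = ∑ p, (d p : ℂ) - 2 * m
  | 0, _, _ => ⟨0, by simp⟩
  | k + 1, d, c => by
    obtain ⟨m, hm⟩ := exists_sum_confWeight k (fun i => d i.succ) c.2
    refine ⟨m + ((c.1 : Fin (d 0 + 1)) : ℕ), ?_⟩
    rw [Fin.sum_univ_succ, Fin.sum_univ_succ]
    simp only [confWeight, Fin.cons_zero, Fin.cons_succ]
    rw [hm]
    push_cast
    ring

theorem conf_eq_of_confWeight (hx : ∀ i j, i ≠ j → x i ^ 2 ≠ x j ^ 2) {d : Fin k → ℕ}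
    {c c' : Conf k d} (h : ∀ p, x p ≠ 0 → confWeight k d c p = confWeight k d c' p)
    (hs : ∑ p, confWeight k d c p = ∑ p, confWeight k d c' p) : c = c' := by
  refine confWeight_injective k d (funext fun p => ?_)
  by_cases hp : x p = 0
  -- at most one of the `x p` vanishes, and the sum determines the weight there
  · rw [← sub_eq_zero, ← Finset.sum_sub_distrib, Finset.sum_eq_single p] at hs
    · exact sub_eq_zero.mp hs
    · intro q _ hq
      rw [h q, sub_self]
      intro hq0
      exact hx q p hq (by rw [hq0, hp])
    · exact fun h => absurd (Finset.mem_univ p) h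
  · exact h p hp

theorem exists_separating_point_conf (hx : ∀ i j, i ≠ j → x i ^ 2 ≠ x j ^ 2) (d : Fin k → ℕ)
    (δ : ℂ) : ∃ w : ℂ, w ≠ 0 ∧ (∀ p, 1 - w ^ 2 * x p ^ 2 ≠ 0) ∧
      Function.Injective fun c => leadingLabel x w (confWeight k d c) δ :=
  exists_separating_point hx _ (fun _ => δ) fun _ _ h1 h2 =>
    conf_eq_of_confWeight hx h1 (add_right_cancel h2)

theorem exists_separating_point_sum (hx : ∀ i j, i ≠ j → x i ^ 2 ≠ x j ^ 2) (d d' : Fin k → ℕ)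
    {δ δ' : ℂ} (h : ∀ m : ℤ, (∑ p, (d p : ℂ) + δ) - (∑ p, (d' p : ℂ) + δ') ≠ 2 * m) :
    ∃ w : ℂ, w ≠ 0 ∧ (∀ p, 1 - w ^ 2 * x p ^ 2 ≠ 0) ∧
      Function.Injective (Sum.elim (fun c => leadingLabel x w (confWeight k d c) δ)
        fun c => leadingLabel x w (confWeight k d' c) δ') := by
  have key : ∀ (c : Conf k d) (c' : Conf k d'),
      ∑ p, confWeight k d c p + δ ≠ ∑ p, confWeight k d' c' p + δ' := by
    intro c c' e
    obtain ⟨m, hm⟩ := exists_sum_confWeight k d c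
    obtain ⟨m', hm'⟩ := exists_sum_confWeight k d' c'
    refine h (m - m') ?_
    push_cast
    linear_combination e - hm + hm'
  obtain ⟨w, h1, h2, h3⟩ := exists_separating_point (L := Conf k d ⊕ Conf k d') hx
    (Sum.elim (confWeight k d) (confWeight k d')) (Sum.elim (fun _ => δ) fun _ => δ') (by
      rintro (c | c) (c' | c') h1 h2
      · rw [conf_eq_of_confWeight hx h1 (add_right_cancel h2)]
      · exact absurd h2 (key c c')
      · exact absurd h2.symm (key c' c)
      · rw [conf_eq_of_confWeight hx h1 (add_right_cancel h2)])
  refine ⟨w, h1, h2, ?_⟩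
  convert h3 using 1
  funext l
  rcases l with l | l <;> rfl

end Labels

/-! ### Simple spectrum for large parameters -/

section Large

open scoped Topology

variable {k : ℕ} {x : Fin k → ℂ}

theorem eventually_cobounded_of_inv {P : ℂ → Prop} (h : ∀ᶠ s in 𝓝[≠] (0 : ℂ), P s⁻¹) :
    ∀ᶠ t in Bornology.cobounded ℂ, P t := by
  have hlim : Filter.Tendsto (fun t : ℂ => t⁻¹) (Bornology.cobounded ℂ) (𝓝[≠] 0) :=
    tendsto_nhdsWithin_iff.mpr ⟨Filter.tendsto_inv₀_cobounded,
      (Bornology.eventually_ne_cobounded 0).mono fun _ ht => inv_ne_zero ht⟩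
  simpa only [inv_inv] using hlim.eventually h

/-- The tensor product itself is treated as its product with the trivial representation, whose
matrix `S(u) = 1` agrees with that of `W(1/2)`. -/
theorem eventually_hasSimpleSpectrum_restrict (ε : ℤˣ) (hx : ∀ i j, i ≠ j → x i ^ 2 ≠ x j ^ 2)
    (α : Fin k → ℂ) (d : Fin k → ℕ) :
    ∀ᶠ t in Bornology.cobounded ℂ, HasSimpleSpectrum (betheSubalgebra ε)
      ((stringModule (fun i => t * x i + α i) d).restrict ε) := by
  obtain ⟨w, h1, h2, h3⟩ := exists_separating_point_conf hx d (1 / 2)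
  obtain ⟨σ, hσ⟩ := exists_isSigma_half ε
  choose b hb using fun s : ℂ => exists_realizes_restrict ε k (fun i => s⁻¹ * x i + α i) d
  exact eventually_cobounded_of_inv (eventually_hasSimpleSpectrum hb hσ h1 h2 h3)

theorem eventually_hasSimpleSpectrum_stringModuleW (hx : ∀ i j, i ≠ j → x i ^ 2 ≠ x j ^ 2)
    (α : Fin k → ℂ) (d : Fin k → ℕ) (δ : ℂ) :
    ∀ᶠ t in Bornology.cobounded ℂ, HasSimpleSpectrum (betheSubalgebra 1)
      (stringModuleW (fun i => t * x i + α i) d δ) := by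
  obtain ⟨w, h1, h2, h3⟩ := exists_separating_point_conf hx d δ
  obtain ⟨σ, hσ⟩ := isSigma_kMatrix δ
  choose b hb using fun s : ℂ => exists_realizes_stringModuleW k (fun i => s⁻¹ * x i + α i) d δ
  exact eventually_cobounded_of_inv (eventually_hasSimpleSpectrum hb hσ h1 h2 h3)

/-- The leading eigenvalues on the two summands are separated by a parity argument. -/
theorem eventually_hasSimpleSpectrum_stringModuleW_directSum
    (hx : ∀ i j, i ≠ j → x i ^ 2 ≠ x j ^ 2) (α α' : Fin k → ℂ) (d d' : Fin k → ℕ) {δ δ' : ℂ}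
    (h : ∀ m : ℤ, (∑ p, (d p : ℂ) + δ) - (∑ p, (d' p : ℂ) + δ') ≠ 2 * m) :
    ∀ᶠ t in Bornology.cobounded ℂ, HasSimpleSpectrum (betheSubalgebra 1)
      ((stringModuleW (fun i => t * x i + α i) d δ).directSum
        (stringModuleW (fun i => t * x i + α' i) d' δ')) := by
  obtain ⟨w, h1, h2, h3⟩ := exists_separating_point_sum hx d d' h
  obtain ⟨σ, hσ⟩ := isSigma_kMatrix δ
  obtain ⟨σ', hσ'⟩ := isSigma_kMatrix δ'
  choose b hb using fun s : ℂ => exists_realizes_stringModuleW k (fun i => s⁻¹ * x i + α i) d δ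
  choose b' hb' using fun s : ℂ => exists_realizes_stringModuleW k (fun i => s⁻¹ * x i + α' i) d' δ'
  exact eventually_cobounded_of_inv
    (eventually_hasSimpleSpectrum_directSum hb hb' hσ hσ' h1 h2 h3)

/-- When the leading eigenvalues on two modules may coincide, `σ₂(u)` distinguishes between the
modules. -/
theorem hasSimpleSpectrum_directSum_of_siteFactor_ne {α α' : Fin k → ℂ} {d : Fin k → ℕ}
    (h : HasSimpleSpectrum (betheSubalgebra 1) (stringModuleW α d (1 / 2)))
    (h' : HasSimpleSpectrum (betheSubalgebra 1) (stringModuleW α' d (1 / 2))) {p : Fin k}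
    (hp : siteFactor (α p) (d p) ≠ siteFactor (α' p) (d p)) (hq : ∀ q, q ≠ p → α q = α' q) :
    HasSimpleSpectrum (betheSubalgebra 1)
      ((stringModuleW α d (1 / 2)).directSum (stringModuleW α' d (1 / 2))) := by
  -- `W(1/2)` is trivial, so that its own factor is `1`
  have hσ : IsSigma 1 (kMatrix (1 / 2)) 1 := by
    rw [kMatrix_half]
    exact isSigma_one_pos
  have hne : (∏ i, siteFactor (α i) (d i)) * 1 ≠ (∏ i, siteFactor (α' i) (d i)) * 1 := by
    rw [mul_one, mul_one, ← Finset.mul_prod_erase _ _ (Finset.mem_univ p),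
      ← Finset.mul_prod_erase _ (fun i => siteFactor (α' i) (d i)) (Finset.mem_univ p),
      Finset.prod_congr rfl fun q hq' => by rw [hq q (Finset.ne_of_mem_erase hq')]]
    exact fun e => hp (mul_right_cancel₀
      (Finset.prod_ne_zero_iff.mpr fun q _ => siteFactor_ne_zero _ _) e)
  obtain ⟨n, hn⟩ : ∃ n, PowerSeries.coeff n ((∏ i, siteFactor (α i) (d i)) * 1)
      ≠ PowerSeries.coeff n ((∏ i, siteFactor (α' i) (d i)) * 1) := by
    by_contra! e
    exact hne (PowerSeries.ext e)
  obtain ⟨b, hb⟩ := exists_realizes_stringModuleW k α d (1 / 2)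
  obtain ⟨b', hb'⟩ := exists_realizes_stringModuleW k α' d (1 / 2)
  exact h.directSum h' (Algebra.subset_adjoin (Or.inr ⟨n, rfl⟩)) (hb.act_sigmaTwo hσ n)
    (hb'.act_sigmaTwo hσ n) hn

end Large

end TwistedBethe
end

theorem mainTheorem5 (k : ℕ) (hk : 0 < k) (α : Fin k → ℂ) (d : Fin k → ℕ) (u : Fin k → ℂ)
    (hu : ∀ i j, i ≠ j → u i ^ 2 ≠ u j ^ 2) :
    ∃ R : ℝ, ∀ t : ℂ, R < ‖t‖ →
      HasSimpleSpectrum (betheSubalgebra (-1))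
        ((stringModule (fun i => t * u i + α i) d).restrict (-1)) ∧
      HasSimpleSpectrum (betheSubalgebra 1)
        ((stringModuleW (fun i => t * u i + α i) d 1).directSum
          (stringModuleW (fun i => t * u i + α i) d 0)) ∧
      (u ⟨0, hk⟩ ≠ 0 ∨ α ⟨0, hk⟩ + (α ⟨0, hk⟩ - d ⟨0, hk⟩) ≠ 1 →
        HasSimpleSpectrum (betheSubalgebra 1)
          ((stringModuleW (fun i => t * u i + α i) d (1 / 2)).directSum
            (stringModuleW
              (fun i => (if i = ⟨0, hk⟩ then t * u i - 1 else t * u i) + α i) d (1 / 2)))) ∧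
      (1 ≤ d ⟨0, hk⟩ →
        HasSimpleSpectrum (betheSubalgebra 1)
          ((stringModuleW (fun i => t * u i + α i) d (1 / 2)).directSum
            (stringModuleW
              (fun i => t * u i + (if i = ⟨0, hk⟩ then α i - 1 else α i))
              (fun i => if i = ⟨0, hk⟩ then d i - 1 else d i) (1 / 2)))) ∧
      (d ⟨0, hk⟩ = 0 →
        HasSimpleSpectrum (betheSubalgebra 1)
          (stringModuleW (fun i => t * u i + α i) d (1 / 2))) := by
  set p : Fin k := ⟨0, hk⟩ with hp
  have h1 := eventually_hasSimpleSpectrum_restrict (-1) hu α d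
  -- the total weights plus `δ` differ by an odd number
  have h2 := eventually_hasSimpleSpectrum_stringModuleW_directSum (δ := 1) (δ' := 0) hu α α d d
    (fun m e => by
      have e' : ((1 : ℤ) : ℂ) = ((2 * m : ℤ) : ℂ) := by
        push_cast
        linear_combination e
      have := Int.cast_injective e'
      omega)
  have h3 := eventually_hasSimpleSpectrum_stringModuleW hu α d (1 / 2)
  have h3' := eventually_hasSimpleSpectrum_stringModuleW hu
    (fun i => if i = p then α i - 1 else α i) d (1 / 2)
  -- the exceptional value of `t` at which `σ₂(u)` does not separate the two summands is avoided
  have hne : u p ≠ 0 ∨ α p + (α p - d p) ≠ 1 →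
      ∀ᶠ t in Bornology.cobounded ℂ, 2 * (t * u p + α p) - d p ≠ 1 := by
    intro h
    by_cases h0 : u p = 0
    · refine Filter.Eventually.of_forall fun t e => h.resolve_left (not_not_intro h0) ?_
      rw [h0] at e
      linear_combination e
    · refine (Bornology.eventually_ne_cobounded ((1 + d p - 2 * α p) / (2 * u p))).mono
        fun t ht e => ht ?_
      rw [eq_div_iff (mul_ne_zero two_ne_zero h0)]
      linear_combination e
  have h4 : 1 ≤ d p → ∀ᶠ t in Bornology.cobounded ℂ, HasSimpleSpectrum (betheSubalgebra 1)
      ((stringModuleW (fun i => t * u i + α i) d (1 / 2)).directSum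
        (stringModuleW (fun i => t * u i + (if i = p then α i - 1 else α i))
          (fun i => if i = p then d i - 1 else d i) (1 / 2))) := by
    intro hd
    have hsum : ∑ i, (d i : ℂ) = ∑ i, ((if i = p then d i - 1 else d i : ℕ) : ℂ) + 1 := by
      have herase : ∑ i ∈ Finset.univ.erase p, ((if i = p then d i - 1 else d i : ℕ) : ℂ)
          = ∑ i ∈ Finset.univ.erase p, (d i : ℂ) :=
        Finset.sum_congr rfl fun q hq => by rw [if_neg (Finset.ne_of_mem_erase hq)]
      rw [← Finset.add_sum_erase _ _ (Finset.mem_univ p),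
        ← Finset.add_sum_erase _ (fun i => ((if i = p then d i - 1 else d i : ℕ) : ℂ))
          (Finset.mem_univ p), herase, if_pos rfl, Nat.cast_sub hd]
      push_cast
      ring
    refine eventually_hasSimpleSpectrum_stringModuleW_directSum hu α _ d _ fun m e => ?_
    have e' : ((1 : ℤ) : ℂ) = ((2 * m : ℤ) : ℂ) := by
      push_cast
      linear_combination e - hsum
    have := Int.cast_injective e'
    omega
  have key := h1.and (h2.and ((h3.and h3').and
    ((Filter.eventually_imp_distrib_left.mpr hne).and
      (Filter.eventually_imp_distrib_left.mpr h4))))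
  obtain ⟨R, -, hR⟩ := (Filter.hasBasis_cobounded_norm (E := ℂ)).eventually_iff.mp key
  refine ⟨R, fun t ht => ?_⟩
  obtain ⟨k1, k2, ⟨k3, k3'⟩, k4, k5⟩ := hR ht.le
  refine ⟨k1, k2, fun h => ?_, k5, fun _ => k3⟩
  have hα : (fun i => (if i = p then t * u i - 1 else t * u i) + α i)
      = fun i => t * u i + if i = p then α i - 1 else α i := by
    funext i
    split_ifs <;> ring
  rw [hα]
  refine hasSimpleSpectrum_directSum_of_siteFactor_ne k3 k3' (p := p) ?_ fun q hq => ?_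
  · have := siteFactor_sub_one_ne (k4 h)
    simpa only [if_true, add_sub_assoc] using this
  · simp only [if_neg hq]
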